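/- The ground field is $\mathbb C$. A homomorphism of finite-dimensional Lie algebras with fixed Cartan subalgebras is a root homomorphism if it maps the Cartan subalgebra into the Cartan subalgebra and every root space into a root space (the zero image being allowed). Let $\mathfrak g=\varinjlim \mathfrak g_n\neq 0$ be a root reductive direct limit Lie algebra, i.e. the direct limit of a sequence $\mathfrak g_1\to\mathfrak g_2\to\cdots$ of finite-dimensional reductive Lie algebras with fixed Cartan subalgebras $\mathfrak h_n\subset\mathfrak g_n$ and root homomorphisms between them (not necessarily injective). Put $\mathfrak h=\varinjlim\mathfrak h_n\subset\mathfrak g$, and let $\Delta\subset\mathfrak h^*\setminus\{0\}$ be the set of roots and $\mathfrak g^\alpha$ ($\alpha\in\Delta$) the root spaces of $\mathfrak g$ with respect to $\mathfrak h$. Let $M$ be an irreducible weight $\mathfrak g$-module, i.e. an irreducible $\mathfrak g$-module with $M=\bigoplus_{\lambda\in\mathfrak h^*}M^\lambda$, $M^\lambda=\{m\in M : xm=\lambda(x)m\ \forall x\in\mathfrak h\}$; put $\operatorname{supp}M=\{\lambda : M^\lambda\neq0\}$. For $\alpha\in\Delta$ and $\lambda\in\operatorname{supp}M$ let $m_\alpha^\lambda=\{q\in\mathbb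 R : \lambda+q\alpha\in\operatorname{supp}M\}$. Let $\Delta_M^F$ (respectively $\Delta_M^I$) be the set of $\alpha\in\Delta$ such that for every $\lambda\in\operatorname{supp}M$ the set $m_\alpha^\lambda$ is bounded from above and from below (respectively unbounded from above and unbounded from below), and put $$\mathfrak g_M^F=\mathfrak h\oplus\bigoplus_{\alpha\in\Delta_M^F}\mathfrak g^\alpha,\qquad \mathfrak g_M^I=\mathfrak h\oplus\bigoplus_{\alpha\in\Delta_M^I}\mathfrak g^\alpha .$$ Call $M$ integrable if every element of $\mathfrak g$ acts locally finitely on $M$ (i.e. for all $x\in\mathfrak g$ and $m\in M$ the vectors $m,xm,x^2m,\dots$ span a finite-dimensional space), cuspidal if $\mathfrak g=\mathfrak g_M^I$, and finite integrable if it is integrable and $\mathfrak g=\mathfrak g_M^F$. (i) If $M$ is integrable, then $\mathfrak g=\mathfrak g_M^F+\mathfrak g_M^I$; if moreover $\mathfrak g\neq\mathfrak g_M^F$, then $\dim M^\lambda=\infty$ for every $\lambda\in\operatorname{supp}M$. (ii) Suppose that $\mathfrak g$ is infinite-dimensional and simple. Then every integrable irreducible weight $\mathfrak g$-module is either cuspidal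 or finite integrable (and not both), and both cases occur: $\mathfrak g$ has a cuspidal integrable irreducible weight module and a finite integrable irreducible weight module. -/

import Mathlib

universe u v w

/-! ### Weight modules, integrability, and the shadow of an irreducible weight module -/

section Weights

variable {g : Type u} [LieRing g] [LieAlgebra ℂ g] (h : LieSubalgebra ℂ g)
variable (M : Type w) [AddCommGroup M] [Module ℂ M] [LieRingModule g M] [LieModule ℂ g M]

/-- The weight space `M^μ = {m | x • m = μ(x) m for all x in h}`. On a weight module (where `h` acts
semisimply) it coincides with the generalized weight space of weight `μ`. -/
def wtSpace (μ : Module.Dual ℂ h) : Submodule ℂ M where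
  carrier := {m | ∀ x : h, ⁅(x : g), m⁆ = μ x • m}
  zero_mem' := by intro x; simp
  add_mem' := by
    intro a b ha hb x
    rw [lie_add, ha x, hb x, smul_add]
  smul_mem' := by
    intro c a ha x
    rw [lie_smul, ha x, smul_comm]

/-- The support of `M`: all weights whose weight space is non-zero. -/
def wtSupp : Set (Module.Dual ℂ h) := {μ | wtSpace h M μ ≠ ⊥}

/-- `M` is a weight module: it is the direct sum of its weight spaces. -/
def IsWeightModule : Prop :=
  iSupIndep (wtSpace h M) ∧ ⨆ μ, wtSpace h M μ = ⊤

/-- The set `Δ` of roots of `g` with respect to `h`. -/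
def rootSet : Set (Module.Dual ℂ h) := {α | α ≠ 0 ∧ wtSpace h g α ≠ ⊥}

variable (g) in
/-- `M` is integrable: every element of `g` acts locally finitely on `M`, that is, for `x` in `g`
and `m` in `M` the vectors `m, x m, x² m, …` span a finite-dimensional space. -/
def IsIntegrableModule : Prop :=
  ∀ (x : g) (m : M), FiniteDimensional ℂ
    (Submodule.span ℂ (Set.range fun k : ℕ => ((LieModule.toEnd ℂ g M x) ^ k) m))

/-- The set `m_α^μ` of real `q` with `μ + q α` in the support of `M`. -/
def wtString (μ α : Module.Dual ℂ h) : Set ℝ := {q | μ + (q : ℂ) • α ∈ wtSupp h M}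

/-- `Δ_M^F`: the roots `α` in whose direction the support of `M` is bounded on both sides
(through every point of the support). -/
def rootsF : Set (Module.Dual ℂ h) :=
  {α ∈ rootSet h | ∀ μ ∈ wtSupp h M,
    BddAbove (wtString h M μ α) ∧ BddBelow (wtString h M μ α)}

/-- `Δ_M^I`: the roots `α` in whose direction the support of `M` is unbounded on both sides
(through every point of the support). -/
def rootsI : Set (Module.Dual ℂ h) :=
  {α ∈ rootSet h | ∀ μ ∈ wtSupp h M,
    ¬ BddAbove (wtString h M μ α) ∧ ¬ BddBelow (wtString h M μ α)}

/-- `g_M^F = h ⊕ ⨁ g^α`, the sum over `α` in `Δ_M^F`. -/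
def shadowF : Submodule ℂ g := h.toSubmodule ⊔ ⨆ α ∈ rootsF h M, wtSpace h g α

/-- `g_M^I = h ⊕ ⨁ g^α`, the sum over `α` in `Δ_M^I`. -/
def shadowI : Submodule ℂ g := h.toSubmodule ⊔ ⨆ α ∈ rootsI h M, wtSpace h g α

/-- `M` is cuspidal: `g = g_M^I` (used for irreducible weight modules). -/
def IsCuspidalModule : Prop := shadowI h M = ⊤

/-- The condition `g = g_M^F`; an integrable module with this property is finite integrable. -/
def IsFiniteModule : Prop := shadowF h M = ⊤

end Weights

/-! ### Root reductive direct limits -/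

/-- A Lie algebra is reductive if its radical is its centre (used in finite dimension). -/
def IsReductiveLieAlgebra (g : Type v) [LieRing g] [LieAlgebra ℂ g] : Prop :=
  LieAlgebra.radical ℂ g = LieAlgebra.center ℂ g

/-- A root homomorphism between finite-dimensional Lie algebras with fixed Cartan subalgebras:
it maps the Cartan subalgebra into the Cartan subalgebra and each root space into a root space
(the zero image is always allowed, also when the target has no roots). -/
def IsRootHom {g : Type v} {g' : Type v} [LieRing g] [LieAlgebra ℂ g] [LieRing g'] [LieAlgebra ℂ g']
    (H : LieSubalgebra ℂ g) (H' : LieSubalgebra ℂ g')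
    [H.IsCartanSubalgebra] [H'.IsCartanSubalgebra] (φ : g →ₗ⁅ℂ⁆ g') : Prop :=
  (∀ x ∈ H, φ x ∈ H') ∧
  ∀ α : Module.Dual ℂ H, α ≠ 0 →
    (∀ x ∈ LieAlgebra.rootSpace H α, φ x = 0) ∨
    ∃ β : Module.Dual ℂ H', β ≠ 0 ∧
      ∀ x ∈ LieAlgebra.rootSpace H α, φ x ∈ LieAlgebra.rootSpace H' β

/-- A chain `G 0 → G 1 → G 2 → ⋯` of finite-dimensional reductive Lie algebras with fixed Cartan
subalgebras `H n` and root homomorphisms (not necessarily injective) between them. -/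
structure RootReductiveSystem where
  G : ℕ → Type v
  [lieRing : ∀ n, LieRing (G n)]
  [lieAlgebra : ∀ n, LieAlgebra ℂ (G n)]
  [finiteDimensional : ∀ n, FiniteDimensional ℂ (G n)]
  reductive : ∀ n, IsReductiveLieAlgebra (G n)
  H : ∀ n, LieSubalgebra ℂ (G n)
  [cartan : ∀ n, (H n).IsCartanSubalgebra]
  φ : ∀ n, G n →ₗ⁅ℂ⁆ G (n + 1)
  rootHom : ∀ n, IsRootHom (H n) (H (n + 1)) (φ n)

attribute [instance] RootReductiveSystem.lieRing RootReductiveSystem.lieAlgebra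
  RootReductiveSystem.finiteDimensional RootReductiveSystem.cartan

/-- The composite transition map `G n → G (n + k)`. -/
def RootReductiveSystem.trans (S : RootReductiveSystem.{v}) (n : ℕ) :
    ∀ k : ℕ, S.G n → S.G (n + k)
  | 0 => fun x => x
  | k + 1 => fun x => S.φ (n + k) (S.trans n k x)

/-- `g`, with the maps `ψ n : G n → g`, is the direct limit of the system, and `h` is the direct
limit of the Cartan subalgebras `H n` inside it. -/
structure RootReductiveSystem.IsDirectLimit (S : RootReductiveSystem.{v}) {g : Type u} [LieRing g]
    [LieAlgebra ℂ g] (h : LieSubalgebra ℂ g) (ψ : ∀ n, S.G n →ₗ⁅ℂ⁆ g) : Prop where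
  compat : ∀ n x, ψ (n + 1) (S.φ n x) = ψ n x
  surj : ∀ y : g, ∃ n, ∃ x : S.G n, ψ n x = y
  ker : ∀ n (x : S.G n), ψ n x = 0 → ∃ k, S.trans n k x = 0
  mem_iff : ∀ y : g, y ∈ h ↔ ∃ n, ∃ x ∈ S.H n, ψ n x = y

/-- The non-zero Lie algebra `g` with the subalgebra `h` is a root reductive direct limit Lie
algebra with its fixed Cartan subalgebra. -/
def IsRootReductiveDirectLimit {g : Type u} [LieRing g] [LieAlgebra ℂ g]
    (h : LieSubalgebra ℂ g) : Prop :=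
  Nontrivial g ∧ ∃ (S : RootReductiveSystem.{v}) (ψ : ∀ n, S.G n →ₗ⁅ℂ⁆ g), S.IsDirectLimit h ψ

/-! ### Weight vectors and their independence. -/

section WeightSpaces

variable {g : Type u} [LieRing g] [LieAlgebra ℂ g] {h : LieSubalgebra ℂ g}
variable {M : Type w} [AddCommGroup M] [Module ℂ M] [LieRingModule g M] [LieModule ℂ g M]

/-! A reductive algebra modulo its centre is semisimple, so the root spaces of each `G n` are lines
spanned by members of `sl₂`-triples. This survives in the limit and is packaged as a `RootData`
(`exists_rootData`), whose roots are exhausted by finite closed symmetric levels. All later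
arguments use only this package.

For (i), `sl₂`-theory makes the weights of an integrable module integral on coroots and its support
closed under root strings. If the `α`-string through `μ` is infinite and `α` is not orthogonal to
`δ`, then moving far along `α`, down along `δ` and back along `α` stays in the support, so the
`δ`-string is infinite too (`InfString.of_apply_c_ne_zero`). Together with irreducibility this shows
that finiteness of the `α`-strings does not depend on the weight (`InfString.of_mem_wtSupp`), so
every root lies in `rootsF` or in `rootsI`. If the strings of `α` are infinite and `μ` is
non-negative on the coroot (otherwise take `-α`), then `e_α^q` maps `M^μ` onto `M^(μ+qα)`, which is
non-zero for arbitrarily large `q`. On a finite-dimensional `M^μ` a fixed power of `e_α` would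
vanish, so `dim M^μ = ∞`.

For (ii), simplicity links all roots by non-orthogonality, so one infinite string makes all strings
infinite; this is the dichotomy. The adjoint module is finite integrable, because its root spaces
are lines and (i) would otherwise make them infinite-dimensional.

A cuspidal module is built as a limit of simple modules `G k` over the levels. Fix a long root `β`,
and let `G k` be the simple constituent of a `k`-th symmetric power that contains `e_β^k`. Infinite
dimension yields `z k` in `h` that commutes with level `k` but not with some root vector of level `k
+ 1`. Multiplication by `z k` followed by projection to `G (k+1)` commutes with level `k`. Two root
vectors carry `e_β^k z_k` to a non-zero multiple of `e_β^(k+1)` (`exists_lie_lie_eq`), so this map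
is non-zero and, by simplicity, injective. The limit is irreducible and integrable and has all `k β`
as weights, hence is not finite, hence is cuspidal. The projection is a polynomial in a Casimir
operator (`exists_isSimplePart`): its eigenvalue at `k β` occurs at no other sum of `k` roots or
zeros (`eq_nsmul_of_casimir_eq`), and `k β` has multiplicity one. -/

theorem lie_mem_wtSpace {α μ : Module.Dual ℂ h} {x : g} {m : M}
    (hx : x ∈ wtSpace h g α) (hm : m ∈ wtSpace h M μ) : ⁅x, m⁆ ∈ wtSpace h M (μ + α) := by
  intro y
  rw [leibniz_lie, hx y, hm y, smul_lie, lie_smul, ← add_smul, LinearMap.add_apply, add_comm]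

theorem pow_toEnd_mem_wtSpace {α μ : Module.Dual ℂ h} {x : g} {m : M}
    (hx : x ∈ wtSpace h g α) (hm : m ∈ wtSpace h M μ) (n : ℕ) :
    (LieModule.toEnd ℂ g M x ^ n) m ∈ wtSpace h M (μ + n • α) := by
  induction n with
  | zero => simpa using hm
  | succ n ih =>
    rw [pow_succ', Module.End.mul_apply, LieModule.toEnd_apply_apply, succ_nsmul, ← add_assoc]
    exact lie_mem_wtSpace hx ih

/-- Since `h` is abelian its elements act by commuting operators, whose simultaneous generalized
eigenspaces are independent; weight spaces sit inside these. -/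
theorem iSupIndep_wtSpace (hab : ∀ x ∈ h, ∀ y ∈ h, ⁅x, y⁆ = 0) : iSupIndep (wtSpace h M) := by
  have key := Module.End.independent_iInf_maxGenEigenspace_of_forall_mapsTo
    (fun x : h => LieModule.toEnd ℂ g M (x : g)) (fun i j φ => by
      refine Module.End.mapsTo_maxGenEigenspace_of_comm ?_ φ
      refine LinearMap.ext fun m => ?_
      simp only [Module.End.mul_apply, LieModule.toEnd_apply_apply]
      rw [leibniz_lie, hab _ j.2 _ i.2, zero_lie, zero_add])
  have h2 := key.comp (f := fun μ : Module.Dual ℂ h => (μ : h → ℂ)) DFunLike.coe_injective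
  refine h2.mono fun μ m hm => ?_
  simp only [Function.comp, Submodule.mem_iInf]
  intro x
  rw [Module.End.mem_maxGenEigenspace]
  exact ⟨1, by simp [hm x]⟩

theorem mem_wtSupp_of_ne_zero {μ : Module.Dual ℂ h} {m : M} (hm : m ∈ wtSpace h M μ)
    (h0 : m ≠ 0) : μ ∈ wtSupp h M := fun hb => h0 (by simpa [hb] using hm)

theorem exists_ne_zero_of_mem_wtSupp {μ : Module.Dual ℂ h} (hμ : μ ∈ wtSupp h M) :
    ∃ m ∈ wtSpace h M μ, m ≠ 0 := Submodule.exists_mem_ne_zero_of_ne_bot hμ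

theorem wt_unique {μ ν : Module.Dual ℂ h} {m : M} (hm : m ∈ wtSpace h M μ)
    (hm' : m ∈ wtSpace h M ν) (h0 : m ≠ 0) : μ = ν := by
  ext x
  have := (hm x).symm.trans (hm' x)
  exact smul_left_injective ℂ h0 this

/-- A weight vector in the span of a set of weight vectors lies in the span of those of the same
weight. -/
theorem mem_span_inter_wtSpace (hab : ∀ x ∈ h, ∀ y ∈ h, ⁅x, y⁆ = 0) {T : Set M}
    (hT : ∀ t ∈ T, ∃ μ, t ∈ wtSpace h M μ) {α : Module.Dual ℂ h} {v : M}
    (hv : v ∈ Submodule.span ℂ T) (hv' : v ∈ wtSpace h M α) :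
    v ∈ Submodule.span ℂ (T ∩ wtSpace h M α) := by
  have h1 : Submodule.span ℂ T ≤ Submodule.span ℂ (T ∩ wtSpace h M α) ⊔
      ⨆ (μ) (_ : μ ≠ α), wtSpace h M μ := by
    rw [Submodule.span_le]
    intro t ht
    obtain ⟨μ, hμ⟩ := hT t ht
    by_cases hc : μ = α
    · subst hc
      exact Submodule.mem_sup_left (Submodule.subset_span ⟨ht, hμ⟩)
    · exact Submodule.mem_sup_right (Submodule.mem_iSup_of_mem μ (Submodule.mem_iSup_of_mem hc hμ))
  obtain ⟨a, ha, b, hb, rfl⟩ := Submodule.mem_sup.1 (h1 hv)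
  have ha' : a ∈ wtSpace h M α :=
    (Submodule.span_le.2 (fun t ht => ht.2) : Submodule.span ℂ (T ∩ wtSpace h M α) ≤ _) ha
  have hb' : b ∈ wtSpace h M α := by simpa using Submodule.sub_mem _ hv' ha'
  have hb0 : b = 0 := by
    have := (iSupIndep_wtSpace (M := M) hab) α
    exact Submodule.disjoint_def.1 this b hb' hb
  simpa [hb0] using ha

/-- This is how unknown weights are identified later: a non-zero weight vector in a span must share
its weight with one of the spanning vectors. -/
theorem exists_mem_inter_wtSpace (hab : ∀ x ∈ h, ∀ y ∈ h, ⁅x, y⁆ = 0) {T : Set M}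
    (hT : ∀ t ∈ T, ∃ μ, t ∈ wtSpace h M μ) {α : Module.Dual ℂ h} {v : M}
    (hv : v ∈ Submodule.span ℂ T) (hv' : v ∈ wtSpace h M α) (h0 : v ≠ 0) :
    ∃ t ∈ T, t ∈ wtSpace h M α ∧ t ≠ 0 := by
  by_contra! hc
  have := mem_span_inter_wtSpace hab hT hv hv'
  apply h0
  rw [← Submodule.mem_bot ℂ]
  refine (Submodule.span_le.2 ?_ : Submodule.span ℂ (T ∩ wtSpace h M α) ≤ ⊥) this
  intro t ht
  exact hc t ht.1 ht.2

/-- Non-zero vectors `x^n m` would have the pairwise distinct weights `μ + n α`, hence be linearly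
independent, against local finiteness. -/
theorem exists_pow_toEnd_eq_zero (hab : ∀ x ∈ h, ∀ y ∈ h, ⁅x, y⁆ = 0)
    (hint : IsIntegrableModule g M) {α μ : Module.Dual ℂ h} (hα : α ≠ 0) {x : g} {m : M}
    (hx : x ∈ wtSpace h g α) (hm : m ∈ wtSpace h M μ) :
    ∃ n, (LieModule.toEnd ℂ g M x ^ n) m = 0 := by
  by_contra! hc
  have hinj : Function.Injective fun n : ℕ => μ + n • α := by
    intro a b hab'
    have : (a : ℂ) • α = (b : ℂ) • α := by
      simpa only [add_right_inj, Nat.cast_smul_eq_nsmul] using hab'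
    exact_mod_cast smul_left_injective ℂ hα this
  have hli : LinearIndependent ℂ fun k : ℕ => (LieModule.toEnd ℂ g M x ^ k) m :=
    ((iSupIndep_wtSpace (M := M) hab).comp hinj).linearIndependent _
      (fun n => pow_toEnd_mem_wtSpace hx hm n) hc
  have := hint x m
  have := Module.Finite.finite_basis (Module.Basis.span hli)
  exact not_finite ℕ

end WeightSpaces

/-! ### `sl₂`-theory for root triples. -/

section RootTriples

variable {g : Type u} [LieRing g] [LieAlgebra ℂ g] {h : LieSubalgebra ℂ g}
variable {M : Type w} [AddCommGroup M] [Module ℂ M] [LieRingModule g M] [LieModule ℂ g M]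

/-- An `sl₂`-triple formed by root vectors for `α` and `-α` and an element `c` of `h`. -/
structure IsRootTriple (α : Module.Dual ℂ h) (e f : g) (c : h) : Prop where
  e_mem : e ∈ wtSpace h g α
  f_mem : f ∈ wtSpace h g (-α)
  lie_ef : ⁅e, f⁆ = c
  apply_c : α c = 2

namespace IsRootTriple

variable {α : Module.Dual ℂ h} {e f : g} {c : h}

theorem ne_zero (t : IsRootTriple α e f c) : α ≠ 0 := by
  rintro rfl
  simpa using t.apply_c

theorem c_ne_zero (t : IsRootTriple α e f c) : c ≠ 0 := by
  rintro rfl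
  simpa using t.apply_c

theorem isSl2Triple (t : IsRootTriple α e f c) : IsSl2Triple (c : g) e f where
  h_ne_zero := by simpa using t.c_ne_zero
  lie_e_f := t.lie_ef
  lie_h_e_nsmul := by
    rw [t.e_mem c, t.apply_c]
    norm_cast
  lie_h_f_nsmul := by
    rw [t.f_mem c, LinearMap.neg_apply, t.apply_c, neg_smul]
    norm_cast

theorem symm (t : IsRootTriple α e f c) : IsRootTriple (-α) f e (-c) where
  e_mem := t.f_mem
  f_mem := by simpa using t.e_mem
  lie_ef := by rw [← lie_skew, t.lie_ef]; rfl
  apply_c := by simp [t.apply_c]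

theorem e_mem_rootSet (t : IsRootTriple α e f c) : α ∈ rootSet h :=
  ⟨t.ne_zero, fun hb => t.isSl2Triple.e_ne_zero (by simpa [hb] using t.e_mem)⟩

theorem string_aux (t : IsRootTriple α e f c)
    (he : ∀ μ : Module.Dual ℂ h, ∀ m ∈ wtSpace h M μ, ∃ n, (LieModule.toEnd ℂ g M e ^ n) m = 0)
    (hf : ∀ μ : Module.Dual ℂ h, ∀ m ∈ wtSpace h M μ, ∃ n, (LieModule.toEnd ℂ g M f ^ n) m = 0)
    {μ : Module.Dual ℂ h} (hμ : μ ∈ wtSupp h M) :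
    ∃ k : ℤ, μ c = k ∧ ∀ j : ℤ, 0 ≤ j → j ≤ k → μ - j • α ∈ wtSupp h M := by
  obtain ⟨m, hm, hm0⟩ := exists_ne_zero_of_mem_wtSupp hμ
  obtain ⟨n, hn, hn'⟩ := Nat.exists_not_and_succ_of_not_zero_of_exists
    (p := fun n => (LieModule.toEnd ℂ g M e ^ n) m = 0) (by simpa using hm0) (he μ m hm)
  set w := (LieModule.toEnd ℂ g M e ^ n) m with hw
  have hwm : w ∈ wtSpace h M (μ + n • α) := pow_toEnd_mem_wtSpace t.e_mem hm n
  have hP : t.isSl2Triple.HasPrimitiveVectorWith w (μ c + 2 * n) :=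
    { ne_zero := hn
      lie_h := by
        rw [hwm c, LinearMap.add_apply, LinearMap.smul_apply, t.apply_c]
        congr 2
        simp [mul_comm]
      lie_e := by rw [hw, IsSl2Triple.lie_e_pow_toEnd_e (R := ℂ)]; exact hn' }
  obtain ⟨i, hi, hi'⟩ := Nat.exists_not_and_succ_of_not_zero_of_exists
    (p := fun n => (LieModule.toEnd ℂ g M f ^ n) w = 0) (by simpa using hn) (hf _ w hwm)
  -- The relation `e f^(i+1) w = (i+1)(L - i) f^i w`, with left side zero and `f^i w ≠ 0`, forces
  -- the highest weight `L` to be `i`.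
  have hL : μ c + 2 * n = i := by
    have := hP.lie_e_pow_succ_toEnd_f i
    rw [hi', lie_zero, eq_comm, smul_eq_zero_iff_left hi, mul_eq_zero, sub_eq_zero] at this
    exact this.resolve_left (Nat.cast_add_one_ne_zero i)
  refine ⟨i - 2 * n, by push_cast; rw [← hL]; ring, fun j hj0 hj => ?_⟩
  obtain ⟨j, rfl⟩ := Int.eq_ofNat_of_zero_le hj0
  have h1 := hP.pow_toEnd_f_ne_zero_of_eq_nat hL (i := n + j) (by omega)
  have h2 := pow_toEnd_mem_wtSpace t.f_mem hwm (n + j)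
  have h3 : μ + n • α + (n + j) • (-α) = μ - (j : ℤ) • α := by
    rw [natCast_zsmul, add_smul]
    simp only [smul_neg]
    abel
  rw [h3] at h2
  exact mem_wtSupp_of_ne_zero h2 h1

/-- Weights of an integrable module take integral values on coroots, and the support contains the
whole string between a weight and its reflection. -/
theorem exists_int_and_string (t : IsRootTriple α e f c)
    (hab : ∀ x ∈ h, ∀ y ∈ h, ⁅x, y⁆ = 0) (hint : IsIntegrableModule g M)
    {μ : Module.Dual ℂ h} (hμ : μ ∈ wtSupp h M) :
    ∃ k : ℤ, μ c = k ∧ ∀ j : ℤ, (0 ≤ j ∧ j ≤ k ∨ k ≤ j ∧ j ≤ 0) → μ - j • α ∈ wtSupp h M := by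
  have he : ∀ μ : Module.Dual ℂ h, ∀ m ∈ wtSpace h M μ, ∃ n, (LieModule.toEnd ℂ g M e ^ n) m = 0 :=
    fun μ m hm => exists_pow_toEnd_eq_zero hab hint t.ne_zero t.e_mem hm
  have hf : ∀ μ : Module.Dual ℂ h, ∀ m ∈ wtSpace h M μ, ∃ n, (LieModule.toEnd ℂ g M f ^ n) m = 0 :=
    fun μ m hm => exists_pow_toEnd_eq_zero hab hint (neg_ne_zero.2 t.ne_zero) t.f_mem hm
  obtain ⟨k, hk, hs⟩ := t.string_aux he hf hμ
  -- `string_aux` says something only for a non-negative value; the opposite triple covers the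
  -- negative one.
  obtain ⟨k', hk', hs'⟩ := t.symm.string_aux hf he hμ
  have hkk : k' = -k := by
    have : ((k' : ℤ) : ℂ) = ((-k : ℤ) : ℂ) := by rw [← hk']; simp [hk]
    exact_mod_cast this
  refine ⟨k, hk, fun j hj => ?_⟩
  rcases hj with ⟨h1, h2⟩ | ⟨h1, h2⟩
  · exact hs j h1 h2
  · have := hs' (-j) (by omega) (by omega)
    simpa using this

/-- This is the commutator identity `[e^(n+1), f] = (n+1) e^n (c + n)`, evaluated on a weight
vector. -/
theorem pow_e_lie_f (t : IsRootTriple α e f c) {μ : Module.Dual ℂ h} {m : M}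
    (hm : m ∈ wtSpace h M μ) (n : ℕ) :
    (LieModule.toEnd ℂ g M e ^ (n + 1)) ⁅f, m⁆ = ⁅f, (LieModule.toEnd ℂ g M e ^ (n + 1)) m⁆ +
      ((n + 1) * (μ c + n) : ℂ) • (LieModule.toEnd ℂ g M e ^ n) m := by
  induction n with
  | zero =>
    simp only [zero_add, pow_one, LieModule.toEnd_apply_apply, pow_zero, Module.End.one_apply,
      leibniz_lie e, t.lie_ef, hm c]
    simp [add_comm]
  | succ n ih =>
    have h1 := pow_toEnd_mem_wtSpace t.e_mem hm (n + 1)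
    rw [pow_succ', Module.End.mul_apply, ih, map_add, LieModule.toEnd_apply_apply, leibniz_lie e,
      t.lie_ef, h1 c, map_smul, ← Module.End.mul_apply _ (_ ^ n), ← pow_succ',
      IsSl2Triple.lie_e_pow_toEnd_e (R := ℂ), add_comm (_ • _),
      add_assoc, ← add_smul, LinearMap.add_apply, LinearMap.smul_apply, t.apply_c]
    rw [pow_succ' (LieModule.toEnd ℂ g M e) (n + 1), nsmul_eq_mul]
    congr 2
    push_cast
    ring

/-- Surjectivity of `e` onto weight spaces where the coroot is positive; no finite dimensionality is
needed. If `e^(n+1) v = 0`, then `e f v - a v` is killed by `e^n` for the scalar `a` of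
`pow_e_lie_f`. By induction it is `e u`, and `a ≠ 0` gives `v = a⁻¹ e (f v - u)`. -/
theorem exists_lie_e_eq (t : IsRootTriple α e f c) {μ : Module.Dual ℂ h} {k : ℤ}
    (hk : μ c = k) (hk1 : 1 ≤ k) (n : ℕ) {v : M} (hv : v ∈ wtSpace h M μ)
    (hn : (LieModule.toEnd ℂ g M e ^ n) v = 0) :
    ∃ u ∈ wtSpace h M (μ - α), ⁅e, u⁆ = v := by
  induction n generalizing v with
  | zero => exact ⟨0, zero_mem _, by simpa using hn.symm⟩
  | succ n ih =>
    set a : ℂ := (n + 1) * (μ c + n) with ha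
    have ha0 : a ≠ 0 := by
      rw [ha, hk]
      have : (n + 1 : ℤ) * (k + n) ≠ 0 := by positivity
      exact_mod_cast this
    have hfv : ⁅f, v⁆ ∈ wtSpace h M (μ - α) := by
      simpa [sub_eq_add_neg] using lie_mem_wtSpace t.f_mem hv
    have hefv : ⁅e, ⁅f, v⁆⁆ ∈ wtSpace h M μ := by
      simpa using lie_mem_wtSpace t.e_mem hfv
    obtain ⟨u, hu, hue⟩ := ih (v := ⁅e, ⁅f, v⁆⁆ - a • v)
      (Submodule.sub_mem _ hefv (Submodule.smul_mem _ _ hv)) (by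
        have := t.pow_e_lie_f hv n
        rw [hn, lie_zero, zero_add, pow_succ, Module.End.mul_apply,
          LieModule.toEnd_apply_apply] at this
        rw [map_sub, this, map_smul, sub_self])
    refine ⟨a⁻¹ • (⁅f, v⁆ - u), Submodule.smul_mem _ _ (Submodule.sub_mem _ hfv hu), ?_⟩
    rw [lie_smul, lie_sub, hue, sub_sub_cancel, smul_smul, inv_mul_cancel₀ ha0, one_smul]

end IsRootTriple

end RootTriples


/-! ### Root data: levels, reflections, the trace form and Cartan integers. -/

section RootDataDef

variable {g : Type u} [LieRing g] [LieAlgebra ℂ g]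

/-- A splitting of `g` with respect to an abelian subalgebra `h`: one-dimensional root spaces, a
root triple for each root, and an exhaustion of the set of roots by finite closed symmetric sets. -/
structure RootData (h : LieSubalgebra ℂ g) where
  Φ : ℕ → Finset (Module.Dual ℂ h)
  e : Module.Dual ℂ h → g
  f : Module.Dual ℂ h → g
  c : Module.Dual ℂ h → h
  abelian : ∀ x ∈ h, ∀ y ∈ h, ⁅x, y⁆ = 0
  mono : Monotone Φ
  mem_rootSet : ∀ {n α}, α ∈ Φ n → α ∈ rootSet h
  exhaust : ∀ {α}, α ∈ rootSet h → ∃ n, α ∈ Φ n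
  neg_mem : ∀ {n α}, α ∈ Φ n → -α ∈ Φ n
  triple : ∀ {α}, α ∈ rootSet h → IsRootTriple α (e α) (f α) (c α)
  exists_smul : ∀ {α}, α ∈ rootSet h → ∀ x ∈ wtSpace h g α, ∃ a : ℂ, x = a • e α
  closed : ∀ {n α γ}, α ∈ Φ n → γ ∈ Φ n → ⁅e α, e γ⁆ ≠ 0 → α + γ = 0 ∨ α + γ ∈ Φ n
  span_top : h.toSubmodule ⊔ ⨆ α ∈ rootSet h, wtSpace h g α = ⊤

end RootDataDef

namespace IsRootTriple

variable {g : Type u} [LieRing g] [LieAlgebra ℂ g] {h : LieSubalgebra ℂ g}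
variable {M : Type w} [AddCommGroup M] [Module ℂ M] [LieRingModule g M] [LieModule ℂ g M]
variable {α : Module.Dual ℂ h} {e f : g} {c : h}

theorem exists_nat_of_lie_e_eq_zero (t : IsRootTriple α e f c)
    (hab : ∀ x ∈ h, ∀ y ∈ h, ⁅x, y⁆ = 0) (hint : IsIntegrableModule g M)
    {μ : Module.Dual ℂ h} {v : M} (hv : v ∈ wtSpace h M μ) (h0 : v ≠ 0) (he : ⁅e, v⁆ = 0) :
    ∃ n : ℕ, μ c = n := by
  have hP : t.isSl2Triple.HasPrimitiveVectorWith v (μ c) := ⟨h0, hv c, he⟩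
  obtain ⟨i, hi, hi'⟩ := Nat.exists_not_and_succ_of_not_zero_of_exists
    (p := fun n => (LieModule.toEnd ℂ g M f ^ n) v = 0) (by simpa using h0)
    (exists_pow_toEnd_eq_zero hab hint (neg_ne_zero.2 t.ne_zero) t.f_mem hv)
  have := hP.lie_e_pow_succ_toEnd_f i
  rw [hi', lie_zero, eq_comm, smul_eq_zero_iff_left hi, mul_eq_zero, sub_eq_zero] at this
  exact ⟨i, this.resolve_left (Nat.cast_add_one_ne_zero i)⟩

end IsRootTriple

namespace RootData

variable {g : Type u} [LieRing g] [LieAlgebra ℂ g] {h : LieSubalgebra ℂ g} (D : RootData h)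
include D

theorem neg_mem_rootSet {α : Module.Dual ℂ h} (hα : α ∈ rootSet h) : -α ∈ rootSet h :=
  (D.triple hα).symm.e_mem_rootSet

theorem e_ne_zero {α : Module.Dual ℂ h} (hα : α ∈ rootSet h) : D.e α ≠ 0 :=
  (D.triple hα).isSl2Triple.e_ne_zero

theorem e_mem {α : Module.Dual ℂ h} (hα : α ∈ rootSet h) : D.e α ∈ wtSpace h g α :=
  (D.triple hα).e_mem

theorem mem_wtSpace_zero (x : h) : (x : g) ∈ wtSpace h g 0 := fun y => by
  simp [D.abelian _ y.2 _ x.2]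

theorem mem_rootSet_of_mem_of_ne_zero {α : Module.Dual ℂ h} {x : g} (hx : x ∈ wtSpace h g α)
    (h0 : x ≠ 0) (hα : α ≠ 0) : α ∈ rootSet h :=
  ⟨hα, fun hb => h0 (by simpa [hb] using hx)⟩

theorem zero_or_mem_of_mem_wtSupp {α : Module.Dual ℂ h} (hα : α ∈ wtSupp h g) :
    α = 0 ∨ α ∈ rootSet h := or_iff_not_imp_left.2 fun h0 => ⟨h0, hα⟩

theorem exists_level (s : Finset (Module.Dual ℂ h)) (hs : ∀ α ∈ s, α ∈ rootSet h) :
    ∃ n, s ⊆ D.Φ n := by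
  classical
  induction s using Finset.induction_on with
  | empty => exact ⟨0, by simp⟩
  | insert a s ha ih =>
    obtain ⟨n, hn⟩ := ih fun α hα => hs α (Finset.mem_insert_of_mem hα)
    obtain ⟨m, hm⟩ := D.exhaust (hs a (Finset.mem_insert_self a s))
    refine ⟨max n m, Finset.insert_subset (D.mono (le_max_right n m) hm)
      (hn.trans (D.mono (le_max_left n m)))⟩

/-- The sum of `h` and of the root spaces of level `n`. -/
def level (n : ℕ) : Submodule ℂ g := h.toSubmodule ⊔ Submodule.span ℂ (D.e '' D.Φ n)

theorem e_mem_level {n : ℕ} {α : Module.Dual ℂ h} (hα : α ∈ D.Φ n) : D.e α ∈ D.level n :=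
  Submodule.mem_sup_right (Submodule.subset_span ⟨α, hα, rfl⟩)

theorem level_mono : Monotone D.level := fun _ _ hnm =>
  sup_le_sup_left (Submodule.span_mono (Set.image_mono (D.mono hnm))) _

theorem exists_mem_level (x : g) : ∃ n, x ∈ D.level n := by
  have hx : x ∈ h.toSubmodule ⊔ ⨆ α ∈ rootSet h, wtSpace h g α := by rw [D.span_top]; trivial
  have hle : h.toSubmodule ⊔ ⨆ α ∈ rootSet h, wtSpace h g α ≤ ⨆ n, D.level n := by
    refine sup_le (le_trans le_sup_left (le_iSup D.level 0)) (iSup₂_le fun α hα y hy => ?_)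
    obtain ⟨a, rfl⟩ := D.exists_smul hα y hy
    obtain ⟨n, hn⟩ := D.exhaust hα
    exact Submodule.mem_iSup_of_mem n (Submodule.smul_mem _ _ (D.e_mem_level hn))
  exact (Submodule.mem_iSup_of_directed _ (directed_of_isDirected_le D.level_mono)).1 (hle hx)

/-- An element of level `n` acts within any subspace that is stable under `h` and the root vectors
of level `n`. -/
theorem lie_mem_of_mem_level {M : Type w} [AddCommGroup M] [Module ℂ M] [LieRingModule g M]
    [LieModule ℂ g M] {n : ℕ} {N N' : Submodule ℂ M}
    (hh : ∀ x ∈ h, ∀ m ∈ N, ⁅x, m⁆ ∈ N') (he : ∀ α ∈ D.Φ n, ∀ m ∈ N, ⁅D.e α, m⁆ ∈ N')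
    {x : g} (hx : x ∈ D.level n) {m : M} (hm : m ∈ N) : ⁅x, m⁆ ∈ N' := by
  have hle : D.level n ≤ N'.comap ((LieModule.toEnd ℂ g M : g →ₗ[ℂ] Module.End ℂ M).flip m) := by
    refine sup_le (fun y hy => hh y hy m hm) (Submodule.span_le.2 ?_)
    rintro _ ⟨α, hα, rfl⟩
    exact he α hα m hm
  exact hle hx

/-- The span of the root vectors and coroots of level `n` and of further elements of `h`. -/
def core (n : ℕ) (T : Set h) : Submodule ℂ g :=
  Submodule.span ℂ (D.e '' D.Φ n ∪ ((fun α => (D.c α : g)) '' D.Φ n ∪ (fun x : h => (x : g)) '' T))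

theorem e_mem_core {n : ℕ} {α : Module.Dual ℂ h} (hα : α ∈ D.Φ n) (T : Set h) :
    D.e α ∈ D.core n T := Submodule.subset_span (Or.inl ⟨α, hα, rfl⟩)

theorem c_mem_core {n : ℕ} {α : Module.Dual ℂ h} (hα : α ∈ D.Φ n) (T : Set h) :
    (D.c α : g) ∈ D.core n T := Submodule.subset_span (Or.inr (Or.inl ⟨α, hα, rfl⟩))

theorem mem_core {n : ℕ} {T : Set h} {x : h} (hx : x ∈ T) : (x : g) ∈ D.core n T :=
  Submodule.subset_span (Or.inr (Or.inr ⟨x, hx, rfl⟩))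

theorem finiteDimensional_core (n : ℕ) {T : Set h} (hT : T.Finite) :
    FiniteDimensional ℂ (D.core n T) := by
  refine FiniteDimensional.span_of_finite ℂ (Set.Finite.union ?_ (Set.Finite.union ?_ (hT.image _)))
  · exact (D.Φ n).finite_toSet.image _
  · exact (D.Φ n).finite_toSet.image _

theorem lie_e_h {α : Module.Dual ℂ h} (hα : α ∈ rootSet h) (x : h) :
    ⁅D.e α, (x : g)⁆ = -(α x) • D.e α := by
  rw [← lie_skew, D.e_mem hα x, neg_smul]

theorem lie_e_neg_mem {α γ : Module.Dual ℂ h} (hα : α ∈ rootSet h) (hγ : γ ∈ rootSet h)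
    (h0 : α + γ = 0) : ∃ a : ℂ, ⁅D.e α, D.e γ⁆ = a • (D.c α : g) := by
  obtain rfl := (neg_eq_of_add_eq_zero_right h0).symm
  obtain ⟨a, ha⟩ := D.exists_smul hγ _ (D.triple hα).f_mem
  have ha0 : a ≠ 0 := by
    rintro rfl
    exact (D.triple hα).isSl2Triple.f_ne_zero (by simpa using ha)
  refine ⟨a⁻¹, ?_⟩
  rw [← (D.triple hα).lie_ef, ha, lie_smul, smul_smul, inv_mul_cancel₀ ha0, one_smul]

theorem lie_e_mem_core {n : ℕ} {T : Set h} {α : Module.Dual ℂ h} (hα : α ∈ D.Φ n) {x : g}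
    (hx : x ∈ D.core n T) : ⁅D.e α, x⁆ ∈ D.core n T := by
  have hle : D.core n T ≤ (D.core n T).comap (LieAlgebra.ad ℂ g (D.e α)) := by
    refine Submodule.span_le.2 ?_
    rintro _ (⟨γ, hγ, rfl⟩ | ⟨γ, hγ, rfl⟩ | ⟨x, hx, rfl⟩)
    · simp only [Submodule.comap_coe, Set.mem_preimage, LieAlgebra.ad_apply, SetLike.mem_coe]
      by_cases h0 : α + γ = 0
      · obtain ⟨a, ha⟩ := D.lie_e_neg_mem (D.mem_rootSet hα) (D.mem_rootSet hγ) h0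
        rw [ha]
        exact Submodule.smul_mem _ _ (D.c_mem_core hα T)
      · by_cases h1 : ⁅D.e α, D.e γ⁆ = 0
        · rw [h1]; exact zero_mem _
        · have h2 := (D.closed hα hγ h1).resolve_left h0
          obtain ⟨a, ha⟩ := D.exists_smul (D.mem_rootSet h2) _ (by
            rw [add_comm]
            exact lie_mem_wtSpace (D.e_mem (D.mem_rootSet hα)) (D.e_mem (D.mem_rootSet hγ)))
          rw [ha]
          exact Submodule.smul_mem _ _ (D.e_mem_core h2 T)
    · simp only [Submodule.comap_coe, Set.mem_preimage, LieAlgebra.ad_apply, SetLike.mem_coe]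
      rw [D.lie_e_h (D.mem_rootSet hα)]
      exact Submodule.smul_mem _ _ (D.e_mem_core hα T)
    · simp only [Submodule.comap_coe, Set.mem_preimage, LieAlgebra.ad_apply, SetLike.mem_coe]
      rw [D.lie_e_h (D.mem_rootSet hα)]
      exact Submodule.smul_mem _ _ (D.e_mem_core hα T)
  exact hle hx

theorem lie_h_mem_core {n : ℕ} {T : Set h} (y : h) {x : g}
    (hx : x ∈ D.core n T) : ⁅(y : g), x⁆ ∈ D.core n T := by
  have hle : D.core n T ≤ (D.core n T).comap (LieAlgebra.ad ℂ g (y : g)) := by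
    refine Submodule.span_le.2 ?_
    rintro _ (⟨γ, hγ, rfl⟩ | ⟨γ, hγ, rfl⟩ | ⟨x, hx, rfl⟩)
    · simp only [Submodule.comap_coe, Set.mem_preimage, LieAlgebra.ad_apply, SetLike.mem_coe]
      rw [D.e_mem (D.mem_rootSet hγ) y]
      exact Submodule.smul_mem _ _ (D.e_mem_core hγ T)
    · simp [D.abelian _ y.2 _ (D.c γ).2]
    · simp [D.abelian _ y.2 _ x.2]
  exact hle hx

/-- A level contains all of `h` and may be infinite-dimensional, whereas a core with finite `T` is
finite-dimensional. Cores supply the finite-dimensional stable subspaces for integrability of the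
adjoint module and for the symmetric powers. -/
theorem lie_mem_core {n : ℕ} {T : Set h} {y : g} (hy : y ∈ D.level n) {x : g}
    (hx : x ∈ D.core n T) : ⁅y, x⁆ ∈ D.core n T :=
  D.lie_mem_of_mem_level (fun y hy _ hm => D.lie_h_mem_core ⟨y, hy⟩ hm)
    (fun _ hα _ hm => D.lie_e_mem_core hα hm) hy hx

theorem exists_mem_core {n : ℕ} {x : g} (hx : x ∈ D.level n) :
    ∃ T : Set h, T.Finite ∧ x ∈ D.core n T := by
  obtain ⟨a, ha, b, hb, rfl⟩ := Submodule.mem_sup.1 hx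
  refine ⟨{⟨a, ha⟩}, Set.finite_singleton _, Submodule.add_mem _ (D.mem_core (x := ⟨a, ha⟩) rfl) ?_⟩
  exact Submodule.span_mono Set.subset_union_left hb

/-- An element acts locally finitely on a vector lying in a stable finite-dimensional subspace. -/
theorem finiteDimensional_span_pow {M : Type w} [AddCommGroup M] [Module ℂ M] (φ : Module.End ℂ M)
    {N : Submodule ℂ M} [FiniteDimensional ℂ N] (hN : ∀ m ∈ N, φ m ∈ N) {m : M} (hm : m ∈ N) :
    FiniteDimensional ℂ (Submodule.span ℂ (Set.range fun k : ℕ => (φ ^ k) m)) := by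
  refine Submodule.finiteDimensional_of_le (S₂ := N) (Submodule.span_le.2 ?_)
  rintro _ ⟨k, rfl⟩
  induction k with
  | zero => simpa using hm
  | succ k ih =>
    simp only [pow_succ', Module.End.mul_apply]
    exact hN _ ih

theorem isIntegrableModule_adjoint : IsIntegrableModule g g := by
  intro x y
  obtain ⟨n, hn⟩ := D.exists_mem_level x
  obtain ⟨m, hm⟩ := D.exists_mem_level y
  have hx := D.level_mono (le_max_left n m) hn
  obtain ⟨T, hT, hy⟩ := D.exists_mem_core (D.level_mono (le_max_right n m) hm)
  have := D.finiteDimensional_core (max n m) hT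
  exact D.finiteDimensional_span_pow _ (N := D.core (max n m) T)
    (fun z hz => D.lie_mem_core hx hz) hy

theorem exists_int {α β : Module.Dual ℂ h} (hα : α ∈ rootSet h) (hβ : β ∈ rootSet h) :
    ∃ k : ℤ, β (D.c α) = k ∧
      ∀ j : ℤ, (0 ≤ j ∧ j ≤ k ∨ k ≤ j ∧ j ≤ 0) → β - j • α = 0 ∨ β - j • α ∈ rootSet h := by
  obtain ⟨k, hk, hs⟩ := (D.triple hα).exists_int_and_string D.abelian D.isIntegrableModule_adjoint
    (μ := β) hβ.2
  exact ⟨k, hk, fun j hj => D.zero_or_mem_of_mem_wtSupp (hs j hj)⟩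

/-- If the bracket vanished, `e γ` would be a highest weight vector, so `γ` takes a value `n ≥ 0` on
the coroot of `α`. Then `α + γ` takes the value `n + 2`, so `e α` maps the root space of `γ` onto
that of `α + γ`; but this line is killed by `e α`. -/
theorem lie_e_ne_zero {α γ : Module.Dual ℂ h} (hα : α ∈ rootSet h) (hγ : γ ∈ rootSet h)
    (hs : α + γ ∈ rootSet h) : ⁅D.e α, D.e γ⁆ ≠ 0 := by
  intro h0
  have hint := D.isIntegrableModule_adjoint
  obtain ⟨n, hn⟩ := (D.triple hα).exists_nat_of_lie_e_eq_zero D.abelian hint (D.e_mem hγ)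
    (D.e_ne_zero hγ) h0
  obtain ⟨N, hN⟩ := exists_pow_toEnd_eq_zero D.abelian hint hα.1 (D.e_mem hα) (D.e_mem hs)
  obtain ⟨u, hu, hue⟩ := (D.triple hα).exists_lie_e_eq (μ := α + γ) (k := n + 2)
    (by simp [(D.triple hα).apply_c, hn, add_comm]) (by omega) N (D.e_mem hs) hN
  rw [add_sub_cancel_left] at hu
  obtain ⟨a, rfl⟩ := D.exists_smul hγ u hu
  rw [lie_smul, h0, smul_zero] at hue
  exact D.e_ne_zero hs hue.symm

theorem two_smul_not_mem {α : Module.Dual ℂ h} (hα : α ∈ rootSet h) : α + α ∉ rootSet h :=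
  fun h2 => D.lie_e_ne_zero hα hα h2 (lie_self _)

theorem add_mem {n : ℕ} {α γ : Module.Dual ℂ h} (hα : α ∈ D.Φ n) (hγ : γ ∈ D.Φ n)
    (hs : α + γ ∈ rootSet h) : α + γ ∈ D.Φ n :=
  (D.closed hα hγ (D.lie_e_ne_zero (D.mem_rootSet hα) (D.mem_rootSet hγ) hs)).resolve_left hs.1

/-- The reflection in the root `α`. -/
def refl (α β : Module.Dual ℂ h) : Module.Dual ℂ h := β - β (D.c α) • α

theorem refl_apply (α β : Module.Dual ℂ h) (x : h) :
    D.refl α β x = β x - β (D.c α) * α x := rfl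

theorem refl_refl {α : Module.Dual ℂ h} (hα : α ∈ rootSet h) (β : Module.Dual ℂ h) :
    D.refl α (D.refl α β) = β := by
  ext x
  simp only [refl_apply, (D.triple hα).apply_c]
  ring

/-- Each step down the string is an addition of roots inside the closed set `Φ n`. Should the string
pass through zero, the next element is `-α`. -/
theorem string_mem {n : ℕ} {α β : Module.Dual ℂ h} (hα : α ∈ D.Φ n) (hβ : β ∈ D.Φ n) (k : ℕ)
    (hs : ∀ j : ℕ, j ≤ k → β - j • α = 0 ∨ β - j • α ∈ rootSet h) :
    β - k • α = 0 ∨ β - k • α ∈ D.Φ n := by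
  induction k with
  | zero => right; simpa using hβ
  | succ k ih =>
    have hk : β - (k + 1) • α = -α + (β - k • α) := by rw [succ_nsmul]; abel
    rcases ih fun j hj => hs j (by omega) with h0 | h0
    · right
      rw [hk, h0, add_zero]
      exact D.neg_mem hα
    · refine (hs (k + 1) le_rfl).imp_right fun h1 => ?_
      rw [hk] at h1 ⊢
      exact D.add_mem (D.neg_mem hα) h0 h1

theorem refl_mem {n : ℕ} {α β : Module.Dual ℂ h} (hα : α ∈ D.Φ n) (hβ : β ∈ D.Φ n) :
    D.refl α β ∈ D.Φ n := by
  have hα' := D.mem_rootSet hα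
  have hβ' := D.mem_rootSet hβ
  obtain ⟨k, hk, hs⟩ := D.exists_int hα' hβ'
  have h0 : D.refl α β ≠ 0 := by
    intro h0
    apply hβ'.1
    rw [← D.refl_refl hα' β, h0]
    simp [refl]
  have hr : D.refl α β = β - k • α := by
    rw [refl, hk, Int.cast_smul_eq_zsmul]
  rw [hr] at h0 ⊢
  refine Or.resolve_left ?_ h0
  obtain ⟨m, rfl | rfl⟩ := Int.eq_nat_or_neg k
  · have := D.string_mem hα hβ m fun j hj => by
      have := hs j (by omega)
      rwa [natCast_zsmul] at this
    rwa [natCast_zsmul]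
  · have := D.string_mem (D.neg_mem hα) hβ m fun j hj => by
      have := hs (-j) (by omega)
      rw [neg_smul, natCast_zsmul] at this
      rwa [smul_neg]
    rw [neg_smul, natCast_zsmul]
    rwa [smul_neg] at this

theorem refl_mem_rootSet {α β : Module.Dual ℂ h} (hα : α ∈ rootSet h) (hβ : β ∈ rootSet h) :
    D.refl α β ∈ rootSet h := by
  classical
  obtain ⟨n, hn⟩ := D.exists_level {α, β} (by simp [hα, hβ])
  exact D.mem_rootSet (D.refl_mem (hn (by simp)) (hn (by simp)))

/-- The real part of the value of a functional on the coroot of `α`. -/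
def pairing (η α : Module.Dual ℂ h) : ℝ := (η (D.c α)).re

theorem pairing_int {α β : Module.Dual ℂ h} (hα : α ∈ rootSet h) (hβ : β ∈ rootSet h) :
    ∃ k : ℤ, D.pairing β α = k := by
  obtain ⟨k, hk, -⟩ := D.exists_int hα hβ
  exact ⟨k, by simp [pairing, hk]⟩

theorem ofReal_pairing {α β : Module.Dual ℂ h} (hα : α ∈ rootSet h) (hβ : β ∈ rootSet h) :
    (D.pairing β α : ℂ) = β (D.c α) := by
  obtain ⟨k, hk, -⟩ := D.exists_int hα hβ
  simp [pairing, hk]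

theorem pairing_self {α : Module.Dual ℂ h} (hα : α ∈ rootSet h) : D.pairing α α = 2 := by
  simp [pairing, (D.triple hα).apply_c]

theorem pairing_add (η ξ α : Module.Dual ℂ h) :
    D.pairing (η + ξ) α = D.pairing η α + D.pairing ξ α := by simp [pairing]

theorem pairing_neg (η α : Module.Dual ℂ h) : D.pairing (-η) α = -D.pairing η α := by
  simp [pairing]

theorem pairing_sub (η ξ α : Module.Dual ℂ h) :
    D.pairing (η - ξ) α = D.pairing η α - D.pairing ξ α := by simp [pairing]

theorem pairing_eq_zero_iff {α β : Module.Dual ℂ h} (hα : α ∈ rootSet h) (hβ : β ∈ rootSet h) :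
    D.pairing β α = 0 ↔ β (D.c α) = 0 := by
  rw [← D.ofReal_pairing hα hβ, Complex.ofReal_eq_zero]

/-- Half the square length of the coroot of `α` in the trace form of level `n`. -/
noncomputable def len (n : ℕ) (α : Module.Dual ℂ h) : ℝ := (∑ δ ∈ D.Φ n, D.pairing δ α ^ 2) / 2

theorem len_pos {n : ℕ} {α : Module.Dual ℂ h} (hα : α ∈ D.Φ n) : 0 < D.len n α := by
  refine div_pos (Finset.sum_pos' (fun _ _ => sq_nonneg _) ⟨α, hα, ?_⟩) two_pos
  rw [D.pairing_self (D.mem_rootSet hα)]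
  norm_num

/-- The reflection in `α` permutes `Φ n` and changes the sign of `δ (c α)`. Reindexing the sum by it
gives a linear equation whose solution says that the coroot `c α` represents `len n α • α` in the
trace form. -/
theorem sum_mul_apply {n : ℕ} {α : Module.Dual ℂ h} (hα : α ∈ D.Φ n) (y : h) :
    ∑ δ ∈ D.Φ n, δ (D.c α) * δ y = D.len n α * α y := by
  have hα' := D.mem_rootSet hα
  have h1 : ∑ δ ∈ D.Φ n, δ (D.c α) * δ y =
      ∑ δ ∈ D.Φ n, D.refl α δ (D.c α) * D.refl α δ y :=
    (Finset.sum_bij' (fun δ _ => D.refl α δ) (fun δ _ => D.refl α δ)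
      (fun δ hδ => D.refl_mem hα hδ) (fun δ hδ => D.refl_mem hα hδ)
      (fun δ _ => D.refl_refl hα' δ) (fun δ _ => D.refl_refl hα' δ)
      (fun δ _ => rfl)).symm
  have h2 : ∑ δ ∈ D.Φ n, D.refl α δ (D.c α) * D.refl α δ y =
      -(∑ δ ∈ D.Φ n, δ (D.c α) * δ y) + (∑ δ ∈ D.Φ n, δ (D.c α) ^ 2) * α y := by
    rw [← Finset.sum_neg_distrib, Finset.sum_mul, ← Finset.sum_add_distrib]
    refine Finset.sum_congr rfl fun δ _ => ?_
    simp only [refl_apply, (D.triple hα').apply_c]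
    ring
  have h3 : (D.len n α : ℂ) = (∑ δ ∈ D.Φ n, δ (D.c α) ^ 2) / 2 := by
    simp only [len, Complex.ofReal_div, Complex.ofReal_sum, Complex.ofReal_pow,
      Complex.ofReal_ofNat]
    congr 1
    exact Finset.sum_congr rfl fun δ hδ => by rw [D.ofReal_pairing hα' (D.mem_rootSet hδ)]
  rw [h3]
  linear_combination (1 / 2 : ℂ) * (h1.trans h2)

theorem sum_pairing {n : ℕ} {α γ : Module.Dual ℂ h} (hα : α ∈ D.Φ n) (hγ : γ ∈ D.Φ n) :
    ∑ δ ∈ D.Φ n, D.pairing δ α * D.pairing δ γ = D.len n α * D.pairing α γ := by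
  have h1 := D.sum_mul_apply hα (D.c γ)
  have hα' := D.mem_rootSet hα
  have hγ' := D.mem_rootSet hγ
  rw [← D.ofReal_pairing hγ' hα', ← Complex.ofReal_mul] at h1
  rw [← Complex.ofReal_inj, ← h1, Complex.ofReal_sum]
  refine Finset.sum_congr rfl fun δ hδ => ?_
  rw [Complex.ofReal_mul, D.ofReal_pairing hα' (D.mem_rootSet hδ),
    D.ofReal_pairing hγ' (D.mem_rootSet hδ)]

/-- Both sides are the trace form of the two coroots. This symmetrizes the Cartan integers and is
the source of all comparisons of lengths. -/
theorem len_mul_pairing {n : ℕ} {α γ : Module.Dual ℂ h} (hα : α ∈ D.Φ n) (hγ : γ ∈ D.Φ n) :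
    D.len n α * D.pairing α γ = D.len n γ * D.pairing γ α := by
  rw [← D.sum_pairing hα hγ, ← D.sum_pairing hγ hα]
  exact Finset.sum_congr rfl fun _ _ => mul_comm _ _

theorem pairing_eq_zero_comm {α γ : Module.Dual ℂ h} (hα : α ∈ rootSet h) (hγ : γ ∈ rootSet h) :
    D.pairing α γ = 0 ↔ D.pairing γ α = 0 := by
  classical
  obtain ⟨n, hn⟩ := D.exists_level {α, γ} (by simp [hα, hγ])
  have hα' : α ∈ D.Φ n := hn (by simp)
  have hγ' : γ ∈ D.Φ n := hn (by simp)
  have h1 := D.len_mul_pairing hα' hγ'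
  have h2 := D.len_pos hα'
  have h3 := D.len_pos hγ'
  constructor <;> intro h0 <;> simp_all [h2.ne', h3.ne']

theorem apply_c_eq_zero_comm {α γ : Module.Dual ℂ h} (hα : α ∈ rootSet h) (hγ : γ ∈ rootSet h) :
    α (D.c γ) = 0 ↔ γ (D.c α) = 0 := by
  rw [← D.pairing_eq_zero_iff hγ hα, ← D.pairing_eq_zero_iff hα hγ, D.pairing_eq_zero_comm hα hγ]

/-- A functional in the span of the roots of level `n` that vanishes on all coroots of level `n`
is zero. -/
theorem eq_zero_of_mem_span {n : ℕ} {η : Module.Dual ℂ h}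
    (hη : η ∈ Submodule.span ℂ (D.Φ n : Set (Module.Dual ℂ h)))
    (h0 : ∀ δ ∈ D.Φ n, η (D.c δ) = 0) : η = 0 := by
  obtain ⟨z, rfl⟩ := Submodule.mem_span_finset'.1 hη
  have hlen : ∀ α : D.Φ n, (D.len n α : ℂ) ≠ 0 := fun α =>
    Complex.ofReal_ne_zero.2 (D.len_pos α.2).ne'
  -- Write `η` as the sum of the `z α • α`. Symmetrizing turns the vanishing of `η` on coroots into
  -- the vanishing of every `δ` on the dual combination of coroots, and `sum_mul_apply` recovers `η`
  -- from those values.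
  have key : ∀ δ ∈ D.Φ n, ∑ α : D.Φ n, z α * (δ (D.c α) / D.len n α) = 0 := by
    intro δ hδ
    have h1 := h0 δ hδ
    simp only [LinearMap.sum_apply, LinearMap.smul_apply, smul_eq_mul] at h1
    have h2 : ∀ α : D.Φ n, δ (D.c α) / D.len n α = (α : Module.Dual ℂ h) (D.c δ) / D.len n δ := by
      intro α
      have h3 := D.len_mul_pairing hδ α.2
      have h4 : (D.len n δ : ℂ) ≠ 0 := hlen ⟨δ, hδ⟩
      have h5 := hlen α
      rw [div_eq_div_iff h5 h4, ← D.ofReal_pairing (D.mem_rootSet α.2) (D.mem_rootSet hδ),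
        ← D.ofReal_pairing (D.mem_rootSet hδ) (D.mem_rootSet α.2)]
      norm_cast
      linarith
    simp only [h2, mul_div_assoc', ← Finset.sum_div, h1, zero_div]
  ext y
  simp only [LinearMap.sum_apply, LinearMap.smul_apply, smul_eq_mul, LinearMap.zero_apply]
  have h6 : ∀ α : D.Φ n, z α * (α : Module.Dual ℂ h) y =
      ∑ δ ∈ D.Φ n, z α * (δ (D.c α) / D.len n α) * δ y := by
    intro α
    have := D.sum_mul_apply α.2 y
    rw [← mul_right_inj' (hlen α), ← mul_assoc, mul_comm (D.len n α : ℂ), mul_assoc, ← this,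
      Finset.mul_sum, Finset.mul_sum]
    refine Finset.sum_congr rfl fun δ _ => ?_
    field_simp [hlen α]
  simp only [h6]
  rw [Finset.sum_comm]
  refine Finset.sum_eq_zero fun δ hδ => ?_
  rw [← Finset.sum_mul, key δ hδ, zero_mul]

/-- A real combination of coroots of level `n` on which the roots of level `n` vanish is
annihilated by all roots. -/
theorem apply_eq_zero_of_sum {n : ℕ} (x : Module.Dual ℂ h → ℝ)
    (h0 : ∀ α ∈ D.Φ n, α (∑ γ ∈ D.Φ n, (x γ : ℂ) • D.c γ) = 0) {δ : Module.Dual ℂ h}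
    (hδ : δ ∈ rootSet h) : δ (∑ γ ∈ D.Φ n, (x γ : ℂ) • D.c γ) = 0 := by
  set u := ∑ γ ∈ D.Φ n, (x γ : ℂ) • D.c γ with hu
  obtain ⟨m, hm⟩ := D.exhaust hδ
  set N := max n m
  have hreal : ∀ β ∈ rootSet h, β u = ((∑ γ ∈ D.Φ n, x γ * D.pairing β γ : ℝ) : ℂ) := by
    intro β hβ
    simp only [hu, map_sum, map_smul, smul_eq_mul, Complex.ofReal_sum, Complex.ofReal_mul]
    exact Finset.sum_congr rfl fun γ hγ => by rw [D.ofReal_pairing (D.mem_rootSet hγ) hβ]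
  -- In a level containing `δ`, expanding one factor `u` in coroots and applying `sum_mul_apply`
  -- leaves multiples of `γ u = 0`. All `β u` are real, so a vanishing sum of squares kills each of
  -- them.
  have h1 : ∑ β ∈ D.Φ N, β u * β u = 0 := by
    have : ∀ β : Module.Dual ℂ h, β u * β u = ∑ γ ∈ D.Φ n, x γ * (β (D.c γ) * β u) := by
      intro β
      conv_lhs => enter [1]; rw [hu]
      simp only [map_sum, map_smul, smul_eq_mul, Finset.sum_mul, mul_assoc]
    simp only [this]
    rw [Finset.sum_comm]
    refine Finset.sum_eq_zero fun γ hγ => ?_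
    rw [← Finset.mul_sum, D.sum_mul_apply (D.mono (le_max_left n m) hγ), h0 γ hγ, mul_zero, mul_zero]
  have h2 : ∑ β ∈ D.Φ N, (∑ γ ∈ D.Φ n, x γ * D.pairing β γ) ^ 2 = 0 := by
    rw [← Complex.ofReal_inj, Complex.ofReal_sum, Complex.ofReal_zero, ← h1]
    refine Finset.sum_congr rfl fun β hβ => ?_
    rw [hreal β (D.mem_rootSet hβ), Complex.ofReal_pow, sq]
  have h3 := (Finset.sum_eq_zero_iff_of_nonneg fun _ _ => sq_nonneg _).1 h2 δ
    (D.mono (le_max_right n m) hm)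
  rw [hreal δ hδ, pow_eq_zero_iff two_ne_zero |>.1 h3, Complex.ofReal_zero]

/-- Two roots with proportional Cartan numbers of product four are equal up to sign. -/
theorem pairing_mul_le {α γ : Module.Dual ℂ h} (hα : α ∈ rootSet h) (hγ : γ ∈ rootSet h)
    (h1 : γ ≠ α) (h2 : γ ≠ -α) : D.pairing γ α * D.pairing α γ ≤ 3 := by
  classical
  obtain ⟨n, hn⟩ := D.exists_level {α, γ} (by simp [hα, hγ])
  have hα' : α ∈ D.Φ n := hn (by simp)
  have hγ' : γ ∈ D.Φ n := hn (by simp)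
  set p := D.pairing γ α with hp
  set q := D.pairing α γ with hq
  have hpq := D.len_mul_pairing hα' hγ'
  have hlα := D.len_pos hα'
  have hlγ := D.len_pos hγ'
  -- This is the square norm of `2 c_γ - q c_α` in the trace form. Non-negativity gives `p q ≤ 4`,
  -- and equality makes `γ` proportional to `α`.
  have hsum : ∑ δ ∈ D.Φ n, (2 * D.pairing δ γ - q * D.pairing δ α) ^ 2 =
      2 * D.len n γ * (4 - p * q) := by
    have e1 : ∑ δ ∈ D.Φ n, D.pairing δ γ ^ 2 = 2 * D.len n γ := by simp only [len]; ring
    have e2 : ∑ δ ∈ D.Φ n, D.pairing δ α ^ 2 = 2 * D.len n α := by simp only [len]; ring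
    have e3 := D.sum_pairing hα' hγ'
    have : ∀ δ : Module.Dual ℂ h, (2 * D.pairing δ γ - q * D.pairing δ α) ^ 2 =
        4 * D.pairing δ γ ^ 2 - 4 * q * (D.pairing δ α * D.pairing δ γ) +
          q ^ 2 * D.pairing δ α ^ 2 := fun δ => by ring
    simp only [this, Finset.sum_add_distrib, Finset.sum_sub_distrib, ← Finset.mul_sum, e1, e2, e3]
    rw [← hq, ← hp] at hpq
    rw [← hq]
    linear_combination (-2 * q) * hpq
  have hle : p * q ≤ 4 := by
    have h0 : 0 ≤ 2 * D.len n γ * (4 - p * q) := hsum ▸ Finset.sum_nonneg fun _ _ => sq_nonneg _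
    have := (mul_nonneg_iff_of_pos_left (by positivity : 0 < 2 * D.len n γ)).1 h0
    linarith
  obtain ⟨k, hk⟩ := D.pairing_int hα hγ
  obtain ⟨l, hl⟩ := D.pairing_int hγ hα
  rw [← hp] at hk
  rw [← hq] at hl
  by_contra! h3
  have hkl : k * l = 4 := by
    rw [hk, hl] at h3 hle
    have h3' : 3 < k * l := by exact_mod_cast h3
    have hle' : k * l ≤ 4 := by exact_mod_cast hle
    omega
  have hpq4 : p * q = 4 := by rw [hk, hl]; exact_mod_cast hkl
  rw [hpq4, sub_self, mul_zero] at hsum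
  have h4 := (Finset.sum_eq_zero_iff_of_nonneg fun _ _ => sq_nonneg _).1 hsum
  have h5 : (2 : ℂ) • γ - (k : ℂ) • α = 0 := by
    refine D.eq_zero_of_mem_span (n := n) (Submodule.sub_mem _
      (Submodule.smul_mem _ _ (Submodule.subset_span hγ'))
      (Submodule.smul_mem _ _ (Submodule.subset_span hα'))) fun δ hδ => ?_
    have h6 : 2 * D.pairing δ γ = q * D.pairing δ α := by
      have := pow_eq_zero_iff two_ne_zero |>.1 (h4 δ hδ)
      linarith
    have h7 := D.len_mul_pairing hδ hγ'
    have h8 := D.len_mul_pairing hδ hα'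
    have h9 : 2 * D.pairing γ δ = p * D.pairing α δ := by
      have : D.len n γ * (2 * D.pairing γ δ - p * D.pairing α δ) = 0 := by
        linear_combination (-2 : ℝ) * h7 + q * h8 + D.len n δ * h6 + D.pairing α δ * hpq
      have := (mul_eq_zero.1 this).resolve_left hlγ.ne'
      linarith
    have hδ' := D.mem_rootSet hδ
    simp only [LinearMap.sub_apply, LinearMap.smul_apply, smul_eq_mul]
    rw [← D.ofReal_pairing hδ' hγ, ← D.ofReal_pairing hδ' hα]
    rw [hk] at h9
    rw [sub_eq_zero]
    exact_mod_cast h9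
  rw [sub_eq_zero] at h5
  have hk4 : k ∣ 4 := ⟨l, hkl.symm⟩
  have hk5 : k ≤ 4 := Int.le_of_dvd (by norm_num) hk4
  have hk6 : -4 ≤ k := by
    have := Int.le_of_dvd (by norm_num) (neg_dvd.2 hk4)
    omega
  have hhalf : γ = ((k : ℂ) / 2) • α := by
    rw [div_eq_inv_mul, mul_smul, ← h5, smul_smul]
    norm_num
  -- Here `2 γ = k α` with `k` dividing 4. The values `±2` are excluded by hypothesis, and the
  -- others would make twice a root a root.
  have cases : k = 2 ∨ k = -2 ∨ k = 4 ∨ k = -4 ∨ k = 1 ∨ k = -1 := by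
    interval_cases k <;> simp_all
  rcases cases with rfl | rfl | rfl | rfl | rfl | rfl
  · exact h1 (by simpa using hhalf)
  · exact h2 (by simpa using hhalf)
  · refine D.two_smul_not_mem hα ?_
    convert hγ using 1
    rw [hhalf]; norm_num [two_smul]
  · refine D.two_smul_not_mem (D.neg_mem_rootSet hα) ?_
    convert hγ using 1
    rw [hhalf]; norm_num; rw [two_smul, neg_add]
  · refine D.two_smul_not_mem hγ ?_
    convert hα using 1
    rw [← two_smul ℂ, h5]; simp
  · refine D.two_smul_not_mem hγ ?_
    convert D.neg_mem_rootSet hα using 1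
    rw [← two_smul ℂ, h5]; simp

end RootData


/-! ### Infinite strings, the decomposition into `F` and `I`, and infinite multiplicities. -/

namespace RootData

variable {g : Type u} [LieRing g] [LieAlgebra ℂ g] {h : LieSubalgebra ℂ g} (D : RootData h)
variable {M : Type w} [AddCommGroup M] [Module ℂ M] [LieRingModule g M] [LieModule ℂ g M]

/-- A subspace stable under `h` and all chosen root vectors, as a submodule. -/
def toLieSubmodule (N : Submodule ℂ M) (hh : ∀ x ∈ h, ∀ m ∈ N, ⁅x, m⁆ ∈ N)
    (he : ∀ α ∈ rootSet h, ∀ m ∈ N, ⁅D.e α, m⁆ ∈ N) : LieSubmodule ℂ g M where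
  __ := N
  lie_mem {x m} hm := by
    obtain ⟨n, hn⟩ := D.exists_mem_level x
    exact D.lie_mem_of_mem_level hh (fun α hα => he α (D.mem_rootSet hα)) hn hm

/-- The triples for `α` and `-α` are chosen independently. One-dimensionality of the root spaces
makes their coroots proportional, and evaluating `α` fixes the factor. -/
theorem c_neg {α : Module.Dual ℂ h} (hα : α ∈ rootSet h) : D.c (-α) = -D.c α := by
  have hα' := D.neg_mem_rootSet hα
  obtain ⟨a, ha⟩ := D.exists_smul hα' _ (D.triple hα).f_mem
  obtain ⟨b, hb⟩ := D.exists_smul hα (D.f (-α)) (by simpa using (D.triple hα').f_mem)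
  have ha0 : a ≠ 0 := by
    rintro rfl
    exact (D.triple hα).isSl2Triple.f_ne_zero (by simpa using ha)
  have h1 : a • D.c (-α) = -(b • D.c α) := by
    apply Subtype.ext
    push_cast
    rw [← (D.triple hα').lie_ef, ← (D.triple hα).lie_ef, ← smul_lie, ← ha, hb, lie_smul,
      ← smul_neg, lie_skew]
  have h2 := congrArg α h1
  have h3 := (D.triple hα').apply_c
  rw [LinearMap.neg_apply] at h3
  rw [map_smul, map_neg, map_smul, (D.triple hα).apply_c, ← neg_eq_iff_eq_neg.2 h3.symm] at h2
  have hab : a = b := by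
    simp only [smul_eq_mul] at h2
    linear_combination (-1 / 2 : ℂ) * h2
  rw [← hab, ← smul_neg] at h1
  exact smul_right_injective _ ha0 h1

/-- The relation generated by non-orthogonality of roots. -/
def Linked : Module.Dual ℂ h → Module.Dual ℂ h → Prop :=
  Relation.ReflTransGen fun α δ => α ∈ rootSet h ∧ δ ∈ rootSet h ∧ δ (D.c α) ≠ 0

theorem Linked.symm {α δ : Module.Dual ℂ h} (hl : D.Linked α δ) : D.Linked δ α := by
  induction hl with
  | refl => exact Relation.ReflTransGen.refl
  | tail _ hbc ih =>
    exact Relation.ReflTransGen.head ⟨hbc.2.1, hbc.1, fun h0 => hbc.2.2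
      ((D.apply_c_eq_zero_comm hbc.1 hbc.2.1).1 h0)⟩ ih

theorem linked_of_ne_zero {α δ : Module.Dual ℂ h} (hα : α ∈ rootSet h) (hδ : δ ∈ rootSet h)
    (h0 : δ (D.c α) ≠ 0) : D.Linked α δ := Relation.ReflTransGen.single ⟨hα, hδ, h0⟩

theorem linked_neg {α : Module.Dual ℂ h} (hα : α ∈ rootSet h) : D.Linked α (-α) :=
  D.linked_of_ne_zero hα (D.neg_mem_rootSet hα) (by simp [(D.triple hα).apply_c])

theorem Linked.trans {α β γ : Module.Dual ℂ h} (h1 : D.Linked α β) (h2 : D.Linked β γ) :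
    D.Linked α γ := Relation.ReflTransGen.trans h1 h2

theorem apply_c_eq_zero_of_not_linked {α β γ : Module.Dual ℂ h}
    (hβ : β ∈ rootSet h) (hγ : γ ∈ rootSet h) (h1 : D.Linked α β) (h2 : ¬ D.Linked α γ) :
    γ (D.c β) = 0 := by
  by_contra h0
  exact h2 (Linked.trans D h1 (D.linked_of_ne_zero hβ hγ h0))

/-- A non-zero bracket would give a root `β + γ`. As `β` and `γ` are orthogonal, that root is
orthogonal to neither and links them. -/
theorem lie_e_eq_zero_of_not_linked {α β γ : Module.Dual ℂ h}
    (hβ : β ∈ rootSet h) (hγ : γ ∈ rootSet h) (h1 : D.Linked α β) (h2 : ¬ D.Linked α γ) :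
    ⁅D.e γ, D.e β⁆ = 0 := by
  by_contra h0
  have hm := lie_mem_wtSpace (D.e_mem hγ) (D.e_mem hβ)
  have hs : β + γ ≠ 0 := by
    intro hs
    rw [neg_eq_of_add_eq_zero_right hs |>.symm] at h2
    exact h2 (Linked.trans D h1 (D.linked_neg hβ))
  have hr := D.mem_rootSet_of_mem_of_ne_zero hm h0 hs
  have h3 := D.apply_c_eq_zero_of_not_linked hβ hγ h1 h2
  have h4 := (D.apply_c_eq_zero_comm hγ hβ).1 h3
  refine h2 (Linked.trans D h1 (Linked.trans D (D.linked_of_ne_zero hβ hr ?_)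
    (Linked.symm D (D.linked_of_ne_zero hγ hr ?_))))
  · simp [h3, (D.triple hβ).apply_c]
  · simp [h4, (D.triple hγ).apply_c]

variable (M) in
/-- The integral `α`-string through `μ` in the support of `M` is infinite. -/
def InfString (α μ : Module.Dual ℂ h) : Prop :=
  ∀ N : ℕ, ∃ q : ℤ, (N : ℤ) ≤ |q| ∧ μ + q • α ∈ wtSupp h M

theorem infString_shift {α μ : Module.Dual ℂ h} (a : ℤ) (hs : InfString M α (μ + a • α)) :
    InfString M α μ := by
  intro N
  obtain ⟨q, hq, hq'⟩ := hs (N + a.natAbs)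
  refine ⟨a + q, ?_, by rwa [add_smul, ← add_assoc]⟩
  have := abs_sub_abs_le_abs_sub q (-a)
  rw [abs_neg, sub_neg_eq_add, add_comm q a] at this
  push_cast at hq
  omega

variable (hint : IsIntegrableModule g M)
include hint D

theorem exists_int_of_mem_wtSupp {α μ : Module.Dual ℂ h} (hα : α ∈ rootSet h)
    (hμ : μ ∈ wtSupp h M) : ∃ k : ℤ, μ (D.c α) = k ∧
      ∀ j : ℤ, (0 ≤ j ∧ j ≤ k ∨ k ≤ j ∧ j ≤ 0) → μ - j • α ∈ wtSupp h M :=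
  (D.triple hα).exists_int_and_string D.abelian hint hμ

/-- The reflection of a far weight `μ + q α` is `μ - (k + q) α`, so the string reaches far on both
sides; the extra `|k|` absorbs the shift. -/
theorem InfString.exists_ge {α μ : Module.Dual ℂ h} (hα : α ∈ rootSet h)
    (hs : InfString M α μ) (hμ : μ ∈ wtSupp h M) (N : ℕ) :
    (∃ q : ℤ, (N : ℤ) ≤ q ∧ μ + q • α ∈ wtSupp h M) ∧
    (∃ q : ℤ, (N : ℤ) ≤ -q ∧ μ + q • α ∈ wtSupp h M) := by
  obtain ⟨k, hk, -⟩ := D.exists_int_of_mem_wtSupp hint hα hμ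
  obtain ⟨q, hq, hq'⟩ := hs (N + k.natAbs)
  obtain ⟨l, hl, hl'⟩ := D.exists_int_of_mem_wtSupp hint hα hq'
  have hlk : l = k + 2 * q := by
    have : ((l : ℤ) : ℂ) = ((k + 2 * q : ℤ) : ℂ) := by
      rw [← hl]
      simp [hk, (D.triple hα).apply_c, mul_comm]
    exact_mod_cast this
  have h2 := hl' l (by omega)
  have h3 : μ + q • α - l • α = μ + (-(k + q)) • α := by
    rw [hlk, add_sub_assoc, ← sub_smul]
    congr 2
    ring
  rw [h3] at h2
  rw [Nat.cast_add] at hq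
  rcases abs_cases q with ⟨h4, h5⟩ | ⟨h4, h5⟩
  · exact ⟨⟨q, by omega, hq'⟩, ⟨_, by omega, h2⟩⟩
  · exact ⟨⟨_, by omega, h2⟩, ⟨q, by omega, hq'⟩⟩

/-- Choose `q` of the sign that makes the value of `μ + q α` on the coroot of `δ` large and
positive. The support then contains `μ + q α - N δ`. Its value on the coroot of `α` is still
dominated by `2 q`, so `q α` can be subtracted again, which leaves `μ - N δ`. -/
theorem InfString.of_apply_c_ne_zero {α δ μ : Module.Dual ℂ h} (hα : α ∈ rootSet h)
    (hδ : δ ∈ rootSet h) (h0 : α (D.c δ) ≠ 0) (hμ : μ ∈ wtSupp h M)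
    (hs : InfString M α μ) : InfString M δ μ := by
  intro N
  obtain ⟨κ, hκ, -⟩ := D.exists_int_of_mem_wtSupp hint hα hμ
  obtain ⟨ε, hε, -⟩ := D.exists_int_of_mem_wtSupp hint hδ hμ
  obtain ⟨d, hd, -⟩ := D.exists_int hδ hα
  obtain ⟨d', hd', -⟩ := D.exists_int hα hδ
  have hd0 : d ≠ 0 := by
    rintro rfl
    simp [hd] at h0
  -- For `|q| ≥ B` this yields both `N ≤ ε + q d` and that `κ + 2 q - N d'` has the sign of `q` and
  -- absolute value at least `|q|`.
  set B : ℕ := N + ε.natAbs + (N * d').natAbs + κ.natAbs with hB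
  have key : ∀ q : ℤ, (B : ℤ) ≤ |q| → |q| ≤ q * d → μ + q • α ∈ wtSupp h M →
      μ + (-N : ℤ) • δ ∈ wtSupp h M := by
    intro q hq hqd hq'
    obtain ⟨l, hl, hl'⟩ := D.exists_int_of_mem_wtSupp hint hδ hq'
    have hlk : l = ε + q * d := by
      have : ((l : ℤ) : ℂ) = ((ε + q * d : ℤ) : ℂ) := by
        rw [← hl]
        simp [hε, hd]
      exact_mod_cast this
    have h1 := hl' N (Or.inl ⟨by omega, by omega⟩)
    obtain ⟨l', hl1, hl2⟩ := D.exists_int_of_mem_wtSupp hint hα h1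
    have hlk' : l' = κ + 2 * q - N * d' := by
      have : ((l' : ℤ) : ℂ) = ((κ + 2 * q - N * d' : ℤ) : ℂ) := by
        rw [← hl1]
        simp [hκ, hd', (D.triple hα).apply_c, mul_comm]
      exact_mod_cast this
    generalize (N : ℤ) * d' = P at *
    have h2 := hl2 q (by rcases abs_cases q with ⟨h4, h5⟩ | ⟨h4, h5⟩ <;> omega)
    have h3 : μ + q • α - (N : ℤ) • δ - q • α = μ + (-N : ℤ) • δ := by
      rw [neg_smul]; abel
    rwa [h3] at h2
  obtain ⟨⟨q, hq, hq'⟩, ⟨r, hr, hr'⟩⟩ := InfString.exists_ge D hint hα hs hμ B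
  refine ⟨-N, by simp, ?_⟩
  rcases lt_or_gt_of_ne hd0 with h1 | h1
  · refine key r (by rw [abs_of_nonpos (by omega)]; exact hr) ?_ hr'
    rw [abs_of_nonpos (by omega)]
    nlinarith
  · refine key q (by rw [abs_of_nonneg (by omega)]; exact hq) ?_ hq'
    rw [abs_of_nonneg (by omega)]
    nlinarith

theorem InfString.of_linked {α δ μ : Module.Dual ℂ h} (hl : D.Linked α δ) (hμ : μ ∈ wtSupp h M)
    (hs : InfString M α μ) : InfString M δ μ := by
  induction hl with
  | refl => exact hs
  | tail _ hbc ih =>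
    exact InfString.of_apply_c_ne_zero D hint hbc.1 hbc.2.1
      (fun h0 => hbc.2.2 ((D.apply_c_eq_zero_comm hbc.1 hbc.2.1).1 h0)) hμ ih

theorem InfString.of_add {α γ μ : Module.Dual ℂ h} (hl : D.Linked α γ) (hμ : μ ∈ wtSupp h M)
    (hμ' : μ + γ ∈ wtSupp h M) (hs : InfString M α (μ + γ)) : InfString M α μ := by
  have h1 := InfString.of_linked D hint hl hμ' hs
  refine InfString.of_linked D hint (Linked.symm D hl) hμ (infString_shift 1 ?_)
  rwa [one_smul]

omit hint

/-- Successive action of root vectors. -/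
def mon (L : List (Module.Dual ℂ h)) (m : M) : M := L.foldr (fun α m => ⁅D.e α, m⁆) m

theorem mon_cons (α : Module.Dual ℂ h) (L : List (Module.Dual ℂ h)) (m : M) :
    D.mon (α :: L) m = ⁅D.e α, D.mon L m⁆ := rfl

theorem mon_zero (L : List (Module.Dual ℂ h)) : D.mon L (0 : M) = 0 := by
  induction L with
  | nil => rfl
  | cons a L ih => rw [mon_cons, ih, lie_zero]

theorem mon_mem {L : List (Module.Dual ℂ h)} (hL : ∀ α ∈ L, α ∈ rootSet h) {μ : Module.Dual ℂ h}
    {m : M} (hm : m ∈ wtSpace h M μ) : D.mon L m ∈ wtSpace h M (μ + L.sum) := by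
  induction L with
  | nil => simpa [mon] using hm
  | cons a L ih =>
    rw [mon_cons, List.sum_cons, add_comm a, ← add_assoc]
    exact lie_mem_wtSpace (D.e_mem (hL a (by simp))) (ih fun α hα => hL α (by simp [hα]))

theorem lie_mon {α γ : Module.Dual ℂ h} {L : List (Module.Dual ℂ h)}
    (hL : ∀ β ∈ L, β ∈ rootSet h ∧ D.Linked α β) (hγ : γ ∈ rootSet h) (hγ' : ¬ D.Linked α γ)
    (m : M) : ⁅D.e γ, D.mon L m⁆ = D.mon L ⁅D.e γ, m⁆ := by
  induction L with
  | nil => rfl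
  | cons a L ih =>
    have ha := hL a (by simp)
    rw [mon_cons, leibniz_lie, D.lie_e_eq_zero_of_not_linked ha.1 hγ ha.2 hγ', zero_lie, zero_add,
      ih fun β hβ => hL β (by simp [hβ])]
    rfl

theorem mon_comm {α : Module.Dual ℂ h} {L L' : List (Module.Dual ℂ h)}
    (hL : ∀ β ∈ L, β ∈ rootSet h ∧ D.Linked α β)
    (hL' : ∀ β ∈ L', β ∈ rootSet h ∧ ¬ D.Linked α β)
    (m : M) : D.mon L' (D.mon L m) = D.mon L (D.mon L' m) := by
  induction L' with
  | nil => rfl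
  | cons a L' ih =>
    have ha := hL' a (by simp)
    rw [mon_cons, ih fun β hβ => hL' β (by simp [hβ]), D.lie_mon hL ha.1 ha.2]
    rfl

/-- Root vectors linked to `α` commute with those that are not, so the monomials applied to `m` can
be sorted into a linked and an unlinked factor. Their span is a submodule, hence everything, and
every weight of `M` is the weight of such a monomial. The linked factor alone does not kill `m`,
because the factors commute. -/
theorem exists_mon (hirr : LieModule.IsIrreducible ℂ g M) (α : Module.Dual ℂ h)
    {μ ν : Module.Dual ℂ h} {m : M} (hm : m ∈ wtSpace h M μ) (hm0 : m ≠ 0)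
    (hν : ν ∈ wtSupp h M) :
    ∃ L L' : List (Module.Dual ℂ h), (∀ β ∈ L, β ∈ rootSet h ∧ D.Linked α β) ∧
      (∀ β ∈ L', β ∈ rootSet h ∧ ¬ D.Linked α β) ∧ ν = μ + L.sum + L'.sum ∧ D.mon L m ≠ 0 := by
  set T : Set M := {x | ∃ L L' : List (Module.Dual ℂ h), (∀ β ∈ L, β ∈ rootSet h ∧ D.Linked α β) ∧
    (∀ β ∈ L', β ∈ rootSet h ∧ ¬ D.Linked α β) ∧ x = D.mon L (D.mon L' m)} with hT
  have hwt : ∀ L L' : List (Module.Dual ℂ h), (∀ β ∈ L, β ∈ rootSet h ∧ D.Linked α β) →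
      (∀ β ∈ L', β ∈ rootSet h ∧ ¬ D.Linked α β) →
      D.mon L (D.mon L' m) ∈ wtSpace h M (μ + L.sum + L'.sum) := by
    intro L L' hL hL'
    rw [add_right_comm]
    exact D.mon_mem (fun β hβ => (hL β hβ).1) (D.mon_mem (fun β hβ => (hL' β hβ).1) hm)
  have hstab : ∀ φ : Module.End ℂ M, (∀ x ∈ T, φ x ∈ Submodule.span ℂ T) →
      ∀ x ∈ Submodule.span ℂ T, φ x ∈ Submodule.span ℂ T := fun φ hφ =>
    (Submodule.span_le.2 hφ : Submodule.span ℂ T ≤ (Submodule.span ℂ T).comap φ)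
  let N : LieSubmodule ℂ g M := D.toLieSubmodule (Submodule.span ℂ T)
    (fun x hx => hstab (LieModule.toEnd ℂ g M x) (by
      rintro _ ⟨L, L', hL, hL', rfl⟩
      rw [LieModule.toEnd_apply_apply, hwt L L' hL hL' ⟨x, hx⟩]
      exact Submodule.smul_mem _ _ (Submodule.subset_span ⟨L, L', hL, hL', rfl⟩)))
    (fun γ hγ => hstab (LieModule.toEnd ℂ g M (D.e γ)) (by
      rintro _ ⟨L, L', hL, hL', rfl⟩
      rw [LieModule.toEnd_apply_apply]
      apply Submodule.subset_span
      by_cases hc : D.Linked α γ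
      · refine ⟨γ :: L, L', ?_, hL', rfl⟩
        simpa using ⟨⟨hγ, hc⟩, hL⟩
      · refine ⟨L, γ :: L', hL, ?_, by rw [D.lie_mon hL hγ hc]; rfl⟩
        simpa using ⟨⟨hγ, hc⟩, hL'⟩))
  have hmN : m ∈ N := Submodule.subset_span ⟨[], [], by simp, by simp, rfl⟩
  have hN : N = ⊤ := (eq_bot_or_eq_top N).resolve_left fun hb => hm0 (by
    rwa [hb, LieSubmodule.mem_bot] at hmN)
  obtain ⟨v, hv, hv0⟩ := exists_ne_zero_of_mem_wtSupp hν
  have hvN : v ∈ N := by rw [hN]; trivial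
  obtain ⟨_, ⟨L, L', hL, hL', rfl⟩, ht, ht0⟩ := exists_mem_inter_wtSpace D.abelian
    (by rintro _ ⟨L, L', hL, hL', rfl⟩; exact ⟨_, hwt L L' hL hL'⟩) hvN hv hv0
  refine ⟨L, L', hL, hL', wt_unique ht (hwt L L' hL hL') ht0, fun h0 => ht0 ?_⟩
  rw [← D.mon_comm hL hL', h0, mon_zero]

theorem sum_mem_span {n : ℕ} {L : List (Module.Dual ℂ h)} (hL : ∀ α ∈ L, α ∈ D.Φ n) :
    L.sum ∈ Submodule.span ℂ (D.Φ n : Set (Module.Dual ℂ h)) :=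
  list_sum_mem fun _ hα => Submodule.subset_span (hL _ hα)

omit D in
theorem sum_apply_eq_zero {L : List (Module.Dual ℂ h)} {x : h} (hL : ∀ α ∈ L, α x = 0) :
    L.sum x = 0 := by
  induction L with
  | nil => rfl
  | cons a L ih =>
    rw [List.sum_cons, LinearMap.add_apply, hL a (by simp), ih fun α hα => hL α (by simp [hα]),
      add_zero]

include hint

theorem InfString.of_sum {α μ : Module.Dual ℂ h} {m : M} (hm : m ∈ wtSpace h M μ)
    (L : List (Module.Dual ℂ h)) (hL : ∀ β ∈ L, β ∈ rootSet h ∧ D.Linked α β)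
    (h0 : D.mon L m ≠ 0) (hs : InfString M α (μ + L.sum)) : InfString M α μ := by
  induction L with
  | nil => simpa using hs
  | cons a L ih =>
    have hL' : ∀ β ∈ L, β ∈ rootSet h ∧ D.Linked α β := fun β hβ => hL β (by simp [hβ])
    have h1 : D.mon L m ≠ 0 := fun h1 => h0 (by rw [mon_cons, h1, lie_zero])
    have hw := mem_wtSupp_of_ne_zero (D.mon_mem (fun β hβ => (hL β hβ).1) hm) h0
    rw [List.sum_cons, add_comm a, ← add_assoc] at hs hw
    exact ih hL' h1 (InfString.of_add D hint (hL a (by simp)).2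
      (mem_wtSupp_of_ne_zero (D.mon_mem (fun β hβ => (hL' β hβ).1) hm) h1) hw hs)

/-- In an irreducible integrable module, whether the strings of a root are infinite does not depend
on the weight. -/
theorem InfString.of_mem_wtSupp (hirr : LieModule.IsIrreducible ℂ g M) {α μ ν : Module.Dual ℂ h}
    (hα : α ∈ rootSet h) (hμ : μ ∈ wtSupp h M) (hν : ν ∈ wtSupp h M) (hs : InfString M α ν) :
    InfString M α μ := by
  classical
  obtain ⟨m, hm, hm0⟩ := exists_ne_zero_of_mem_wtSupp hμ
  obtain ⟨L₀, L₀', hL₀, hL₀', hν', h0⟩ := D.exists_mon hirr α hm hm0 hν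
  refine InfString.of_sum D hint hm L₀ hL₀ h0 fun N => ?_
  obtain ⟨q, hq, hq'⟩ := hs N
  obtain ⟨L, L', hL, hL', hν'', h1⟩ := D.exists_mon hirr α hm hm0 hq'
  refine ⟨q, hq, ?_⟩
  have hLm := mem_wtSupp_of_ne_zero (D.mon_mem (fun β hβ => (hL β hβ).1) hm) h1
  have heq : L.sum - L₀.sum - (q : ℂ) • α = L₀'.sum - L'.sum := by
    rw [hν', ← Int.cast_smul_eq_zsmul ℂ] at hν''
    rw [sub_sub, sub_eq_sub_iff_add_eq_add]
    have := add_left_cancel (a := μ) (b := L₀.sum + L₀'.sum + (q : ℂ) • α) (c := L.sum + L'.sum)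
      (by simpa only [add_assoc] using hν'')
    rw [← this]
    abel
  -- Linked coroots kill the right side of `heq` and unlinked coroots kill the left side. A
  -- combination of roots vanishing on all coroots is zero, so the unlinked parts agree and can be
  -- dropped.
  have hθ : L.sum - L₀.sum - (q : ℂ) • α = 0 := by
    obtain ⟨n, hn⟩ := D.exists_level (insert α (L.toFinset ∪ L₀.toFinset)) (by
      intro β hβ
      simp only [Finset.mem_insert, Finset.mem_union, List.mem_toFinset] at hβ
      rcases hβ with rfl | hβ | hβ
      exacts [hα, (hL β hβ).1, (hL₀ β hβ).1])
    have hn1 : α ∈ D.Φ n := hn (by simp)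
    refine D.eq_zero_of_mem_span (n := n) (Submodule.sub_mem _ (Submodule.sub_mem _
      (D.sum_mem_span fun β hβ => hn (by simp [hβ]))
      (D.sum_mem_span fun β hβ => hn (by simp [hβ])))
      (Submodule.smul_mem _ _ (Submodule.subset_span hn1))) fun δ hδ => ?_
    have hδ' := D.mem_rootSet hδ
    by_cases hc : D.Linked α δ
    · rw [heq, LinearMap.sub_apply, sum_apply_eq_zero, sum_apply_eq_zero, sub_zero]
      exacts [fun β hβ => D.apply_c_eq_zero_of_not_linked hδ' (hL' β hβ).1 hc (hL' β hβ).2,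
        fun β hβ => D.apply_c_eq_zero_of_not_linked hδ' (hL₀' β hβ).1 hc (hL₀' β hβ).2]
    · have h2 : ∀ β ∈ rootSet h, D.Linked α β → β (D.c δ) = 0 := fun β hβ hβ' =>
        (D.apply_c_eq_zero_comm hβ hδ').2 (D.apply_c_eq_zero_of_not_linked hβ hδ' hβ' hc)
      rw [LinearMap.sub_apply, LinearMap.sub_apply, LinearMap.smul_apply, sum_apply_eq_zero,
        sum_apply_eq_zero, h2 α hα Relation.ReflTransGen.refl]
      · simp
      · exact fun β hβ => h2 β (hL₀ β hβ).1 (hL₀ β hβ).2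
      · exact fun β hβ => h2 β (hL β hβ).1 (hL β hβ).2
  rw [sub_sub, sub_eq_zero] at hθ
  rw [hθ, Int.cast_smul_eq_zsmul, ← add_assoc] at hLm
  exact hLm

theorem mem_rootsI {α : Module.Dual ℂ h} (hα : α ∈ rootSet h)
    (hs : ∀ μ ∈ wtSupp h M, InfString M α μ) : α ∈ rootsI h M := by
  refine ⟨hα, fun μ hμ => ⟨?_, ?_⟩⟩
  · rintro ⟨B, hB⟩
    obtain ⟨⟨q, hq, hq'⟩, -⟩ := InfString.exists_ge D hint hα (hs μ hμ) hμ (⌈B⌉₊ + 1)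
    have h1 : (q : ℝ) ≤ B := hB (by simpa [wtString, Int.cast_smul_eq_zsmul] using hq')
    have h2 := Nat.le_ceil B
    have h3 : ((⌈B⌉₊ + 1 : ℕ) : ℝ) ≤ q := by exact_mod_cast hq
    push_cast at h3
    linarith
  · rintro ⟨B, hB⟩
    obtain ⟨-, ⟨q, hq, hq'⟩⟩ := InfString.exists_ge D hint hα (hs μ hμ) hμ (⌈-B⌉₊ + 1)
    have h1 : B ≤ (q : ℝ) := hB (by simpa [wtString, Int.cast_smul_eq_zsmul] using hq')
    have h2 := Nat.le_ceil (-B)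
    have h3 : ((⌈-B⌉₊ + 1 : ℕ) : ℝ) ≤ -q := by exact_mod_cast hq
    push_cast at h3
    linarith

theorem mem_rootsF {α : Module.Dual ℂ h} (hα : α ∈ rootSet h)
    (hs : ∀ μ ∈ wtSupp h M, ¬ InfString M α μ) : α ∈ rootsF h M := by
  refine ⟨hα, fun μ hμ => ?_⟩
  suffices hB : ∃ B : ℝ, ∀ q ∈ wtString h M μ α, |q| ≤ B by
    obtain ⟨B, hB⟩ := hB
    exact ⟨⟨B, fun q hq => (abs_le.1 (hB q hq)).2⟩, ⟨-B, fun q hq => (abs_le.1 (hB q hq)).1⟩⟩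
  -- Real parameters are restricted by integrality on the coroot, where `α` takes the value 2: they
  -- are half-integers. It remains to bound two classes modulo `ℤ`, the integral one through `μ` and
  -- the other through some `q₁`, if it occurs.
  have hhalf : ∀ q ∈ wtString h M μ α, ∃ k : ℤ, 2 * q = k := by
    intro q hq
    obtain ⟨k, hk, -⟩ := D.exists_int_of_mem_wtSupp hint hα hμ
    obtain ⟨l, hl, -⟩ := D.exists_int_of_mem_wtSupp hint hα (μ := μ + (q : ℂ) • α) hq
    refine ⟨l - k, ?_⟩
    rw [LinearMap.add_apply, LinearMap.smul_apply, (D.triple hα).apply_c, hk, smul_eq_mul] at hl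
    have : ((2 * q : ℝ) : ℂ) = ((l - k : ℤ) : ℝ) := by
      push_cast
      linear_combination hl
    exact_mod_cast this
  have hbd : ∀ q₀ ∈ wtString h M μ α, ∃ B : ℝ, ∀ k : ℤ, q₀ + k ∈ wtString h M μ α →
      |q₀ + k| ≤ B := by
    intro q₀ hq₀
    have := hs _ hq₀
    simp only [InfString, not_forall, not_exists, not_and] at this
    obtain ⟨N, hN⟩ := this
    refine ⟨|q₀| + N, fun k hk => (abs_add_le _ _).trans (add_le_add le_rfl ?_)⟩
    by_contra! hc
    refine hN k (by exact_mod_cast hc.le) ?_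
    have h1 : μ + ((q₀ + k : ℝ) : ℂ) • α ∈ wtSupp h M := hk
    rw [← Int.cast_smul_eq_zsmul ℂ, add_assoc, ← add_smul]
    push_cast at h1
    exact h1
  have h0 : (0 : ℝ) ∈ wtString h M μ α := by simpa [wtString] using hμ
  obtain ⟨B₀, hB₀⟩ := hbd 0 h0
  by_cases hc : ∃ q₁ ∈ wtString h M μ α, ∃ k : ℤ, 2 * q₁ = 2 * k + 1
  · obtain ⟨q₁, hq₁, k₁, hk₁⟩ := hc
    obtain ⟨B₁, hB₁⟩ := hbd q₁ hq₁
    refine ⟨max B₀ B₁, fun q hq => ?_⟩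
    obtain ⟨k, hk⟩ := hhalf q hq
    rcases Int.even_or_odd' k with ⟨l, rfl | rfl⟩
    · have hql : q = 0 + l := by push_cast at hk; linarith
      rw [hql] at hq ⊢
      exact (hB₀ l hq).trans (le_max_left _ _)
    · have hql : q = q₁ + ((l - k₁ : ℤ) : ℝ) := by push_cast at hk ⊢; linarith
      rw [hql] at hq ⊢
      exact (hB₁ _ hq).trans (le_max_right _ _)
  · push Not at hc
    refine ⟨B₀, fun q hq => ?_⟩
    obtain ⟨k, hk⟩ := hhalf q hq
    rcases Int.even_or_odd' k with ⟨l, rfl | rfl⟩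
    · have hql : q = 0 + l := by push_cast at hk; linarith
      rw [hql] at hq ⊢
      exact hB₀ l hq
    · exact absurd (by push_cast at hk; exact hk) (hc q hq l)

theorem mem_rootsF_or_rootsI (hirr : LieModule.IsIrreducible ℂ g M) {α : Module.Dual ℂ h}
    (hα : α ∈ rootSet h) : α ∈ rootsF h M ∨ α ∈ rootsI h M := by
  by_cases hs : ∃ ν ∈ wtSupp h M, InfString M α ν
  · obtain ⟨ν, hν, hs⟩ := hs
    exact Or.inr (D.mem_rootsI hint hα fun μ hμ =>
      InfString.of_mem_wtSupp D hint hirr hα hμ hν hs)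
  · push Not at hs
    exact Or.inl (D.mem_rootsF hint hα hs)

theorem infString_of_not_mem_rootsF (hirr : LieModule.IsIrreducible ℂ g M) {α : Module.Dual ℂ h}
    (hα : α ∈ rootSet h) (hF : α ∉ rootsF h M) {μ : Module.Dual ℂ h} (hμ : μ ∈ wtSupp h M) :
    InfString M α μ := by
  by_contra hs
  exact hF (D.mem_rootsF hint hα fun ν hν hs' =>
    hs (InfString.of_mem_wtSupp D hint hirr hα hμ hν hs'))

theorem shadow_sup (hirr : LieModule.IsIrreducible ℂ g M) : shadowF h M ⊔ shadowI h M = ⊤ := by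
  rw [eq_top_iff, ← D.span_top]
  refine sup_le (le_sup_left.trans le_sup_left) (iSup₂_le fun α hα => ?_)
  rcases D.mem_rootsF_or_rootsI hint hirr hα with hF | hI
  · exact ((le_iSup₂ (f := fun α (_ : α ∈ rootsF h M) => wtSpace h g α) α hF).trans
      le_sup_right).trans le_sup_left
  · exact ((le_iSup₂ (f := fun α (_ : α ∈ rootsI h M) => wtSpace h g α) α hI).trans
      le_sup_right).trans le_sup_right

omit hint in
theorem exists_not_mem_rootsF (hF : shadowF h M ≠ ⊤) : ∃ α ∈ rootSet h, α ∉ rootsF h M := by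
  by_contra! hc
  apply hF
  rw [eq_top_iff, ← D.span_top]
  refine sup_le_sup_left (iSup₂_le fun α hα => ?_) _
  exact le_iSup₂ (f := fun α (_ : α ∈ rootsF h M) => wtSpace h g α) α (hc α hα)

theorem exists_pow_eq_zero_on {α μ : Module.Dual ℂ h} (hα : α ∈ rootSet h)
    (hfd : FiniteDimensional ℂ (wtSpace h M μ)) :
    ∃ K, ∀ m ∈ wtSpace h M μ, (LieModule.toEnd ℂ g M (D.e α) ^ K) m = 0 := by
  obtain ⟨s, hs⟩ := Module.Finite.iff_fg.1 hfd
  have hnil : ∀ m ∈ wtSpace h M μ, ∃ n, (LieModule.toEnd ℂ g M (D.e α) ^ n) m = 0 := fun m hm =>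
    exists_pow_toEnd_eq_zero D.abelian hint hα.1 (D.e_mem hα) hm
  choose! N hN using hnil
  refine ⟨s.sup N, fun m hm => ?_⟩
  have hle : Submodule.span ℂ (s : Set M) ≤
      LinearMap.ker (LieModule.toEnd ℂ g M (D.e α) ^ s.sup N) := by
    refine Submodule.span_le.2 fun x hx => ?_
    have hxμ : x ∈ wtSpace h M μ := hs ▸ Submodule.subset_span hx
    rw [SetLike.mem_coe, LinearMap.mem_ker, ← Nat.sub_add_cancel (Finset.le_sup (f := N) hx),
      pow_add, Module.End.mul_apply, hN x hxμ, map_zero]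
  exact hle (hs ▸ hm)

/-- With `k ≥ 0`, every weight `μ + (j+1) α` takes a positive value on the coroot, so
`exists_lie_e_eq` applies at each step. -/
theorem mem_wtSupp_pow {α μ : Module.Dual ℂ h} (hα : α ∈ rootSet h) {k : ℤ} (hk : μ (D.c α) = k)
    (hk0 : 0 ≤ k) (q : ℕ) {v : M} (hv : v ∈ wtSpace h M (μ + q • α)) :
    ∃ u ∈ wtSpace h M μ, (LieModule.toEnd ℂ g M (D.e α) ^ q) u = v := by
  induction q generalizing v with
  | zero => exact ⟨v, by simpa using hv, by simp⟩
  | succ q ih =>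
    obtain ⟨n, hn⟩ := exists_pow_toEnd_eq_zero D.abelian hint hα.1 (D.e_mem hα) hv
    obtain ⟨u, hu, hue⟩ := (D.triple hα).exists_lie_e_eq (k := k + 2 * (q + 1)) (by
      simp [hk, (D.triple hα).apply_c, mul_comm]) (by omega) n hv hn
    obtain ⟨u', hu', hue'⟩ := ih (v := u) (by
      rwa [succ_nsmul, ← add_assoc, add_sub_cancel_right] at hu)
    exact ⟨u', hu', by rw [pow_succ', Module.End.mul_apply, hue', LieModule.toEnd_apply_apply, hue]⟩

/-- On a finite-dimensional weight space one power `e^K` vanishes identically. Yet for some `q ≥ K`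
the operator `e^q` maps it onto a non-zero weight space. -/
theorem not_finiteDimensional_aux {α μ : Module.Dual ℂ h} (hα : α ∈ rootSet h)
    (hμ : μ ∈ wtSupp h M) (hs : InfString M α μ) {k : ℤ} (hk : μ (D.c α) = k) (hk0 : 0 ≤ k) :
    ¬ FiniteDimensional ℂ (wtSpace h M μ) := by
  intro hfd
  obtain ⟨K, hK⟩ := D.exists_pow_eq_zero_on hint hα hfd
  obtain ⟨⟨q, hq, hq'⟩, -⟩ := InfString.exists_ge D hint hα hs hμ K
  obtain ⟨q, rfl⟩ := Int.eq_ofNat_of_zero_le (le_trans (Int.natCast_nonneg K) hq)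
  have hKq : K ≤ q := by exact_mod_cast hq
  obtain ⟨v, hv, hv0⟩ := exists_ne_zero_of_mem_wtSupp hq'
  rw [natCast_zsmul] at hv
  obtain ⟨u, hu, rfl⟩ := D.mem_wtSupp_pow hint hα hk hk0 q hv
  apply hv0
  rw [← Nat.sub_add_cancel hKq, pow_add, Module.End.mul_apply, hK u hu, map_zero]

theorem not_finiteDimensional_wtSpace (hirr : LieModule.IsIrreducible ℂ g M) {α : Module.Dual ℂ h}
    (hα : α ∈ rootSet h) (hF : α ∉ rootsF h M) {μ : Module.Dual ℂ h} (hμ : μ ∈ wtSupp h M) :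
    ¬ FiniteDimensional ℂ (wtSpace h M μ) := by
  have hs := D.infString_of_not_mem_rootsF hint hirr hα hF hμ
  obtain ⟨k, hk, -⟩ := D.exists_int_of_mem_wtSupp hint hα hμ
  rcases le_total 0 k with h0 | h0
  · exact D.not_finiteDimensional_aux hint hα hμ hs hk h0
  · have hα' := D.neg_mem_rootSet hα
    obtain ⟨l, hl, -⟩ := D.exists_int_of_mem_wtSupp hint hα' hμ
    refine D.not_finiteDimensional_aux hint hα' hμ
      (InfString.of_linked D hint (D.linked_neg hα) hμ hs) (k := -k) ?_ (by omega)
    rw [D.c_neg hα, map_neg, hk, Int.cast_neg]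

end RootData


/-! ### Simple Lie algebras: the dichotomy and the adjoint module. -/

namespace RootData

variable {g : Type u} [LieRing g] [LieAlgebra ℂ g] {h : LieSubalgebra ℂ g} (D : RootData h)
variable {M : Type w} [AddCommGroup M] [Module ℂ M] [LieRingModule g M] [LieModule ℂ g M]
include D

theorem isWeightModule_adjoint : IsWeightModule h g := by
  refine ⟨iSupIndep_wtSpace D.abelian, ?_⟩
  rw [eq_top_iff, ← D.span_top]
  refine sup_le (fun x hx => Submodule.mem_iSup_of_mem 0 (D.mem_wtSpace_zero ⟨x, hx⟩))
    (iSup₂_le fun α _ => le_iSup _ α)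

omit D in
theorem eq_zero_of_forall_lie {x : g} (hsimple : LieAlgebra.IsSimple ℂ g)
    (h0 : ∀ y : g, ⁅x, y⁆ = 0) : x = 0 := by
  by_contra hx
  have hc : x ∈ LieAlgebra.center ℂ g := fun y => by rw [← lie_skew, h0 y, neg_zero]
  rcases hsimple.eq_bot_or_eq_top (LieAlgebra.center ℂ g) with h1 | h1
  · rw [h1] at hc
    exact hx hc
  · exact hsimple.non_abelian (LieAlgebra.isLieAbelian_iff_center_eq_top ℂ g |>.2 h1)

/-- In a simple Lie algebra an element of `h` on which all roots vanish is zero. -/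
theorem eq_zero_of_forall_root (hsimple : LieAlgebra.IsSimple ℂ g) {x : h}
    (h0 : ∀ α ∈ rootSet h, α x = 0) : x = 0 := by
  apply Subtype.ext
  refine eq_zero_of_forall_lie hsimple fun y => ?_
  have hy : y ∈ h.toSubmodule ⊔ ⨆ α ∈ rootSet h, wtSpace h g α := by rw [D.span_top]; trivial
  have hle : h.toSubmodule ⊔ ⨆ α ∈ rootSet h, wtSpace h g α ≤
      LinearMap.ker (LieAlgebra.ad ℂ g (x : g)) := by
    refine sup_le (fun z hz => D.abelian _ x.2 _ hz) (iSup₂_le fun α hα z hz => ?_)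
    rw [LinearMap.mem_ker, LieAlgebra.ad_apply, hz x, h0 α hα, zero_smul]
  exact hle hy

theorem exists_mem_rootSet (hsimple : LieAlgebra.IsSimple ℂ g) : ∃ α, α ∈ rootSet h := by
  by_contra! hc
  have htop := D.span_top
  simp only [hc, not_false_eq_true, iSup_neg, iSup_bot, sup_bot_eq] at htop
  refine hsimple.non_abelian ⟨fun x y => D.abelian x ?_ y ?_⟩
  · exact (htop ▸ Submodule.mem_top : x ∈ h.toSubmodule)
  · exact (htop ▸ Submodule.mem_top : y ∈ h.toSubmodule)

theorem linked_add {β δ : Module.Dual ℂ h} (hβ : β ∈ rootSet h) (hδ : δ ∈ rootSet h)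
    (hs : β + δ ∈ rootSet h) : D.Linked (β + δ) β ∨ D.Linked (β + δ) δ := by
  by_contra! hc
  have h1 : β (D.c (β + δ)) = 0 := by
    by_contra h0
    exact hc.1 (D.linked_of_ne_zero hs hβ h0)
  have h2 : δ (D.c (β + δ)) = 0 := by
    by_contra h0
    exact hc.2 (D.linked_of_ne_zero hs hδ h0)
  have h3 := (D.triple hs).apply_c
  rw [LinearMap.add_apply, h1, h2] at h3
  norm_num at h3

/-- In a simple Lie algebra all roots are linked by non-orthogonality. -/
theorem linked_of_isSimple (hsimple : LieAlgebra.IsSimple ℂ g) {α δ : Module.Dual ℂ h}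
    (hα : α ∈ rootSet h) (hδ : δ ∈ rootSet h) : D.Linked α δ := by
  set T : Set g := {x | ∃ β ∈ rootSet h, D.Linked α β ∧ (x = D.e β ∨ x = D.c β)} with hT
  have hstab : ∀ φ : Module.End ℂ g, (∀ x ∈ T, φ x ∈ Submodule.span ℂ T) →
      ∀ x ∈ Submodule.span ℂ T, φ x ∈ Submodule.span ℂ T := fun φ hφ =>
    (Submodule.span_le.2 hφ : Submodule.span ℂ T ≤ (Submodule.span ℂ T).comap φ)
  have he : ∀ β ∈ rootSet h, D.Linked α β → D.e β ∈ Submodule.span ℂ T := fun β hβ hl =>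
    Submodule.subset_span ⟨β, hβ, hl, Or.inl rfl⟩
  -- The root vectors and coroots of the component of `α` span an ideal, because a root sum is
  -- linked to one of its summands (`linked_add`). Simplicity makes this ideal everything, and `e δ`
  -- can only come from a root vector of weight `δ`.
  let I : LieSubmodule ℂ g g := D.toLieSubmodule (Submodule.span ℂ T)
    (fun x hx => hstab (LieAlgebra.ad ℂ g x) (by
      rintro _ ⟨β, hβ, hl, rfl | rfl⟩
      · rw [LieAlgebra.ad_apply, D.e_mem hβ ⟨x, hx⟩]
        exact Submodule.smul_mem _ _ (he β hβ hl)
      · rw [LieAlgebra.ad_apply, D.abelian x hx _ (D.c β).2]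
        exact zero_mem _))
    (fun γ hγ => hstab (LieAlgebra.ad ℂ g (D.e γ)) (by
      rintro _ ⟨β, hβ, hl, rfl | rfl⟩
      · rw [LieAlgebra.ad_apply]
        by_cases h0 : γ + β = 0
        · obtain ⟨a, ha⟩ := D.lie_e_neg_mem hγ hβ h0
          have hγβ : γ = -β := eq_neg_of_add_eq_zero_left h0
          rw [ha, hγβ, D.c_neg hβ]
          exact Submodule.smul_mem _ _ (Submodule.neg_mem _
            (Submodule.subset_span ⟨β, hβ, hl, Or.inr rfl⟩))
        · by_cases h1 : ⁅D.e γ, D.e β⁆ = 0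
          · rw [h1]; exact zero_mem _
          · have hm := lie_mem_wtSpace (D.e_mem hγ) (D.e_mem hβ)
            have hr := D.mem_rootSet_of_mem_of_ne_zero hm h1 (by rwa [add_comm])
            obtain ⟨a, ha⟩ := D.exists_smul hr _ hm
            rw [ha]
            refine Submodule.smul_mem _ _ (he _ hr (Linked.trans D hl ?_))
            by_cases h2 : γ (D.c β) = 0
            · refine D.linked_of_ne_zero hβ hr ?_
              rw [LinearMap.add_apply, h2, (D.triple hβ).apply_c]
              norm_num
            · rcases D.linked_add hβ hγ hr with h3 | h3
              · exact Linked.symm D h3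
              · exact Linked.trans D (D.linked_of_ne_zero hβ hγ h2) (Linked.symm D h3)
      · rw [LieAlgebra.ad_apply, D.lie_e_h hγ]
        by_cases h2 : γ (D.c β) = 0
        · rw [h2, neg_zero, zero_smul]; exact zero_mem _
        · exact Submodule.smul_mem _ _ (he _ hγ (Linked.trans D hl
            (D.linked_of_ne_zero hβ hγ h2)))))
  have hαI : D.e α ∈ I := he α hα Relation.ReflTransGen.refl
  have hI : I = ⊤ := (hsimple.eq_bot_or_eq_top I).resolve_left fun hb => D.e_ne_zero hα (by
    rwa [hb, LieSubmodule.mem_bot] at hαI)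
  have hδI : D.e δ ∈ I := by rw [hI]; trivial
  obtain ⟨_, ⟨β, hβ, hl, rfl | rfl⟩, hx, hx0⟩ := exists_mem_inter_wtSpace D.abelian (by
    rintro _ ⟨β, hβ, hl, rfl | rfl⟩
    exacts [⟨_, D.e_mem hβ⟩, ⟨_, D.mem_wtSpace_zero _⟩]) hδI (D.e_mem hδ) (D.e_ne_zero hδ)
  · rwa [wt_unique hx (D.e_mem hβ) hx0]
  · exact absurd (wt_unique hx (D.mem_wtSpace_zero _) hx0) hδ.1

/-- If the sum of `h` and of some root spaces is everything, all roots occur. -/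
theorem mem_of_sup_eq_top {R : Set (Module.Dual ℂ h)}
    (hR : h.toSubmodule ⊔ ⨆ α ∈ R, wtSpace h g α = ⊤) {α : Module.Dual ℂ h}
    (hα : α ∈ rootSet h) : α ∈ R := by
  by_contra hc
  have hind := iSupIndep_wtSpace (M := g) D.abelian α
  have hle : h.toSubmodule ⊔ ⨆ β ∈ R, wtSpace h g β ≤ ⨆ (β) (_ : β ≠ α), wtSpace h g β := by
    refine sup_le (fun x hx => ?_) (iSup₂_le fun β hβ => ?_)
    · exact Submodule.mem_iSup_of_mem 0 (Submodule.mem_iSup_of_mem hα.1.symm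
        (D.mem_wtSpace_zero ⟨x, hx⟩))
    · exact le_iSup₂ (f := fun β (_ : β ≠ α) => wtSpace h g β) β
        (fun h0 => hc (h0 ▸ hβ))
  rw [hR, top_le_iff] at hle
  rw [hle, disjoint_top] at hind
  exact hα.2 hind

theorem not_isFiniteModule_of_not_mem {α : Module.Dual ℂ h} (hα : α ∈ rootSet h)
    (hF : α ∉ rootsF h M) : ¬ IsFiniteModule h M := fun hf => hF (D.mem_of_sup_eq_top hf hα)

omit D in
theorem exists_mem_wtSupp (hirr : LieModule.IsIrreducible ℂ g M) (hw : IsWeightModule h M) :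
    ∃ μ, μ ∈ wtSupp h M := by
  by_contra! hc
  have h1 : ⨆ μ, wtSpace h M μ = ⊥ := iSup_eq_bot.2 fun μ => not_not.1 (hc μ)
  have h2 : (⊤ : LieSubmodule ℂ g M) = ⊥ := by
    rw [← LieSubmodule.toSubmodule_inj]
    simp [← hw.2, h1]
  have := hirr.toNontrivial
  exact top_ne_bot h2

theorem isCuspidalModule_or_isFiniteModule (hsimple : LieAlgebra.IsSimple ℂ g)
    (hirr : LieModule.IsIrreducible ℂ g M) (hint : IsIntegrableModule g M) :
    IsCuspidalModule h M ∨ IsFiniteModule h M := by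
  by_cases hF : shadowF h M = ⊤
  · exact Or.inr hF
  · obtain ⟨α, hα, hαF⟩ := D.exists_not_mem_rootsF hF
    refine Or.inl ?_
    rw [IsCuspidalModule, shadowI, eq_top_iff, ← D.span_top]
    refine sup_le_sup_left (iSup₂_le fun δ hδ => ?_) _
    exact le_iSup₂ (f := fun α (_ : α ∈ rootsI h M) => wtSpace h g α) δ
      (D.mem_rootsI hint hδ fun μ hμ => InfString.of_linked D hint
        (D.linked_of_isSimple hsimple hα hδ) hμ (D.infString_of_not_mem_rootsF hint hirr hα hαF hμ))

theorem xor_isCuspidalModule_isFiniteModule (hsimple : LieAlgebra.IsSimple ℂ g)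
    (hirr : LieModule.IsIrreducible ℂ g M) (hw : IsWeightModule h M)
    (hint : IsIntegrableModule g M) : Xor (IsCuspidalModule h M) (IsFiniteModule h M) := by
  have hnot : ¬ (IsCuspidalModule h M ∧ IsFiniteModule h M) := by
    rintro ⟨hI, hF⟩
    obtain ⟨α, hα⟩ := D.exists_mem_rootSet hsimple
    obtain ⟨μ, hμ⟩ := exists_mem_wtSupp hirr hw
    exact ((D.mem_of_sup_eq_top hI hα).2 μ hμ).1 ((D.mem_of_sup_eq_top hF hα).2 μ hμ).1
  rcases D.isCuspidalModule_or_isFiniteModule hsimple hirr hint with h1 | h1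
  · exact Or.inl ⟨h1, fun h2 => hnot ⟨h1, h2⟩⟩
  · exact Or.inr ⟨h1, fun h2 => hnot ⟨h2, h1⟩⟩

omit D in
theorem isIrreducible_adjoint (hsimple : LieAlgebra.IsSimple ℂ g) :
    LieModule.IsIrreducible ℂ g g := by
  have : Nontrivial (LieSubmodule ℂ g g) := by
    refine ⟨⊥, ⊤, fun hb => hsimple.non_abelian ⟨fun x y => ?_⟩⟩
    have hx : x ∈ (⊤ : LieSubmodule ℂ g g) := trivial
    rw [← hb, LieSubmodule.mem_bot] at hx
    rw [hx, zero_lie]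
  exact ⟨hsimple.eq_bot_or_eq_top⟩

/-- Otherwise the multiplicity result would make every root space infinite-dimensional, but root
spaces are lines. -/
theorem isFiniteModule_adjoint (hsimple : LieAlgebra.IsSimple ℂ g) : IsFiniteModule h g := by
  by_contra hF
  obtain ⟨α, hα, hαF⟩ := D.exists_not_mem_rootsF hF
  refine D.not_finiteDimensional_wtSpace D.isIntegrableModule_adjoint
    (isIrreducible_adjoint hsimple) hα hαF (μ := α) hα.2 ?_
  have hle : wtSpace h g α ≤ Submodule.span ℂ {D.e α} := fun x hx => by
    obtain ⟨a, rfl⟩ := D.exists_smul hα x hx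
    exact Submodule.smul_mem _ _ (Submodule.mem_span_singleton_self _)
  exact Submodule.finiteDimensional_of_le hle

end RootData


/-! ### Root decomposition of a reductive Lie algebra via its quotient `K` by the centre. -/

section Reductive

open LieAlgebra LieModule

variable {G : Type v} [LieRing G] [LieAlgebra ℂ G] [FiniteDimensional ℂ G]
variable {K : Type*} [LieRing K] [LieAlgebra ℂ K] [FiniteDimensional ℂ K]
variable {π : G →ₗ⁅ℂ⁆ K} (hπ : Function.Surjective π)
  (hker : ∀ x, π x = 0 ↔ ∀ y : G, ⁅x, y⁆ = 0)
include hπ hker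

/-- The preimage of an abelian ideal has central derived algebra, so it is solvable, lies in the
radical, which is the centre, and has zero image. -/
theorem IsReductiveLieAlgebra.hasTrivialRadical (hG : IsReductiveLieAlgebra G) :
    HasTrivialRadical ℂ K := by
  rw [hasTrivialRadical_iff_no_abelian_ideals]
  intro I hI
  set J : LieIdeal ℂ G := LieIdeal.comap π I with hJ
  have h1 : ⁅J, J⁆ ≤ center ℂ G := by
    rw [LieSubmodule.lieIdeal_oper_eq_span, LieSubmodule.lieSpan_le]
    rintro _ ⟨x, y, rfl⟩
    have hx : π x ∈ I := LieIdeal.mem_comap.1 x.2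
    have hy : π y ∈ I := LieIdeal.mem_comap.1 y.2
    have h2 : π ⁅(x : G), (y : G)⁆ = 0 := by
      rw [LieHom.map_lie]
      exact congrArg Subtype.val (hI.trivial ⟨_, hx⟩ ⟨_, hy⟩)
    intro z
    rw [← lie_skew, (hker _).1 h2, neg_zero]
  have h3 : derivedSeriesOfIdeal ℂ G 2 J = ⊥ := by
    rw [derivedSeriesOfIdeal_succ, derivedSeriesOfIdeal_succ, derivedSeriesOfIdeal_zero,
      LieSubmodule.lie_eq_bot_iff]
    intro x _ y hy
    exact h1 hy x
  have h4 : IsSolvable J := IsSolvable.mk (k := 2) (LieIdeal.derivedSeries_eq_bot_iff _ 2 |>.2 h3)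
  have h5 : J ≤ center ℂ G := by
    rw [← hG]
    exact (LieIdeal.solvable_iff_le_radical ℂ G J).1 h4
  rw [eq_bot_iff]
  intro y hy
  obtain ⟨x, rfl⟩ := hπ y
  rw [LieSubmodule.mem_bot, hker]
  intro z
  rw [← lie_skew, h5 (LieIdeal.mem_comap.2 hy) z, neg_zero]

variable {H : LieSubalgebra ℂ G} [H.IsCartanSubalgebra]

omit hπ in
theorem mem_cartan_of_apply_eq_zero {x : G} (hx : π x = 0) : x ∈ H := by
  rw [← LieSubalgebra.IsCartanSubalgebra.self_normalizing (H := H), LieSubalgebra.mem_normalizer_iff]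
  intro y _
  rw [(hker x).1 hx]
  exact zero_mem _

omit hπ in
theorem mem_cartan_of_apply_mem {x : G} (hx : π x ∈ H.map π) : x ∈ H := by
  obtain ⟨y, hy, hyx⟩ := hx
  have : x - y ∈ H := mem_cartan_of_apply_eq_zero hker (by
    rw [map_sub, sub_eq_zero]; exact hyx.symm)
  simpa using add_mem this hy

theorem isCartanSubalgebra_map : (H.map π).IsCartanSubalgebra where
  nilpotent := by
    let f : H →ₗ⁅ℂ⁆ H.map π :=
      { toFun := fun x => ⟨π x, x, x.2, rfl⟩
        map_add' := fun x y => Subtype.ext (by simp)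
        map_smul' := fun a x => Subtype.ext (by simp)
        map_lie' := fun {x y} => Subtype.ext (by simp) }
    refine Function.Surjective.lieAlgebra_isNilpotent (f := f) ?_
    rintro ⟨_, x, hx, rfl⟩
    exact ⟨⟨x, hx⟩, rfl⟩
  self_normalizing := by
    refine le_antisymm (fun y hy => ?_) (LieSubalgebra.le_normalizer _)
    obtain ⟨x, rfl⟩ := hπ y
    rw [LieSubalgebra.mem_normalizer_iff] at hy
    have : x ∈ H.normalizer := by
      rw [LieSubalgebra.mem_normalizer_iff]
      intro z hz
      apply mem_cartan_of_apply_mem hker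
      rw [LieHom.map_lie]
      exact hy _ ⟨z, hz, rfl⟩
    rw [LieSubalgebra.IsCartanSubalgebra.self_normalizing] at this
    exact ⟨x, this, rfl⟩

omit hπ in
-- A central vector is killed by every `y`, while on the root space `y` has the single generalized
-- eigenvalue `β y`, non-zero for a suitable `y`. Thus `π` is injective on root spaces.
theorem eq_zero_of_mem_rootSpace_of_apply_eq_zero {β : Module.Dual ℂ H} (hβ : β ≠ 0) {z : G}
    (hz : π z = 0) (hz' : z ∈ rootSpace H β) : z = 0 := by
  obtain ⟨y, hy⟩ := DFunLike.ne_iff.1 hβ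
  rw [mem_genWeightSpace] at hz'
  obtain ⟨k, hk⟩ := hz' y
  have h1 : ∀ k : ℕ, ((toEnd ℂ H G y - β y • (1 : Module.End ℂ G)) ^ k) z = (-β y) ^ k • z := by
    intro k
    induction k with
    | zero => simp
    | succ k ih =>
      have h2 : ⁅y, z⁆ = 0 := by
        rw [LieSubalgebra.coe_bracket_of_module, ← lie_skew, (hker z).1 hz, neg_zero]
      rw [pow_succ', Module.End.mul_apply, ih, map_smul, LinearMap.sub_apply,
        toEnd_apply_apply, h2, pow_succ, mul_smul]
      simp
  rw [h1] at hk
  exact (smul_eq_zero.1 hk).resolve_left (pow_ne_zero _ (neg_ne_zero.2 hy))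

variable [HasTrivialRadical ℂ K]

/-- On the root spaces of a reductive Lie algebra, the Cartan subalgebra acts by scalars. -/
theorem lie_eq_smul_of_mem_rootSpace {β : Module.Dual ℂ H} (hβ : β ≠ 0) {x : G}
    (hx : x ∈ rootSpace H β) (y : H) : ⁅(y : G), x⁆ = β y • x := by
  have := isCartanSubalgebra_map hπ hker (H := H)
  have hz' : ⁅(y : G), x⁆ - β y • x ∈ rootSpace H β :=
    sub_mem ((rootSpace H β).lie_mem (x := y) hx) (Submodule.smul_mem _ _ hx)
  rw [← sub_eq_zero]
  refine eq_zero_of_mem_rootSpace_of_apply_eq_zero hker hβ ?_ hz'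
  rw [mem_genWeightSpace] at hx
  obtain ⟨k, hk⟩ := hx y
  have h1 : ∀ k : ℕ, ((ad ℂ K (π y) - β y • (1 : Module.End ℂ K)) ^ k) (π x) =
      π (((toEnd ℂ H G y - β y • (1 : Module.End ℂ G)) ^ k) x) := by
    intro k
    induction k with
    | zero => simp
    | succ k ih =>
      rw [pow_succ', Module.End.mul_apply, ih, pow_succ', Module.End.mul_apply]
      simp
  have h2 : π x ∈ (ad ℂ K (π y)).maxGenEigenspace (β y) := by
    rw [Module.End.mem_maxGenEigenspace]
    exact ⟨k, by rw [h1, hk, map_zero]⟩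
  have hy : π y ∈ H.map π := ⟨y, y.2, rfl⟩
  -- In the quotient, Cartan elements act semisimply, so the image of `x` is a true eigenvector;
  -- injectivity of `π` on the root space lifts this to `G`.
  rw [(IsKilling.isSemisimple_ad_of_mem_isCartanSubalgebra (H := H.map π)
    hy).isFinitelySemisimple.maxGenEigenspace_eq_eigenspace,
    Module.End.mem_eigenspace_iff] at h2
  simpa [sub_eq_zero] using h2

/-- A non-zero functional on the Cartan subalgebra with a root vector comes from the quotient. -/
theorem exists_dual_map {β : Module.Dual ℂ H} (hβ : β ≠ 0) {x : G} (hx : x ∈ rootSpace H β)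
    (h0 : x ≠ 0) : ∃ χ : Module.Dual ℂ (H.map π), ∀ y : H, χ ⟨π y, y, y.2, rfl⟩ = β y := by
  let f : H →ₗ[ℂ] H.map π :=
    { toFun := fun x => ⟨π x, x, x.2, rfl⟩
      map_add' := fun x y => Subtype.ext (by simp)
      map_smul' := fun a x => Subtype.ext (by simp) }
  obtain ⟨s, hs⟩ := f.exists_rightInverse_of_surjective (LinearMap.range_eq_top.2 (by
    rintro ⟨_, x, hx, rfl⟩
    exact ⟨⟨x, hx⟩, rfl⟩))
  refine ⟨β ∘ₗ s, fun y => ?_⟩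
  change β (s (f y)) = β y
  rw [← sub_eq_zero, ← map_sub]
  -- The section recovers `y` up to a central element, and `β` vanishes on central elements because
  -- `x ≠ 0`.
  have h1 : f (s (f y) - y) = 0 := by
    rw [map_sub, sub_eq_zero]
    exact LinearMap.congr_fun hs (f y)
  have h2 : π ((s (f y) - y : H) : G) = 0 := congrArg Subtype.val h1
  have h3 := lie_eq_smul_of_mem_rootSpace hπ hker hβ hx (s (f y) - y)
  rw [(hker _).1 h2, eq_comm, smul_eq_zero] at h3
  exact h3.resolve_right h0

omit hπ [HasTrivialRadical ℂ K] [FiniteDimensional ℂ G] [FiniteDimensional ℂ K]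
  [H.IsCartanSubalgebra] hker in
theorem mem_rootSpace_map [LieRing.IsNilpotent (H.map π)] {χ : Module.Dual ℂ (H.map π)} {x : G}
    (hx : ∀ y : H, ⁅π y, π x⁆ = χ ⟨π y, y, y.2, rfl⟩ • π x) : π x ∈ rootSpace (H.map π) χ := by
  refine weightSpace_le_genWeightSpace _ _ ?_
  rw [mem_weightSpace]
  rintro ⟨_, y, hy, rfl⟩
  exact hx ⟨y, hy⟩

theorem apply_mem_rootSpace_map [LieRing.IsNilpotent (H.map π)] {β : Module.Dual ℂ H} (hβ : β ≠ 0)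
    {x : G} (hx : x ∈ rootSpace H β) {χ : Module.Dual ℂ (H.map π)}
    (hχ : ∀ y : H, χ ⟨π y, y, y.2, rfl⟩ = β y) : π x ∈ rootSpace (H.map π) χ := by
  refine mem_rootSpace_map fun y => ?_
  rw [hχ, ← LieHom.map_lie, lie_eq_smul_of_mem_rootSpace hπ hker hβ hx, map_smul]

/-- Root vectors of the quotient lift to root vectors. -/
theorem exists_lift_of_mem_rootSpace [(H.map π).IsCartanSubalgebra] {χ : Module.Dual ℂ (H.map π)}
    (hχ : χ ≠ 0) {f : K}
    (hf : f ∈ rootSpace (H.map π) χ) :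
    ∃ F : G, π F = f ∧ ∀ y : H, ⁅(y : G), F⁆ = χ ⟨π y, y, y.2, rfl⟩ • F := by
  obtain ⟨⟨_, h0, hh0, rfl⟩, hy⟩ := DFunLike.ne_iff.1 hχ
  change χ ⟨π h0, h0, hh0, rfl⟩ ≠ 0 at hy
  set b := χ ⟨π h0, h0, hh0, rfl⟩ with hb
  obtain ⟨F, rfl⟩ := hπ f
  have hact : ∀ y : H, ⁅π y, π F⁆ = χ ⟨π y, y, y.2, rfl⟩ • π F := fun y =>
    IsKilling.lie_eq_smul_of_mem_rootSpace hf ⟨π y, y, y.2, rfl⟩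
  set F' := b⁻¹ • ⁅h0, F⁆ with hF'
  have hπF : π F' = π F := by
    rw [hF', map_smul, LieHom.map_lie, hact ⟨h0, hh0⟩, smul_smul, inv_mul_cancel₀ hy, one_smul]
  have hcent : ∀ a c : G, π a = π c → ∀ z : G, ⁅a, z⁆ = ⁅c, z⁆ := fun a c hac z => by
    rw [← sub_eq_zero, ← sub_lie, (hker _).1 (by rw [map_sub, hac, sub_self])]
  have hcent' : ∀ a c : G, π a = π c → ∀ z : G, ⁅z, a⁆ = ⁅z, c⁆ := fun a c hac z => by
    rw [← lie_skew, hcent a c hac, lie_skew]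
  have hh0F : ⁅h0, F'⁆ = b • F' := by
    rw [hcent' F' F hπF, hF', smul_smul, mul_inv_cancel₀ hy, one_smul]
  refine ⟨F', hπF, fun y => ?_⟩
  have h1 : ⁅⁅(y : G), h0⁆, F'⁆ = 0 := by
    refine (hker _).1 ?_ F'
    rw [LieHom.map_lie]
    have := IsKilling.instIsLieAbelianOfIsCartanSubalgebra ℂ K (H.map π)
    exact congrArg Subtype.val (this.trivial ⟨π y, y, y.2, rfl⟩ ⟨π h0, h0, hh0, rfl⟩)
  have h2 : ⁅h0, ⁅(y : G), F'⁆⁆ = b • ⁅(y : G), F'⁆ := by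
    rw [leibniz_lie, ← lie_skew h0, neg_lie, h1, neg_zero, zero_add, hh0F, lie_smul]
  have h3 : ⁅h0, ⁅(y : G), F'⁆⁆ = χ ⟨π y, y, y.2, rfl⟩ • b • F' := by
    rw [hcent' _ (χ ⟨π y, y, y.2, rfl⟩ • F') (by
      rw [LieHom.map_lie, hπF, hact, map_smul, hπF]), lie_smul, hh0F]
  rw [h2, smul_comm] at h3
  exact (smul_right_injective _ hy) h3

/-- The Cartan subalgebra of the quotient is spanned by brackets of opposite root vectors. Their
lifts have opposite weights, so the lifted brackets commute with `x`; and `y` differs from a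
combination of these by a central element. -/
theorem cartan_abelian {x y : G} (hx : x ∈ H) (hy : y ∈ H) : ⁅x, y⁆ = 0 := by
  have hcar := isCartanSubalgebra_map hπ hker (H := H)
  let W : Submodule ℂ G := LinearMap.ker (ad ℂ G x)
  have h1 : ∀ z : H.map π, (z : K) ∈ W.map (π : G →ₗ[ℂ] K) := by
    intro z
    have hz : z ∈ ⨆ α : Weight ℂ (H.map π) K, ⨆ (_ : α.IsNonZero), corootSpace α := by
      rw [IsKilling.biSup_corootSpace_eq_top]; trivial
    have hle : (⨆ α : Weight ℂ (H.map π) K, ⨆ (_ : α.IsNonZero),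
        (corootSpace α).toSubmodule) ≤
        (W.map (π : G →ₗ[ℂ] K)).comap (H.map π).toSubmodule.subtype := by
      refine iSup₂_le fun α hα u hu => ?_
      have hu' := (mem_corootSpace _).1 hu
      refine (Submodule.span_le.2 ?_ : _ ≤ W.map (π : G →ₗ[ℂ] K)) hu'
      rintro _ ⟨e, he, f, hf, rfl⟩
      have hα' : α.toLinear ≠ 0 := fun h0 => hα (by
        ext u; exact LinearMap.congr_fun h0 u)
      obtain ⟨E, rfl, hE⟩ := exists_lift_of_mem_rootSpace hπ hker (χ := α.toLinear) hα' he
      obtain ⟨F, rfl, hF⟩ := exists_lift_of_mem_rootSpace hπ hker (χ := -α.toLinear)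
        (neg_ne_zero.2 hα') hf
      refine ⟨⁅E, F⁆, ?_, by simp⟩
      change ⁅x, ⁅E, F⁆⁆ = 0
      rw [leibniz_lie, hE ⟨x, hx⟩, hF ⟨x, hx⟩]
      simp
    refine hle ?_
    simpa only [LieSubmodule.iSup_toSubmodule, ← LieSubmodule.mem_toSubmodule] using hz
  obtain ⟨w, hw, hwy⟩ := h1 ⟨π y, y, hy, rfl⟩
  have h2 : ⁅y - w, x⁆ = 0 := (hker _).1 (by
    rw [map_sub, sub_eq_zero]; exact hwy.symm) x
  have h3 : ⁅x, w⁆ = 0 := hw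
  rw [sub_lie, ← lie_skew w, h3, neg_zero, sub_zero] at h2
  rw [← lie_skew, h2, neg_zero]

theorem exists_smul_of_mem_rootSpace {β : Module.Dual ℂ H} (hβ : β ≠ 0) {x y : G}
    (hx : x ∈ rootSpace H β) (hx0 : x ≠ 0) (hy : y ∈ rootSpace H β) : ∃ a : ℂ, y = a • x := by
  have hcar := isCartanSubalgebra_map hπ hker (H := H)
  obtain ⟨χ, hχ⟩ := exists_dual_map hπ hker hβ hx hx0
  have hχ0 : χ ≠ 0 := by
    rintro rfl
    exact hβ (LinearMap.ext fun y => (hχ y).symm)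
  have hx' := apply_mem_rootSpace_map hπ hker hβ hx hχ
  have hy' := apply_mem_rootSpace_map hπ hker hβ hy hχ
  have hπx : π x ≠ 0 := fun h0 =>
    hx0 (eq_zero_of_mem_rootSpace_of_apply_eq_zero hker hβ h0 hx)
  let α : Weight ℂ (H.map π) K := ⟨χ, fun hb => hπx (by simpa [hb] using hx')⟩
  have hfr := IsKilling.finrank_rootSpace_eq_one α (fun h0 => hχ0 (LinearMap.ext fun y =>
    congrFun h0 y))
  obtain ⟨a, ha⟩ := (finrank_eq_one_iff_of_nonzero' (⟨π x, hx'⟩ : rootSpace (H.map π) χ)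
    (fun h0 => hπx (congrArg Subtype.val h0))).1 hfr ⟨π y, hy'⟩
  refine ⟨a, ?_⟩
  rw [← sub_eq_zero]
  refine eq_zero_of_mem_rootSpace_of_apply_eq_zero hker hβ ?_
    (sub_mem hy (Submodule.smul_mem _ _ hx))
  rw [map_sub, map_smul, sub_eq_zero]
  exact (congrArg Subtype.val ha).symm

/-- Take the opposite vector of an `sl₂`-triple in the quotient and lift it. The bracket with `x`
commutes with `H`, so it lies in `H`. If `π x = a • e`, then `β` takes the value `2 a` on it, which
explains the factor `a⁻¹`. -/
theorem exists_partner {β : Module.Dual ℂ H} (hβ : β ≠ 0) {x : G}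
    (hx : x ∈ rootSpace H β) (hx0 : x ≠ 0) :
    ∃ y ∈ rootSpace H (-β : Module.Dual ℂ H), ∃ t : H, ⁅x, y⁆ = t ∧ β t = 2 := by
  have hcar := isCartanSubalgebra_map hπ hker (H := H)
  obtain ⟨χ, hχ⟩ := exists_dual_map hπ hker hβ hx hx0
  have hχ0 : χ ≠ 0 := by
    rintro rfl
    exact hβ (LinearMap.ext fun y => (hχ y).symm)
  have hx' := apply_mem_rootSpace_map hπ hker hβ hx hχ
  have hπx : π x ≠ 0 := fun h0 =>
    hx0 (eq_zero_of_mem_rootSpace_of_apply_eq_zero hker hβ h0 hx)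
  let α : Weight ℂ (H.map π) K := ⟨χ, fun hb => hπx (by simpa [hb] using hx')⟩
  have hα : α.IsNonZero := fun h0 => hχ0 (LinearMap.ext fun y => congrFun h0 y)
  obtain ⟨h', e, f, ht, he, hf⟩ := IsKilling.exists_isSl2Triple_of_weight_isNonZero hα
  have hfr := IsKilling.finrank_rootSpace_eq_one α hα
  obtain ⟨a, ha⟩ := (finrank_eq_one_iff_of_nonzero' (⟨e, he⟩ : rootSpace (H.map π) χ)
    (fun h0 => ht.e_ne_zero (congrArg Subtype.val h0))).1 hfr ⟨π x, hx'⟩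
  have ha' : a • e = π x := congrArg Subtype.val ha
  have ha0 : a ≠ 0 := by
    rintro rfl
    exact hπx (by rw [← ha', zero_smul])
  obtain ⟨F, rfl, hF⟩ := exists_lift_of_mem_rootSpace hπ hker (χ := -χ) (neg_ne_zero.2 hχ0) hf
  have hF' : ∀ y : H, ⁅(y : G), F⁆ = -β y • F := fun y => by
    rw [hF, LinearMap.neg_apply, hχ]
  have hcar' : ⁅x, F⁆ ∈ H := by
    rw [← LieSubalgebra.IsCartanSubalgebra.self_normalizing (H := H), LieSubalgebra.mem_normalizer_iff]
    intro y hy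
    rw [← lie_skew, leibniz_lie, hF' ⟨y, hy⟩, lie_eq_smul_of_mem_rootSpace hπ hker hβ hx ⟨y, hy⟩]
    simp
  have hval : β ⟨⁅x, F⁆, hcar'⟩ = 2 * a := by
    have h1 := lie_eq_smul_of_mem_rootSpace hπ hker hβ hx ⟨⁅x, F⁆, hcar'⟩
    have h2 := congrArg π h1
    rw [LieHom.map_lie, LieHom.map_lie, map_smul, ← ha', smul_lie, ht.lie_e_f, lie_smul, smul_lie,
      ht.lie_h_e_nsmul, ← Nat.cast_smul_eq_nsmul ℂ, smul_smul, smul_smul, smul_smul] at h2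
    have h3 := smul_left_injective ℂ ht.e_ne_zero h2
    have h4 : (β ⟨⁅x, F⁆, hcar'⟩ - 2 * a) * a = 0 := by
      rw [sub_mul, ← h3]; push_cast; ring
    exact sub_eq_zero.1 ((mul_eq_zero.1 h4).resolve_right ha0)
  refine ⟨a⁻¹ • F, Submodule.smul_mem _ _ (weightSpace_le_genWeightSpace _ _ ?_),
    a⁻¹ • ⟨⁅x, F⁆, hcar'⟩, by simp, ?_⟩
  · rw [mem_weightSpace]
    exact hF'
  · rw [map_smul, hval, smul_eq_mul]
    field_simp

omit hπ hker [HasTrivialRadical ℂ K] [FiniteDimensional ℂ K] in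
theorem cartan_sup_iSup_rootSpace :
    H.toSubmodule ⊔ ⨆ β : {β : Module.Dual ℂ H // β ≠ 0},
      (rootSpace H (β : Module.Dual ℂ H)).toSubmodule = ⊤ := by
  have h1 := cartan_sup_iSup_rootSpace_eq_top H
  have h2 := congrArg LieSubmodule.toSubmodule h1
  simp only [LieSubmodule.sup_toSubmodule, LieSubmodule.iSup_toSubmodule,
    LieSubmodule.top_toSubmodule] at h2
  rw [eq_top_iff, ← h2]
  refine sup_le le_sup_left (iSup₂_le fun α hα => le_sup_of_le_right ?_)
  exact le_iSup (fun β : {β : Module.Dual ℂ H // β ≠ 0} =>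
    (rootSpace H (β : Module.Dual ℂ H)).toSubmodule)
    ⟨α.toLinear, fun h0 => hα (by ext u; exact LinearMap.congr_fun h0 u)⟩

end Reductive

section Reductive

open LieAlgebra LieModule

attribute [local instance 100] LieRing.ofAssociativeRing

/-- The structure of a reductive Lie algebra with respect to a Cartan subalgebra. -/
theorem IsReductiveLieAlgebra.root_decomposition {G : Type v} [LieRing G] [LieAlgebra ℂ G]
    [FiniteDimensional ℂ G] (hG : IsReductiveLieAlgebra G) (H : LieSubalgebra ℂ G)
    [H.IsCartanSubalgebra] :
    (∀ x ∈ H, ∀ y ∈ H, ⁅x, y⁆ = 0) ∧ ∀ β : Module.Dual ℂ H, β ≠ 0 → ∀ x ∈ rootSpace H β,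
      (∀ y : H, ⁅(y : G), x⁆ = β y • x) ∧ (x ≠ 0 → (∀ y ∈ rootSpace H β, ∃ a : ℂ, y = a • x) ∧
        ∃ y ∈ rootSpace H (-β : Module.Dual ℂ H), ∃ t : H, ⁅x, y⁆ = t ∧ β t = 2) := by
  have hπ : Function.Surjective (ad ℂ G).rangeRestrict := LieHom.surjective_rangeRestrict _
  have hker : ∀ x, (ad ℂ G).rangeRestrict x = 0 ↔ ∀ y : G, ⁅x, y⁆ = 0 := fun x => by
    rw [← Subtype.coe_inj]
    exact ⟨fun h0 y => LinearMap.congr_fun h0 y, fun h0 => LinearMap.ext h0⟩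
  have := hG.hasTrivialRadical hπ hker
  exact ⟨fun x hx y hy => cartan_abelian hπ hker hx hy, fun β hβ x hx =>
    ⟨lie_eq_smul_of_mem_rootSpace hπ hker hβ hx, fun hx0 =>
      ⟨fun y hy => exists_smul_of_mem_rootSpace hπ hker hβ hx hx0 hy,
        exists_partner hπ hker hβ hx hx0⟩⟩⟩

end Reductive


/-! ### Root data of a root reductive direct limit. -/

section Limit

open LieAlgebra

variable {g : Type u} [LieRing g] [LieAlgebra ℂ g] {h : LieSubalgebra ℂ g}

theorem exists_mem_wtSpace_of_forall_smul {x : g} (hx0 : x ≠ 0)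
    (hx : ∀ y : h, ∃ a : ℂ, ⁅(y : g), x⁆ = a • x) : ∃ α : Module.Dual ℂ h, x ∈ wtSpace h g α := by
  choose a ha using hx
  have hinj := smul_left_injective ℂ hx0
  refine ⟨{ toFun := a, map_add' := fun y z => hinj ?_, map_smul' := fun b y => hinj ?_ }, ha⟩
  · simp only [add_smul, ← ha]
    rw [← add_lie]
    rfl
  · simp only [RingHom.id_apply, smul_eq_mul, mul_smul, ← ha]
    rw [← smul_lie]
    rfl

theorem finite_of_wtSpace_le (hab : ∀ x ∈ h, ∀ y ∈ h, ⁅x, y⁆ = 0) (N : Submodule ℂ g)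
    [FiniteDimensional ℂ N] : {α ∈ rootSet h | wtSpace h g α ≤ N}.Finite := by
  set A := {α ∈ rootSet h | wtSpace h g α ≤ N}
  choose e he he0 using fun α : A => exists_ne_zero_of_mem_wtSupp α.2.1.2
  have hli : LinearIndependent ℂ e :=
    ((iSupIndep_wtSpace hab).comp Subtype.val_injective).linearIndependent _ he he0
  have hli' : LinearIndependent ℂ (fun α : A => (⟨e α, α.2.2 (he α)⟩ : N)) :=
    LinearIndependent.of_comp N.subtype hli
  exact Set.finite_coe_iff.1 hli'.finite

namespace RootReductiveSystem

variable {S : RootReductiveSystem.{v}} {ψ : ∀ n, S.G n →ₗ⁅ℂ⁆ g} 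

variable (ψ) in
/-- The non-zero images of root vectors of level `n`. -/
def rootVectors (n : ℕ) : Set g :=
  {x | x ≠ 0 ∧ ∃ β : Module.Dual ℂ (S.H n), β ≠ 0 ∧ ∃ y ∈ rootSpace (S.H n) β, ψ n y = x}

variable (hS : S.IsDirectLimit h ψ)
include hS

theorem exists_eq_of_le {n N : ℕ} (hN : n ≤ N) {x : S.G n} (hx : x ∈ S.H n) :
    ∃ y ∈ S.H N, ψ N y = ψ n x := by
  induction N, hN using Nat.le_induction with
  | base => exact ⟨x, hx, rfl⟩
  | succ N _ ih =>
    obtain ⟨y, hy, hyx⟩ := ih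
    exact ⟨S.φ N y, (S.rootHom N).1 y hy, (hS.compat N y).trans hyx⟩

theorem exists_mem_cartan_of_mem {y : g} (hy : y ∈ h) (n : ℕ) :
    ∃ N ≥ n, ∃ x ∈ S.H N, ψ N x = y := by
  obtain ⟨m, x, hx, rfl⟩ := (hS.mem_iff y).1 hy
  obtain ⟨z, hz, hzx⟩ := exists_eq_of_le hS (le_max_right n m) hx
  exact ⟨max n m, le_max_left n m, z, hz, hzx⟩

theorem abelian_limit : ∀ x ∈ h, ∀ y ∈ h, ⁅x, y⁆ = 0 := by
  intro x hx y hy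
  obtain ⟨n, x, hxn, rfl⟩ := (hS.mem_iff x).1 hx
  obtain ⟨N, hN, y, hyN, rfl⟩ := exists_mem_cartan_of_mem hS hy n
  obtain ⟨x', hx', hxx⟩ := exists_eq_of_le hS hN hxn
  rw [← hxx, ← LieHom.map_lie, ((S.reductive N).root_decomposition (S.H N)).1 x' hx' y hyN, map_zero]

theorem range_le_of_le {n N : ℕ} (hN : n ≤ N) : (ψ n).range ≤ (ψ N).range := by
  induction N, hN using Nat.le_induction with
  | base => exact le_rfl
  | succ N _ ih =>
    refine ih.trans ?_
    rintro _ ⟨x, rfl⟩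
    exact ⟨S.φ N x, hS.compat N x⟩

theorem rootVectors_subset {n N : ℕ} (hN : n ≤ N) : rootVectors ψ n ⊆ rootVectors ψ N := by
  induction N, hN using Nat.le_induction with
  | base => exact le_rfl
  | succ N _ ih =>
    refine ih.trans ?_
    rintro x ⟨hx0, β, hβ, y, hy, rfl⟩
    refine ⟨hx0, ?_⟩
    rcases (S.rootHom N).2 β hβ with h1 | ⟨β', hβ', h1⟩
    · rw [← hS.compat, h1 y hy, map_zero] at hx0
      exact absurd rfl hx0
    · exact ⟨β', hβ', S.φ N y, h1 y hy, hS.compat N y⟩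

theorem apply_mem {n : ℕ} (y : S.H n) : ψ n y ∈ h := (hS.mem_iff _).2 ⟨n, y, y.2, rfl⟩

/-- Any element of `h` comes from the Cartan subalgebra of some later level, where a non-zero image
of a root vector is again a root vector and hence an eigenvector. -/
theorem exists_mem_wtSpace {n : ℕ} {x : g} (hx : x ∈ rootVectors ψ n) :
    ∃ α : Module.Dual ℂ h, x ∈ wtSpace h g α := by
  refine exists_mem_wtSpace_of_forall_smul hx.1 fun ⟨y, hy⟩ => ?_
  obtain ⟨N, hN, y, hyN, rfl⟩ := exists_mem_cartan_of_mem hS hy n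
  obtain ⟨-, β, hβ, z, hz, rfl⟩ := rootVectors_subset hS hN hx
  refine ⟨β ⟨y, hyN⟩, ?_⟩
  simp only
  rw [← LieHom.map_lie, ((((S.reductive N).root_decomposition (S.H N)).2 β hβ z hz).1 ⟨y, hyN⟩),
    map_smul]

theorem apply_eq_of_mem_wtSpace {n : ℕ} {β : Module.Dual ℂ (S.H n)} (hβ : β ≠ 0) {x : S.G n}
    (hx : x ∈ rootSpace (S.H n) β) (hx0 : ψ n x ≠ 0) {α : Module.Dual ℂ h}
    (hα : ψ n x ∈ wtSpace h g α) (y : S.H n) : α ⟨ψ n y, apply_mem hS y⟩ = β y := by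
  have h1 := hα ⟨ψ n y, apply_mem hS y⟩
  simp only at h1
  rw [← LieHom.map_lie, ((((S.reductive n).root_decomposition (S.H n)).2 β hβ x hx).1 y),
    map_smul] at h1
  exact (smul_left_injective ℂ hx0 h1).symm

/-- At a common level both vectors come from root vectors whose roots are the pullback of `α`, hence
equal, and root spaces there are lines. -/
theorem exists_smul_of_mem_rootVectors {n m : ℕ} {x x' : g} (hx : x ∈ rootVectors ψ n)
    (hx' : x' ∈ rootVectors ψ m) {α : Module.Dual ℂ h} (hα : x ∈ wtSpace h g α)
    (hα' : x' ∈ wtSpace h g α) : ∃ a : ℂ, x' = a • x := by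
  obtain ⟨hx0, β, hβ, y, hy, rfl⟩ := rootVectors_subset hS (le_max_left n m) hx
  obtain ⟨hx0', β', hβ', y', hy', rfl⟩ := rootVectors_subset hS (le_max_right n m) hx'
  have hββ : β = β' := LinearMap.ext fun z => by
    rw [← apply_eq_of_mem_wtSpace hS hβ hy hx0 hα, ← apply_eq_of_mem_wtSpace hS hβ' hy' hx0' hα']
  subst hββ
  obtain ⟨a, rfl⟩ := ((((S.reductive _).root_decomposition (S.H _)).2 β hβ y hy).2
    (fun h0 => hx0 (by rw [h0, map_zero]))).1 y' hy'
  exact ⟨a, by rw [map_smul]⟩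

theorem exists_isRootTriple {n : ℕ} {x : g} (hx : x ∈ rootVectors ψ n) {α : Module.Dual ℂ h}
    (hα : x ∈ wtSpace h g α) : ∃ f ∈ rootVectors ψ n, ∃ c : h, IsRootTriple α x f c := by
  obtain ⟨hx0, β, hβ, y, hy, rfl⟩ := hx
  obtain ⟨z, hz, t, hyz, hβt⟩ := ((((S.reductive n).root_decomposition (S.H n)).2 β hβ y hy).2
    (fun h0 => hx0 (by rw [h0, map_zero]))).2
  have hα2 : α ⟨ψ n t, apply_mem hS t⟩ = 2 := by
    rw [apply_eq_of_mem_wtSpace hS hβ hy hx0 hα, hβt]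
  have hef : ⁅ψ n y, ψ n z⁆ = ψ n t := by rw [← LieHom.map_lie, hyz]
  have ht0 : ψ n t ≠ 0 := by
    intro h0
    have : (⟨ψ n t, apply_mem hS t⟩ : h) = 0 := Subtype.ext h0
    rw [this, map_zero] at hα2
    norm_num at hα2
  have hz0 : ψ n z ≠ 0 := by
    intro h0
    rw [h0, lie_zero] at hef
    exact ht0 hef.symm
  have hzr : ψ n z ∈ rootVectors ψ n := ⟨hz0, -β, neg_ne_zero.2 hβ, z, hz, rfl⟩
  obtain ⟨α', hα'⟩ := exists_mem_wtSpace hS hzr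
  have h1 : (ψ n t) ∈ wtSpace h g (α' + α) := by
    rw [← hef]
    exact lie_mem_wtSpace hα hα'
  have h2 : (ψ n t) ∈ wtSpace h g 0 := fun w => by
    simp [abelian_limit hS _ w.2 _ (apply_mem hS t)]
  have h3 : α' = -α := eq_neg_of_add_eq_zero_left (wt_unique h1 h2 ht0)
  subst h3
  exact ⟨ψ n z, hzr, ⟨ψ n t, apply_mem hS t⟩, hα, hα', hef, hα2⟩

omit hS in
theorem range_le_span (n : ℕ) : ((ψ n).range : Submodule ℂ g) ≤
    Submodule.span ℂ ((fun y => ψ n y) '' (S.H n : Set (S.G n)) ∪ rootVectors ψ n) := by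
  rintro _ ⟨x, rfl⟩
  have hx : x ∈ (S.H n).toSubmodule ⊔ ⨆ β : {β : Module.Dual ℂ (S.H n) // β ≠ 0},
      (rootSpace (S.H n) (β : Module.Dual ℂ (S.H n))).toSubmodule := by
    rw [cartan_sup_iSup_rootSpace]; trivial
  refine (sup_le ?_ (iSup_le fun β => ?_) : _ ≤ (Submodule.span ℂ
    ((fun y => ψ n y) '' (S.H n : Set (S.G n)) ∪ rootVectors ψ n)).comap (ψ n : S.G n →ₗ[ℂ] g)) hx
  · exact fun y hy => Submodule.subset_span (Or.inl ⟨y, hy, rfl⟩)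
  · intro y hy
    by_cases h0 : ψ n y = 0
    · exact (congrArg (· ∈ Submodule.span ℂ _) h0).mpr (zero_mem _)
    · exact Submodule.subset_span (Or.inr ⟨h0, β, β.2, y, hy, rfl⟩)

theorem exists_mem_rootVectors {n : ℕ} {α : Module.Dual ℂ h} (hα : α ≠ 0) {v : g}
    (hv : v ∈ wtSpace h g α) (hv0 : v ≠ 0) (hvn : v ∈ (ψ n).range) :
    ∃ t ∈ rootVectors ψ n, t ∈ wtSpace h g α ∧ ∃ a : ℂ, v = a • t := by
  have hab := abelian_limit hS
  have hw0 : ∀ y ∈ S.H n, ψ n y ∈ wtSpace h g 0 := fun y hy w => by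
    simp [hab _ w.2 _ (apply_mem hS ⟨y, hy⟩)]
  have hT : ∀ t ∈ ((fun y => ψ n y) '' (S.H n : Set (S.G n)) ∪ rootVectors ψ n),
      ∃ μ : Module.Dual ℂ h, t ∈ wtSpace h g μ := by
    rintro _ (⟨y, hy, rfl⟩ | ht)
    · exact ⟨0, hw0 y hy⟩
    · exact exists_mem_wtSpace hS ht
  have hvs := range_le_span (ψ := ψ) n hvn
  obtain ⟨t, ht, htα, ht0⟩ := exists_mem_inter_wtSpace hab hT hvs hv hv0
  have key : ∀ s ∈ ((fun y => ψ n y) '' (S.H n : Set (S.G n)) ∪ rootVectors ψ n),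
      s ∈ wtSpace h g α → s ≠ 0 → s ∈ rootVectors ψ n := by
    rintro _ (⟨y, hy, rfl⟩ | hs) hsα hs0
    · exact absurd (wt_unique hsα (hw0 y hy) hs0) hα
    · exact hs
  have htr := key t ht htα ht0
  refine ⟨t, htr, htα, ?_⟩
  have h1 := mem_span_inter_wtSpace hab hT hvs hv
  have h2 : v ∈ Submodule.span ℂ {t} := by
    refine (Submodule.span_le.2 ?_ : Submodule.span ℂ _ ≤ _) h1
    rintro s ⟨hs, hsα⟩
    by_cases hs0 : s = 0
    · rw [hs0]; exact zero_mem _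
    · obtain ⟨a, rfl⟩ := exists_smul_of_mem_rootVectors hS htr (key s hs hsα hs0) htα hsα
      exact Submodule.smul_mem _ _ (Submodule.mem_span_singleton_self t)
  obtain ⟨a, ha⟩ := Submodule.mem_span_singleton.1 h2
  exact ⟨a, ha.symm⟩

theorem exists_smul_of_mem_wtSpace {α : Module.Dual ℂ h} (hα : α ≠ 0) {x y : g}
    (hx : x ∈ wtSpace h g α) (hx0 : x ≠ 0) (hy : y ∈ wtSpace h g α) : ∃ a : ℂ, y = a • x := by
  by_cases hy0 : y = 0
  · exact ⟨0, by simp [hy0]⟩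
  obtain ⟨n, x', hx'⟩ := hS.surj x
  obtain ⟨m, y', hy'⟩ := hS.surj y
  obtain ⟨t, ht, htα, a, rfl⟩ := exists_mem_rootVectors hS hα hx hx0 (n := n) ⟨x', hx'⟩
  obtain ⟨s, hs, hsα, b, rfl⟩ := exists_mem_rootVectors hS hα hy hy0 (n := m) ⟨y', hy'⟩
  obtain ⟨c, rfl⟩ := exists_smul_of_mem_rootVectors hS ht hs htα hsα
  have ha : a ≠ 0 := by rintro rfl; simp at hx0
  exact ⟨b * c * a⁻¹, by rw [smul_smul, smul_smul, mul_assoc _ _ a, inv_mul_cancel₀ ha, mul_one]⟩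

theorem exists_rootData : Nonempty (RootData h) := by
  classical
  have hab := abelian_limit hS
  have hpick : ∀ α : Module.Dual ℂ h, ∃ e f : g, ∃ c : h, α ∈ rootSet h → IsRootTriple α e f c := by
    intro α
    by_cases hα : α ∈ rootSet h
    · obtain ⟨x, hx, hx0⟩ := exists_ne_zero_of_mem_wtSupp hα.2
      obtain ⟨n, x', hx'⟩ := hS.surj x
      obtain ⟨t, ht, htα, -⟩ := exists_mem_rootVectors hS hα.1 hx hx0 (n := n) ⟨x', hx'⟩
      obtain ⟨f, -, c, hc⟩ := exists_isRootTriple hS ht htα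
      exact ⟨t, f, c, fun _ => hc⟩
    · exact ⟨0, 0, 0, fun h0 => absurd h0 hα⟩
  choose e f c hefc using hpick
  have hone : ∀ {α}, α ∈ rootSet h → ∀ x ∈ wtSpace h g α, ∃ a : ℂ, x = a • e α :=
    fun hα x hx => exists_smul_of_mem_wtSpace hS hα.1 (hefc _ hα).e_mem
      (hefc _ hα).isSl2Triple.e_ne_zero hx
  have hle : ∀ {n α x}, α ≠ 0 → x ∈ wtSpace h g α → x ≠ 0 → x ∈ (ψ n).range →
      wtSpace h g α ≤ (ψ n).range.toSubmodule := by
    intro n α x hα hx hx0 hxn y hy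
    obtain ⟨a, rfl⟩ := exists_smul_of_mem_wtSpace hS hα hx hx0 hy
    exact Submodule.smul_mem _ _ hxn
  have hfin : ∀ n, {α ∈ rootSet h | wtSpace h g α ≤ (ψ n).range.toSubmodule}.Finite := fun n => by
    have : FiniteDimensional ℂ (ψ n).range.toSubmodule :=
      inferInstanceAs (FiniteDimensional ℂ (LinearMap.range (ψ n : S.G n →ₗ[ℂ] g)))
    exact finite_of_wtSpace_le hab _
  have hmem : ∀ {n α}, α ∈ (hfin n).toFinset ↔
      α ∈ rootSet h ∧ wtSpace h g α ≤ (ψ n).range.toSubmodule := by simp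
  refine ⟨{
    -- Level `n` collects the roots whose root space lies in the image of `G n`: finitely many,
    -- because that image is finite-dimensional, and closed under addition, because it is a
    -- subalgebra.
    Φ := fun n => (hfin n).toFinset
    e := e
    f := f
    c := c
    abelian := hab
    mono := fun n m hnm α hα => ?_
    mem_rootSet := fun hα => (hmem.1 hα).1
    exhaust := fun {α} hα => ?_
    neg_mem := fun {n α} hα => ?_
    triple := fun {α} hα => hefc α hα
    exists_smul := fun hα => hone hα
    closed := fun {n α γ} hα hγ h0 => ?_
    span_top := ?_ }⟩
  · exact hmem.2 ⟨(hmem.1 hα).1, (hmem.1 hα).2.trans (range_le_of_le hS hnm)⟩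
  · obtain ⟨n, x, hx⟩ := hS.surj (e α)
    exact ⟨n, hmem.2 ⟨hα, hle hα.1 (hefc α hα).e_mem (hefc α hα).isSl2Triple.e_ne_zero ⟨x, hx⟩⟩⟩
  · obtain ⟨h1, h2⟩ := hmem.1 hα
    obtain ⟨t, ht, htα, -⟩ := exists_mem_rootVectors hS h1.1 (hefc α h1).e_mem
      (hefc α h1).isSl2Triple.e_ne_zero (h2 (hefc α h1).e_mem)
    obtain ⟨f', ⟨-, β, -, y, -, rfl⟩, c', hc'⟩ := exists_isRootTriple hS ht htα
    exact hmem.2 ⟨hc'.symm.e_mem_rootSet, hle (neg_ne_zero.2 h1.1) hc'.f_mem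
      hc'.isSl2Triple.f_ne_zero ⟨y, rfl⟩⟩
  · obtain ⟨h1, h2⟩ := hmem.1 hα
    obtain ⟨h3, h4⟩ := hmem.1 hγ
    rw [or_iff_not_imp_left]
    intro hne
    have h5 := lie_mem_wtSpace (hefc α h1).e_mem (hefc γ h3).e_mem
    rw [add_comm] at h5
    exact hmem.2 ⟨⟨hne, mem_wtSupp_of_ne_zero h5 h0⟩, hle hne h5 h0
      ((ψ n).range.lie_mem (h2 (hefc α h1).e_mem) (h4 (hefc γ h3).e_mem))⟩
  · rw [eq_top_iff]
    intro x _
    obtain ⟨n, y, rfl⟩ := hS.surj x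
    refine (Submodule.span_le.2 ?_ : Submodule.span ℂ _ ≤ _) (range_le_span (ψ := ψ) n ⟨y, rfl⟩)
    rintro _ (⟨z, hz, rfl⟩ | ht)
    · exact Submodule.mem_sup_left (apply_mem hS ⟨z, hz⟩)
    · obtain ⟨α, hα⟩ := exists_mem_wtSpace hS ht
      obtain ⟨f', -, c', hc'⟩ := exists_isRootTriple hS ht hα
      exact Submodule.mem_sup_right (Submodule.mem_iSup_of_mem α
        (Submodule.mem_iSup_of_mem hc'.e_mem_rootSet hα))

end RootReductiveSystem

theorem IsRootReductiveDirectLimit.nonempty_rootData (hg : IsRootReductiveDirectLimit.{u, v} h) :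
    Nonempty (RootData h) := by
  obtain ⟨-, S, ψ, hS⟩ := hg
  exact RootReductiveSystem.exists_rootData hS

end Limit


/-! ### Lengths, long roots and connected levels. -/

namespace RootData

variable {g : Type u} [LieRing g] [LieAlgebra ℂ g] {h : LieSubalgebra ℂ g} (D : RootData h)
include D

/-- The inner product of a functional with a root, normalised by the trace form of level `n`. -/
noncomputable def ip (n : ℕ) (η α : Module.Dual ℂ h) : ℝ := D.pairing η α / D.len n α

theorem ip_comm {n : ℕ} {α γ : Module.Dual ℂ h} (hα : α ∈ D.Φ n) (hγ : γ ∈ D.Φ n) :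
    D.ip n α γ = D.ip n γ α := by
  have := D.len_mul_pairing hα hγ
  rw [ip, ip, div_eq_div_iff (D.len_pos hγ).ne' (D.len_pos hα).ne']
  linarith

theorem ip_add (n : ℕ) (η ξ α : Module.Dual ℂ h) : D.ip n (η + ξ) α = D.ip n η α + D.ip n ξ α := by
  rw [ip, ip, ip, pairing_add, add_div]

theorem ip_sub (n : ℕ) (η ξ α : Module.Dual ℂ h) : D.ip n (η - ξ) α = D.ip n η α - D.ip n ξ α := by
  rw [ip, ip, ip, pairing_sub, sub_div]

theorem ip_neg (n : ℕ) (η α : Module.Dual ℂ h) : D.ip n (-η) α = -D.ip n η α := by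
  rw [ip, ip, pairing_neg, neg_div]

theorem ip_self {n : ℕ} {α : Module.Dual ℂ h} (hα : α ∈ D.Φ n) : D.ip n α α = 2 / D.len n α := by
  rw [ip, D.pairing_self (D.mem_rootSet hα)]

theorem ip_self_pos {n : ℕ} {α : Module.Dual ℂ h} (hα : α ∈ D.Φ n) : 0 < D.ip n α α := by
  rw [D.ip_self hα]
  exact div_pos two_pos (D.len_pos hα)

theorem pairing_eq_ip {n : ℕ} {α : Module.Dual ℂ h} (η : Module.Dual ℂ h) (hα : α ∈ D.Φ n) :
    D.pairing η α = D.ip n η α * D.len n α := by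
  rw [ip, div_mul_cancel₀ _ (D.len_pos hα).ne']

theorem pairing_smul (x : ℝ) (η α : Module.Dual ℂ h) :
    D.pairing ((x : ℂ) • η) α = x * D.pairing η α := by
  simp [pairing]

theorem ip_smul (n : ℕ) (x : ℝ) (η α : Module.Dual ℂ h) :
    D.ip n ((x : ℂ) • η) α = x * D.ip n η α := by
  rw [ip, ip, pairing_smul, mul_div_assoc]

theorem refl_eq {α η : Module.Dual ℂ h} (hα : α ∈ rootSet h) (hη : η ∈ rootSet h) :
    D.refl α η = η - (D.pairing η α : ℂ) • α := by
  rw [refl, D.ofReal_pairing hα hη]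

theorem pairing_refl {α η : Module.Dual ℂ h} (hα : α ∈ rootSet h) (hη : η ∈ rootSet h)
    (γ : Module.Dual ℂ h) :
    D.pairing (D.refl α η) γ = D.pairing η γ - D.pairing η α * D.pairing α γ := by
  rw [D.refl_eq hα hη, pairing_sub, pairing_smul]

theorem ip_refl {α η : Module.Dual ℂ h} (hα : α ∈ rootSet h) (hη : η ∈ rootSet h)
    (n : ℕ) (γ : Module.Dual ℂ h) :
    D.ip n (D.refl α η) γ = D.ip n η γ - D.pairing η α * D.ip n α γ := by
  rw [D.refl_eq hα hη, ip_sub, ip_smul]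

theorem len_refl {n : ℕ} {α δ : Module.Dual ℂ h} (hα : α ∈ D.Φ n) (hδ : δ ∈ D.Φ n) :
    D.len n (D.refl δ α) = D.len n α := by
  have hα' := D.mem_rootSet hα
  have hδ' := D.mem_rootSet hδ
  have hr := D.refl_mem hδ hα
  have h1 : D.ip n (D.refl δ α) (D.refl δ α) = D.ip n α α := by
    rw [D.ip_refl hδ' hα', D.ip_comm hα hr, D.ip_comm hδ hr, D.ip_refl hδ' hα', D.ip_refl hδ' hα',
      D.ip_comm hδ hα, D.pairing_eq_ip α hδ, D.ip_self hδ]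
    field_simp [(D.len_pos hδ).ne']
    ring
  rw [D.ip_self hr, D.ip_self hα] at h1
  have h2 := (D.len_pos hα).ne'
  have h3 := (D.len_pos hr).ne'
  field_simp at h1
  linarith

theorem len_neg (n : ℕ) {α : Module.Dual ℂ h} (hα : α ∈ rootSet h) :
    D.len n (-α) = D.len n α := by
  simp only [len, pairing, D.c_neg hα, map_neg, Complex.neg_re, neg_sq]

/-- A root all of whose Cartan numbers with further roots are at most one in absolute value. -/
def IsLong (β : Module.Dual ℂ h) : Prop :=
  β ∈ rootSet h ∧ ∀ γ ∈ rootSet h, γ ≠ β → γ ≠ -β → |D.pairing γ β| ≤ 1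

/-- Some Cartan integer of `α` has absolute value at least 2. The product of the two Cartan integers
being at most 3, the opposite one is `±1`, and symmetrizing compares the lengths. Note that `len`
measures coroots, so the direction is reversed for roots. -/
theorem exists_two_mul_len_le {α : Module.Dual ℂ h} (hα : α ∈ rootSet h) (hl : ¬ D.IsLong α) :
    ∃ δ ∈ rootSet h, D.pairing α δ ≠ 0 ∧ D.pairing δ α ≠ 0 ∧
      ∀ n, α ∈ D.Φ n → δ ∈ D.Φ n → 2 * D.len n δ ≤ D.len n α := by
  simp only [IsLong, hα, true_and, not_forall, not_le] at hl
  obtain ⟨δ, hδ, h1, h2, h3⟩ := hl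
  have hmul := D.pairing_mul_le hα hδ h1 h2
  obtain ⟨k, hk⟩ := D.pairing_int hα hδ
  obtain ⟨l, hl⟩ := D.pairing_int hδ hα
  have hδα : D.pairing δ α ≠ 0 := by
    intro h0
    rw [h0] at h3
    norm_num at h3
  have hαδ : D.pairing α δ ≠ 0 := fun h0 => hδα ((D.pairing_eq_zero_comm hα hδ).1 h0)
  refine ⟨δ, hδ, hαδ, hδα, fun n hαn hδn => ?_⟩
  have h4 := D.len_mul_pairing hαn hδn
  have h5 := D.len_pos hαn
  have h6 := D.len_pos hδn
  rw [hk] at h3 hmul hδα h4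
  rw [hl] at hmul hαδ h4
  have h3' : 1 < |k| := by exact_mod_cast h3
  have hmul' : k * l ≤ 3 := by exact_mod_cast hmul
  have hl0 : l ≠ 0 := by exact_mod_cast hαδ
  have hk0 : k ≠ 0 := by exact_mod_cast hδα
  rcases lt_or_gt_of_ne hk0 with hk1 | hk1
  · rw [abs_of_neg hk1] at h3'
    have hl1 : l < 0 := by
      by_contra hc
      have hl2 : (0 : ℝ) < l := by
        have : 0 < l := by omega
        exact_mod_cast this
      have hk2 : (k : ℝ) < 0 := by exact_mod_cast hk1
      have := mul_pos h5 hl2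
      have := mul_neg_of_pos_of_neg h6 hk2
      linarith
    have hl2 : l = -1 := by nlinarith
    have hk2 : (k : ℝ) ≤ -2 := by
      have : k ≤ -2 := by omega
      exact_mod_cast this
    rw [hl2] at h4
    push_cast at h4
    nlinarith
  · rw [abs_of_pos hk1] at h3'
    have hl1 : 0 < l := by
      by_contra hc
      have hl2 : (l : ℝ) < 0 := by
        have : l < 0 := by omega
        exact_mod_cast this
      have hk2 : (0 : ℝ) < k := by exact_mod_cast hk1
      have := mul_neg_of_pos_of_neg h5 hl2
      have := mul_pos h6 hk2
      linarith
    have hl2 : l = 1 := by nlinarith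
    have hk2 : (2 : ℝ) ≤ k := by
      have : 2 ≤ k := by omega
      exact_mod_cast this
    rw [hl2] at h4
    push_cast at h4
    nlinarith

theorem len_le_of_pairing_ne_zero {n : ℕ} {α ε : Module.Dual ℂ h} (hα : α ∈ D.Φ n) (hε : ε ∈ D.Φ n)
    (h0 : D.pairing α ε ≠ 0) : D.len n α ≤ 3 * D.len n ε := by
  have hα' := D.mem_rootSet hα
  have hε' := D.mem_rootSet hε
  have hp := D.len_pos hε
  have hpα := D.len_pos hα
  by_cases h1 : ε = α
  · subst h1; linarith
  by_cases h2 : ε = -α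
  · have : D.len n ε = D.len n α := by rw [h2, D.len_neg n hα']
    linarith
  have hmul := D.pairing_mul_le hα' hε' h1 h2
  obtain ⟨l, hl⟩ := D.pairing_int hε' hα'
  have h4 := D.len_mul_pairing hα hε
  have h5 : (1 : ℝ) ≤ (D.pairing α ε) ^ 2 := by
    rw [hl] at h0 ⊢
    have hl0 : l ≠ 0 := by exact_mod_cast h0
    have : 0 < l ^ 2 := by positivity
    exact_mod_cast this
  have h6 : D.len n α * D.pairing α ε ^ 2 = D.len n ε * (D.pairing ε α * D.pairing α ε) := by
    rw [sq, ← mul_assoc, h4, mul_assoc]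
  nlinarith

/-- Without a long root, two successive steps give `4 len ε ≤ len α`. But `α` or its reflection in
`δ`, which has the same length, is not orthogonal to `ε`, and then the ratio is at most 3. -/
theorem exists_isLong (hne : ∃ α, α ∈ rootSet h) : ∃ β, D.IsLong β := by
  classical
  by_contra! hc
  obtain ⟨α, hα⟩ := hne
  obtain ⟨δ, hδ, h1, h1', h2⟩ := D.exists_two_mul_len_le hα (hc α)
  obtain ⟨ε, hε, h3, h3', h4⟩ := D.exists_two_mul_len_le hδ (hc δ)
  obtain ⟨n, hn⟩ := D.exists_level {α, δ, ε} (by simp [hα, hδ, hε])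
  have hαn : α ∈ D.Φ n := hn (by simp)
  have hδn : δ ∈ D.Φ n := hn (by simp)
  have hεn : ε ∈ D.Φ n := hn (by simp)
  have h5 := h2 n hαn hδn
  have h6 := h4 n hδn hεn
  have h7 := D.len_pos hεn
  by_cases h8 : D.pairing α ε = 0
  · have h9 := D.len_le_of_pairing_ne_zero (D.refl_mem hδn hαn) hεn (by
      rw [D.pairing_refl hδ hα, h8, zero_sub]
      exact neg_ne_zero.2 (mul_ne_zero h1 h3))
    rw [D.len_refl hαn hδn] at h9
    linarith
  · have := D.len_le_of_pairing_ne_zero hαn hεn h8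
    linarith

/-- Every root of a given level is connected within that level to `β` by a path of length two. -/
structure IsConnected (β : Module.Dual ℂ h) : Prop where
  mem : ∀ n, β ∈ D.Φ n
  exists_path : ∀ n, ∀ γ ∈ D.Φ n, ∃ δ ∈ D.Φ n, D.pairing δ β ≠ 0 ∧ D.pairing γ δ ≠ 0

/-- A chain can always be shortened to two steps: when neither middle root works for the longer
chain, reflecting one in the other does. -/
theorem exists_path_of_linked {β η : Module.Dual ℂ h} (hβ : β ∈ rootSet h) (hl : D.Linked β η) :
    ∃ δ ∈ rootSet h, D.pairing δ β ≠ 0 ∧ D.pairing η δ ≠ 0 := by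
  induction hl with
  | refl => exact ⟨β, hβ, by rw [D.pairing_self hβ]; norm_num, by rw [D.pairing_self hβ]; norm_num⟩
  | tail _ hbc ih =>
    rename_i η ζ _
    obtain ⟨hη, hζ, h1⟩ := hbc
    rw [ne_eq, ← D.pairing_eq_zero_iff hη hζ] at h1
    obtain ⟨δ, hδ, h2, h3⟩ := ih
    by_cases h4 : D.pairing η β = 0
    · by_cases h5 : D.pairing ζ δ = 0
      · refine ⟨D.refl η δ, D.refl_mem_rootSet hη hδ, ?_, ?_⟩
        · rwa [D.pairing_refl hη hδ, h4, mul_zero, sub_zero]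
        · rw [ne_eq, D.pairing_eq_zero_comm hζ (D.refl_mem_rootSet hη hδ), D.pairing_refl hη hδ,
            (D.pairing_eq_zero_comm hζ hδ).1 h5, zero_sub, neg_eq_zero, mul_eq_zero]
          rintro (h6 | h6)
          · exact h3 ((D.pairing_eq_zero_comm hη hδ).2 h6)
          · exact h1 ((D.pairing_eq_zero_comm hζ hη).2 h6)
      · exact ⟨δ, hδ, h2, h5⟩
    · exact ⟨η, hη, h4, h1⟩

/-- Suppose `α + γ` has no such path. It is orthogonal to `β` and to every root not orthogonal to
`β`. Using `α` and `γ` themselves, or else the reflections of `δ` in them, it is orthogonal to `α`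
and `γ`, hence to itself, which is absurd. This keeps the levels closed after discarding roots
without a path. -/
theorem path_add {n : ℕ} {β α γ : Module.Dual ℂ h} (hα : α ∈ D.Φ n) (hγ : γ ∈ D.Φ n)
    (hβ : β ∈ D.Φ n) (hσ : α + γ ∈ D.Φ n)
    (hpα : ∃ δ ∈ D.Φ n, D.pairing δ β ≠ 0 ∧ D.pairing α δ ≠ 0)  :
    ∃ δ ∈ D.Φ n, D.pairing δ β ≠ 0 ∧ D.pairing (α + γ) δ ≠ 0 := by
  have hα' := D.mem_rootSet hα
  have hγ' := D.mem_rootSet hγ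
  have hβ' := D.mem_rootSet hβ
  have hσ' := D.mem_rootSet hσ
  by_contra! hc
  have hc' : ∀ δ ∈ D.Φ n, D.pairing δ β ≠ 0 → D.pairing δ (α + γ) = 0 := fun δ hδ h0 =>
    (D.pairing_eq_zero_comm hσ' (D.mem_rootSet hδ)).1 (hc δ hδ h0)
  have hσσ : D.pairing α (α + γ) + D.pairing γ (α + γ) = 2 := by
    rw [← pairing_add, D.pairing_self hσ']
  have hσβ := hc β hβ (by rw [D.pairing_self hβ']; norm_num)
  rw [pairing_add] at hσβ
  by_cases h1 : D.pairing α β = 0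
  · have h2 : D.pairing γ β = 0 := by linarith
    obtain ⟨δ, hδ, h3, h4⟩ := hpα
    have hδ' := D.mem_rootSet hδ
    have h5 := hc' δ hδ h3
    have h6 := hc δ hδ h3
    rw [pairing_add] at h6
    have h7 := hc' _ (D.refl_mem hα hδ) (by
      rw [D.pairing_refl hα' hδ', h1, mul_zero, sub_zero]; exact h3)
    have h8 := hc' _ (D.refl_mem hγ hδ) (by
      rw [D.pairing_refl hγ' hδ', h2, mul_zero, sub_zero]; exact h3)
    rw [D.pairing_refl hα' hδ', h5, zero_sub, neg_eq_zero, mul_eq_zero] at h7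
    rw [D.pairing_refl hγ' hδ', h5, zero_sub, neg_eq_zero, mul_eq_zero] at h8
    have h9 := h7.resolve_left fun h0 => h4 ((D.pairing_eq_zero_comm hα' hδ').2 h0)
    have h10 := h8.resolve_left fun h0 => h4 (by
      have := (D.pairing_eq_zero_comm hγ' hδ').2 h0
      linarith)
    linarith
  · have h2 : D.pairing γ β ≠ 0 := fun h0 => h1 (by linarith)
    have := hc' α hα h1
    have := hc' γ hγ h2
    linarith

theorem exists_isConnected {β : Module.Dual ℂ h} (hβ : β ∈ rootSet h)
    (hl : ∀ γ ∈ rootSet h, D.Linked β γ) :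
    ∃ D' : RootData h, D'.c = D.c ∧ D'.IsConnected β := by
  classical
  obtain ⟨n₀, hn₀⟩ := D.exhaust hβ
  set P : ℕ → Module.Dual ℂ h → Prop := fun n γ =>
    ∃ δ ∈ D.Φ n, D.pairing δ β ≠ 0 ∧ D.pairing γ δ ≠ 0 with hP
  have hβn : ∀ n, β ∈ D.Φ (n₀ + n) := fun n => D.mono (Nat.le_add_right _ _) hn₀
  have hββ : D.pairing β β ≠ 0 := by rw [D.pairing_self hβ]; norm_num
  refine ⟨{ D with
    Φ := fun n => (D.Φ (n₀ + n)).filter (P (n₀ + n))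
    mono := ?_
    mem_rootSet := ?_
    exhaust := ?_
    neg_mem := ?_
    closed := ?_ }, rfl, ?_, ?_⟩
  · intro n m hnm γ hγ
    obtain ⟨h1, δ, h2, h3⟩ := Finset.mem_filter.1 hγ
    have hle := D.mono (Nat.add_le_add_left hnm n₀)
    exact Finset.mem_filter.2 ⟨hle h1, δ, hle h2, h3⟩
  · intro n α hα
    exact D.mem_rootSet (Finset.mem_filter.1 hα).1
  · intro γ hγ
    obtain ⟨δ, hδ, h1, h2⟩ := D.exists_path_of_linked hβ (hl γ hγ)
    obtain ⟨n, hn⟩ := D.exists_level {γ, δ} (by simp [hγ, hδ])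
    have hle := D.mono (Nat.le_add_left n n₀)
    exact ⟨n, Finset.mem_filter.2 ⟨hle (hn (by simp)), δ, hle (hn (by simp)), h1, h2⟩⟩
  · intro n α hα
    obtain ⟨h1, δ, h2, h3, h4⟩ := Finset.mem_filter.1 hα
    exact Finset.mem_filter.2 ⟨D.neg_mem h1, δ, h2, h3, by rwa [pairing_neg, neg_ne_zero]⟩
  · intro n α γ hα hγ h0
    obtain ⟨h1, h2⟩ := Finset.mem_filter.1 hα
    obtain ⟨h3, h4⟩ := Finset.mem_filter.1 hγ
    refine (D.closed h1 h3 h0).imp_right fun h5 => Finset.mem_filter.2 ⟨h5, ?_⟩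
    exact D.path_add h1 h3 (hβn n) h5 h2
  · intro n
    exact Finset.mem_filter.2 ⟨hβn n, β, hβn n, hββ, hββ⟩
  · intro n γ hγ
    obtain ⟨h1, δ, h2, h3, h4⟩ := Finset.mem_filter.1 hγ
    exact ⟨δ, Finset.mem_filter.2 ⟨h2, β, hβn n, hββ, h3⟩, h3, h4⟩

/-- Roots not orthogonal to `β` are compared through their Cartan integers. Any other root is first
reflected to such a root, with its length unchanged. -/
theorem len_le {β : Module.Dual ℂ h} (hlong : D.IsLong β) (hconn : D.IsConnected β) {n : ℕ}
    {γ : Module.Dual ℂ h} (hγ : γ ∈ D.Φ n) : D.len n β ≤ D.len n γ := by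
  have hβ := hconn.mem n
  have key : ∀ γ ∈ D.Φ n, D.pairing γ β ≠ 0 → D.len n β ≤ D.len n γ := by
    intro γ hγ h0
    have hγ' := D.mem_rootSet hγ
    by_cases h1 : γ = β
    · rw [h1]
    by_cases h2 : γ = -β
    · rw [h2, D.len_neg n hlong.1]
    have h3 := hlong.2 γ hγ' h1 h2
    have h4 := D.len_mul_pairing hβ hγ
    obtain ⟨l, hl⟩ := D.pairing_int hγ' hlong.1
    have h5 : D.pairing β γ ≠ 0 := fun h6 => h0 ((D.pairing_eq_zero_comm hlong.1 hγ').1 h6)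
    have h6 : (1 : ℝ) ≤ |D.pairing β γ| := by
      rw [hl] at h5 ⊢
      have : l ≠ 0 := by exact_mod_cast h5
      exact_mod_cast Int.one_le_abs this
    have h7 := congrArg abs h4
    have hpβ := D.len_pos hβ
    have hpγ := D.len_pos hγ
    rw [abs_mul, abs_mul, abs_of_pos hpβ, abs_of_pos hpγ] at h7
    nlinarith
  obtain ⟨δ, hδ, h1, h2⟩ := hconn.exists_path n γ hγ
  by_cases h0 : D.pairing γ β = 0
  · have h3 := key _ (D.refl_mem hδ hγ) (by
      rw [D.pairing_refl (D.mem_rootSet hδ) (D.mem_rootSet hγ), h0, zero_sub]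
      exact neg_ne_zero.2 (mul_ne_zero h2 h1))
    rwa [D.len_refl hγ hδ] at h3
  · exact key γ hγ h0

end RootData


/-! ### The Casimir operator of a level. -/

namespace RootData

variable {g : Type u} [LieRing g] [LieAlgebra ℂ g] {h : LieSubalgebra ℂ g} (D : RootData h)
variable {M : Type w} [AddCommGroup M] [Module ℂ M] [LieRingModule g M] [LieModule ℂ g M]
include D

/-- The element of `h` representing the root `α` with respect to the trace form of level `n`. -/
noncomputable def t (n : ℕ) (α : Module.Dual ℂ h) : h := (D.len n α : ℂ)⁻¹ • D.c α

/-- The root vector for `-α` dual to `e α` with respect to the trace form of level `n`. -/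
noncomputable def f' (n : ℕ) (α : Module.Dual ℂ h) : g := (D.len n α : ℂ)⁻¹ • D.f α

theorem ofReal_ip (n : ℕ) {γ α : Module.Dual ℂ h} (hγ : γ ∈ rootSet h) (hα : α ∈ rootSet h) :
    (D.ip n γ α : ℂ) = γ (D.t n α) := by
  rw [ip, t, map_smul, Complex.ofReal_div, D.ofReal_pairing hα hγ, smul_eq_mul, div_eq_inv_mul]

theorem t_neg (n : ℕ) {α : Module.Dual ℂ h} (hα : α ∈ rootSet h) : D.t n (-α) = -D.t n α := by
  rw [t, t, D.len_neg n hα, D.c_neg hα, smul_neg]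

theorem lie_e_f' (n : ℕ) {α : Module.Dual ℂ h} (hα : α ∈ rootSet h) :
    ⁅D.e α, D.f' n α⁆ = (D.t n α : g) := by
  rw [f', lie_smul, (D.triple hα).lie_ef]
  rfl

theorem f'_mem (n : ℕ) {α : Module.Dual ℂ h} (hα : α ∈ rootSet h) :
    D.f' n α ∈ wtSpace h g (-α) := Submodule.smul_mem _ _ (D.triple hα).f_mem

theorem t_ne_zero {n : ℕ} {α : Module.Dual ℂ h} (hα : α ∈ D.Φ n) : D.t n α ≠ 0 := by
  intro h0
  have h1 := D.ofReal_ip n (D.mem_rootSet hα) (D.mem_rootSet hα)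
  rw [h0, map_zero, Complex.ofReal_eq_zero] at h1
  exact (D.ip_self_pos hα).ne' h1

theorem f'_ne_zero {n : ℕ} {α : Module.Dual ℂ h} (hα : α ∈ D.Φ n) : D.f' n α ≠ 0 := by
  intro h0
  have := D.lie_e_f' n (D.mem_rootSet hα)
  rw [h0, lie_zero] at this
  exact D.t_ne_zero hα (Subtype.ext this.symm)

theorem exists_smul_f' {n : ℕ} {α : Module.Dual ℂ h} (hα : α ∈ D.Φ n) {x : g}
    (hx : x ∈ wtSpace h g (-α)) : ∃ a : ℂ, x = a • D.f' n α := by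
  have hα' := D.neg_mem_rootSet (D.mem_rootSet hα)
  obtain ⟨a, ha⟩ := D.exists_smul hα' _ (D.f'_mem n (D.mem_rootSet hα))
  obtain ⟨b, rfl⟩ := D.exists_smul hα' x hx
  have ha0 : a ≠ 0 := by
    rintro rfl
    exact D.f'_ne_zero hα (by simpa using ha)
  exact ⟨b * a⁻¹, by rw [ha, smul_smul, mul_assoc, inv_mul_cancel₀ ha0, mul_one]⟩

theorem sum_ip {n : ℕ} {γ δ : Module.Dual ℂ h} (hγ : γ ∈ D.Φ n) (hδ : δ ∈ D.Φ n) :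
    ∑ α ∈ D.Φ n, D.ip n γ α * D.ip n δ α = D.ip n γ δ := by
  have h1 : ∀ α ∈ D.Φ n, D.ip n γ α * D.ip n δ α =
      D.pairing α γ * D.pairing α δ / (D.len n γ * D.len n δ) := by
    intro α hα
    rw [D.ip_comm hγ hα, D.ip_comm hδ hα, ip, ip, div_mul_div_comm]
  rw [Finset.sum_congr rfl h1, ← Finset.sum_div, D.sum_pairing hγ hδ, ip,
    mul_div_mul_left _ _ (D.len_pos hγ).ne']

omit D in
theorem lie_lie_lie_eq (x y z : g) (m : M) :
    ⁅z, ⁅x, ⁅y, m⁆⁆⁆ = ⁅⁅z, x⁆, ⁅y, m⁆⁆ + ⁅x, ⁅⁅z, y⁆, m⁆⁆ + ⁅x, ⁅y, ⁅z, m⁆⁆⁆ := by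
  rw [leibniz_lie z x, leibniz_lie z y, lie_add, add_assoc]

variable (M) in
/-- The Casimir operator of level `n`. -/
noncomputable def casimir (n : ℕ) : Module.End ℂ M :=
  ∑ α ∈ D.Φ n, (LieModule.toEnd ℂ g M (D.t n α : g) * LieModule.toEnd ℂ g M (D.t n α : g) +
    LieModule.toEnd ℂ g M (D.e α) * LieModule.toEnd ℂ g M (D.f' n α))

theorem casimir_apply (n : ℕ) (m : M) : D.casimir M n m = ∑ α ∈ D.Φ n,
    (⁅(D.t n α : g), ⁅(D.t n α : g), m⁆⁆ + ⁅D.e α, ⁅D.f' n α, m⁆⁆) := by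
  simp [casimir, LinearMap.sum_apply]

theorem casimir_mem {n : ℕ} {N : Submodule ℂ M} (hN : ∀ x ∈ D.level n, ∀ m ∈ N, ⁅x, m⁆ ∈ N)
    {m : M} (hm : m ∈ N) : D.casimir M n m ∈ N := by
  rw [casimir_apply]
  have ht : ∀ x : h, (x : g) ∈ D.level n := fun x => Submodule.mem_sup_left x.2
  refine Submodule.sum_mem _ fun α hα => Submodule.add_mem _ (hN _ (ht _) _ (hN _ (ht _) _ hm))
    (hN _ (D.e_mem_level hα) _ (hN _ ?_ _ hm))
  obtain ⟨a, ha⟩ := D.exists_smul (D.neg_mem_rootSet (D.mem_rootSet hα)) _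
    (D.f'_mem n (D.mem_rootSet hα))
  rw [ha]
  exact Submodule.smul_mem _ _ (D.e_mem_level (D.neg_mem hα))

theorem lie_casimir_of_mem (n : ℕ) (x : h) (m : M) :
    ⁅(x : g), D.casimir M n m⁆ = D.casimir M n ⁅(x : g), m⁆ := by
  rw [casimir_apply, casimir_apply, lie_sum]
  refine Finset.sum_congr rfl fun α hα => ?_
  have hα' := D.mem_rootSet hα
  rw [lie_add, lie_lie_lie_eq _ _ (x : g), lie_lie_lie_eq _ _ (x : g), D.abelian _ x.2 _ (D.t n α).2, D.e_mem hα' x,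
    D.f'_mem n hα' x]
  simp

variable (hz : ∀ x : h, (∀ α ∈ rootSet h, α x = 0) → x = 0)
include hz

theorem sum_smul_t_eq_zero {n : ℕ} (y : Module.Dual ℂ h → ℝ)
    (h0 : ∀ δ ∈ D.Φ n, ∑ γ ∈ D.Φ n, y γ * D.ip n δ γ = 0) :
    ∑ γ ∈ D.Φ n, (y γ : ℂ) • D.t n γ = 0 := by
  have h1 : ∑ γ ∈ D.Φ n, (y γ : ℂ) • D.t n γ =
      ∑ γ ∈ D.Φ n, ((y γ / D.len n γ : ℝ) : ℂ) • D.c γ := by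
    refine Finset.sum_congr rfl fun γ _ => ?_
    rw [t, smul_smul, Complex.ofReal_div, div_eq_mul_inv]
  rw [h1]
  refine hz _ fun δ hδ => D.apply_eq_zero_of_sum (fun γ => y γ / D.len n γ) (fun α hα => ?_) hδ
  rw [← h1, map_sum, ← Complex.ofReal_zero, ← h0 α hα, Complex.ofReal_sum]
  refine Finset.sum_congr rfl fun γ hγ => ?_
  rw [map_smul, smul_eq_mul, Complex.ofReal_mul, D.ofReal_ip n (D.mem_rootSet hα)
    (D.mem_rootSet hγ)]

/-- The sum of the `t α ⊗ t α` over the level is inverse to the trace form, so it replaces a pair of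
dual bases in the Casimir operator even when `h` is infinite-dimensional. The identity is checked on
the roots of the level; that this suffices in `h` uses `hz`. -/
theorem sum_ip_smul_t {n : ℕ} {γ : Module.Dual ℂ h} (hγ : γ ∈ D.Φ n) :
    ∑ α ∈ D.Φ n, γ (D.t n α) • D.t n α = D.t n γ := by
  classical
  have h1 := D.sum_smul_t_eq_zero hz (n := n) (fun α => D.ip n γ α - if α = γ then 1 else 0)
    (fun δ hδ => by
      simp only [sub_mul, ite_mul, one_mul, zero_mul, Finset.sum_sub_distrib,
        Finset.sum_ite_eq', hγ, if_true]
      rw [D.sum_ip hγ hδ, D.ip_comm hγ hδ, sub_self])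
  simp only [Complex.ofReal_sub, sub_smul, Finset.sum_sub_distrib, sub_eq_zero] at h1
  refine Eq.trans (Finset.sum_congr rfl fun α hα => ?_) (h1.trans ?_)
  · rw [D.ofReal_ip n (D.mem_rootSet hγ) (D.mem_rootSet hα)]
  · rw [Finset.sum_eq_single γ (fun b _ hb => by simp [hb]) (fun hn => absurd hγ hn)]
    simp

theorem t_add {n : ℕ} {α γ : Module.Dual ℂ h} (hα : α ∈ D.Φ n) (hγ : γ ∈ D.Φ n)
    (hs : α + γ ∈ D.Φ n) : D.t n (α + γ) = D.t n α + D.t n γ := by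
  rw [← sub_eq_zero, ← D.sum_ip_smul_t hz hα, ← D.sum_ip_smul_t hz hγ, ← D.sum_ip_smul_t hz hs,
    ← Finset.sum_add_distrib, ← Finset.sum_sub_distrib]
  refine Finset.sum_eq_zero fun δ _ => ?_
  rw [LinearMap.add_apply, add_smul, sub_self]

/-- The Gram determinant of `α` and `γ` is non-zero, since the product of their Cartan integers is
less than 4. -/
theorem eq_zero_of_smul_t_add {n : ℕ} {α γ : Module.Dual ℂ h} (hα : α ∈ D.Φ n) (hγ : γ ∈ D.Φ n)
    (h1 : γ ≠ α) (h2 : γ ≠ -α) {a b : ℂ} (hab : a • D.t n α + b • D.t n γ = 0) : a = 0 := by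
  by_contra ha
  have hα' := D.mem_rootSet hα
  have hγ' := D.mem_rootSet hγ
  have e1 := congrArg α hab
  have e2 := congrArg γ hab
  simp only [map_add, map_smul, map_zero, smul_eq_mul] at e1 e2
  rw [← D.ofReal_ip n hα' hα', ← D.ofReal_ip n hα' hγ'] at e1
  rw [← D.ofReal_ip n hγ' hα', ← D.ofReal_ip n hγ' hγ'] at e2
  have e3 : a * ((D.ip n α α * D.ip n γ γ - D.ip n α γ * D.ip n γ α : ℝ) : ℂ) = 0 := by
    push_cast
    linear_combination (D.ip n γ γ : ℂ) * e1 - (D.ip n α γ : ℂ) * e2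
  rw [mul_eq_zero, or_iff_right ha, Complex.ofReal_eq_zero] at e3
  have e4 := D.pairing_mul_le hα' hγ' h1 h2
  rw [D.pairing_eq_ip γ hα, D.pairing_eq_ip α hγ] at e4
  have e5 := D.len_pos hα
  have e6 := D.len_pos hγ
  rw [D.ip_self hα, D.ip_self hγ] at e3
  have e7 : D.ip n γ α * D.len n α * (D.ip n α γ * D.len n γ) = 4 := by
    field_simp at e3
    linarith
  linarith

/-- The invariance of the structure constants. -/
theorem exists_structure_constant {n : ℕ} {α γ : Module.Dual ℂ h} (hα : α ∈ D.Φ n)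
    (hγ : γ ∈ D.Φ n) (hs : α + γ ∈ D.Φ n) :
    ∃ N : ℂ, ⁅D.e γ, D.e α⁆ = N • D.e (α + γ) ∧ ⁅D.e γ, D.f' n (α + γ)⁆ = -N • D.f' n α := by
  have hα' := D.mem_rootSet hα
  have hγ' := D.mem_rootSet hγ
  have hs' := D.mem_rootSet hs
  obtain ⟨N, hN⟩ := D.exists_smul hs' _ (lie_mem_wtSpace (D.e_mem hγ') (D.e_mem hα'))
  obtain ⟨a, ha⟩ := D.exists_smul_f' (n := n) hα (x := ⁅D.e γ, D.f' n (α + γ)⁆) (by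
    convert lie_mem_wtSpace (D.e_mem hγ') (D.f'_mem n hs') using 2
    abel)
  obtain ⟨b, hb⟩ := D.exists_smul_f' (n := n) hγ (x := ⁅D.e α, D.f' n (α + γ)⁆) (by
    convert lie_mem_wtSpace (D.e_mem hα') (D.f'_mem n hs') using 2
    abel)
  refine ⟨N, hN, ?_⟩
  -- The Jacobi identity evaluates this bracket in a second way, as a combination of the independent
  -- elements `t α` and `t γ`; comparing coefficients relates the structure constants.
  have h1 : ⁅⁅D.e γ, D.e α⁆, D.f' n (α + γ)⁆ = N • (D.t n (α + γ) : g) := by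
    rw [hN, smul_lie, D.lie_e_f' n hs']
  rw [lie_lie, hb, ha, lie_smul, lie_smul, D.lie_e_f' n hγ', D.lie_e_f' n hα',
    D.t_add hz hα hγ hs] at h1
  have h2 : (N + a) • D.t n α + (N - b) • D.t n γ = 0 := by
    have h3 : b • D.t n γ - a • D.t n α = N • (D.t n α + D.t n γ) := Subtype.ext h1
    have h4 : (N + a) • D.t n α + (N - b) • D.t n γ =
        -(b • D.t n γ - a • D.t n α - N • (D.t n α + D.t n γ)) := by module
    rw [h4, h3, sub_self, neg_zero]
  have h3 := D.eq_zero_of_smul_t_add hz hα hγ (by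
    rintro rfl
    exact D.two_smul_not_mem hα' hs') (by
    rintro rfl
    exact hs'.1 (add_neg_cancel _)) h2
  rw [ha, eq_neg_of_add_eq_zero_right h3]

/-- In the commutator, the terms `α = -γ` of `hA` and `α = γ` of `hB` cancel the contribution `hT`
of the Cartan part. The remaining terms cancel in pairs under `α ↦ α + γ`, by
`exists_structure_constant`. -/
theorem lie_casimir_e {n : ℕ} {γ : Module.Dual ℂ h} (hγ : γ ∈ D.Φ n) (m : M) :
    ⁅D.e γ, D.casimir M n m⁆ = D.casimir M n ⁅D.e γ, m⁆ := by
  classical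
  have hγ' := D.mem_rootSet hγ
  rw [casimir_apply, casimir_apply, lie_sum, ← sub_eq_zero, ← Finset.sum_sub_distrib]
  have h0n : (0 : Module.Dual ℂ h) ∉ D.Φ n := fun h0 => (D.mem_rootSet h0).1 rfl
  have hA : ∑ α ∈ D.Φ n, ⁅⁅D.e γ, D.e α⁆, ⁅D.f' n α, m⁆⁆ = ⁅(D.t n γ : g), ⁅D.e γ, m⁆⁆ +
      ∑ α ∈ (D.Φ n).filter (fun α => α + γ ∈ D.Φ n), ⁅⁅D.e γ, D.e α⁆, ⁅D.f' n α, m⁆⁆ := by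
    have h1 : ∀ α ∈ D.Φ n, ⁅⁅D.e γ, D.e α⁆, ⁅D.f' n α, m⁆⁆ =
        (if α = -γ then ⁅(D.t n γ : g), ⁅D.e γ, m⁆⁆ else 0) +
        (if α + γ ∈ D.Φ n then ⁅⁅D.e γ, D.e α⁆, ⁅D.f' n α, m⁆⁆ else 0) := by
      intro α hα
      by_cases h2 : α = -γ
      · subst h2
        rw [if_pos rfl, neg_add_cancel, if_neg h0n, add_zero]
        obtain ⟨a, ha⟩ := D.exists_smul hγ' _ (by
          simpa using D.f'_mem n (D.neg_mem_rootSet hγ'))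
        have h3 := D.lie_e_f' n (D.neg_mem_rootSet hγ')
        rw [D.t_neg n hγ', ha, lie_smul, ← lie_skew, smul_neg] at h3
        have h4 : a • ⁅D.e γ, D.e (-γ)⁆ = (D.t n γ : g) := neg_injective h3
        rw [ha, smul_lie, lie_smul, ← smul_lie, h4]
      · rw [if_neg h2, zero_add]
        split_ifs with h3
        · rfl
        · have h4 : ⁅D.e γ, D.e α⁆ = 0 := by
            by_contra h5
            rcases D.closed hγ hα h5 with h6 | h6
            · exact h2 (eq_neg_of_add_eq_zero_right h6)
            · exact h3 (by rwa [add_comm])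
          rw [h4, zero_lie]
    rw [Finset.sum_congr rfl h1, Finset.sum_add_distrib, Finset.sum_ite_eq',
      if_pos (D.neg_mem hγ), Finset.sum_filter]
  have hB : ∑ α ∈ D.Φ n, ⁅D.e α, ⁅⁅D.e γ, D.f' n α⁆, m⁆⁆ = ⁅D.e γ, ⁅(D.t n γ : g), m⁆⁆ +
      ∑ α ∈ (D.Φ n).filter (fun α => α - γ ∈ D.Φ n), ⁅D.e α, ⁅⁅D.e γ, D.f' n α⁆, m⁆⁆ := by
    have h1 : ∀ α ∈ D.Φ n, ⁅D.e α, ⁅⁅D.e γ, D.f' n α⁆, m⁆⁆ =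
        (if α = γ then ⁅D.e γ, ⁅(D.t n γ : g), m⁆⁆ else 0) +
        (if α - γ ∈ D.Φ n then ⁅D.e α, ⁅⁅D.e γ, D.f' n α⁆, m⁆⁆ else 0) := by
      intro α hα
      by_cases h2 : α = γ
      · subst h2
        rw [if_pos rfl, sub_self, if_neg h0n, add_zero, D.lie_e_f' n hγ']
      · rw [if_neg h2, zero_add]
        split_ifs with h3
        · rfl
        · have h4 : ⁅D.e γ, D.f' n α⁆ = 0 := by
            obtain ⟨a, ha⟩ := D.exists_smul (D.neg_mem_rootSet (D.mem_rootSet hα)) _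
              (D.f'_mem n (D.mem_rootSet hα))
            rw [ha, lie_smul]
            by_contra h5
            rcases D.closed hγ (D.neg_mem hα) (fun h6 => h5 (by rw [h6, smul_zero])) with h6 | h6
            · exact h2 (add_neg_eq_zero.1 h6).symm
            · exact h3 (by simpa [neg_add_rev, ← sub_eq_add_neg] using D.neg_mem h6)
          rw [h4, zero_lie, lie_zero]
    rw [Finset.sum_congr rfl h1, Finset.sum_add_distrib, Finset.sum_ite_eq', if_pos hγ,
      Finset.sum_filter]
  have hAB : ∑ α ∈ (D.Φ n).filter (fun α => α + γ ∈ D.Φ n), ⁅⁅D.e γ, D.e α⁆, ⁅D.f' n α, m⁆⁆ +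
      ∑ α ∈ (D.Φ n).filter (fun α => α - γ ∈ D.Φ n), ⁅D.e α, ⁅⁅D.e γ, D.f' n α⁆, m⁆⁆ = 0 := by
    rw [add_eq_zero_iff_eq_neg, ← Finset.sum_neg_distrib]
    refine Finset.sum_bij' (fun α _ => α + γ) (fun α _ => α - γ) ?_ ?_ ?_ ?_ ?_
    · intro α hα
      rw [Finset.mem_filter] at hα ⊢
      simpa using hα.symm
    · intro α hα
      rw [Finset.mem_filter] at hα ⊢
      simpa using hα.symm
    · intro α _
      exact add_sub_cancel_right α γ
    · intro α _
      exact sub_add_cancel α γ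
    · intro α hα
      obtain ⟨h1, h2⟩ := Finset.mem_filter.1 hα
      obtain ⟨N, hN, hN'⟩ := D.exists_structure_constant hz h1 hγ h2
      rw [hN, hN', smul_lie, smul_lie, lie_smul, neg_smul, neg_neg]
  have hT : ∑ α ∈ D.Φ n, (⁅⁅D.e γ, (D.t n α : g)⁆, ⁅(D.t n α : g), m⁆⁆ +
      ⁅(D.t n α : g), ⁅⁅D.e γ, (D.t n α : g)⁆, m⁆⁆) =
      -(⁅D.e γ, ⁅(D.t n γ : g), m⁆⁆ + ⁅(D.t n γ : g), ⁅D.e γ, m⁆⁆) := by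
    have h1 : (D.t n γ : g) = ∑ α ∈ D.Φ n, γ (D.t n α) • (D.t n α : g) := by
      conv_lhs => rw [← D.sum_ip_smul_t hz hγ]
      exact map_sum h.toSubmodule.subtype _ _
    rw [h1, sum_lie, sum_lie, lie_sum, ← Finset.sum_add_distrib,
      ← Finset.sum_neg_distrib]
    refine Finset.sum_congr rfl fun α _ => ?_
    rw [D.lie_e_h hγ']
    simp only [smul_lie, lie_smul, neg_smul, neg_lie, lie_neg, neg_add]
  have hsum : ∀ α : Module.Dual ℂ h, ⁅D.e γ, ⁅(D.t n α : g), ⁅(D.t n α : g), m⁆⁆ +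
      ⁅D.e α, ⁅D.f' n α, m⁆⁆⁆ - (⁅(D.t n α : g), ⁅(D.t n α : g), ⁅D.e γ, m⁆⁆⁆ +
        ⁅D.e α, ⁅D.f' n α, ⁅D.e γ, m⁆⁆⁆) =
      (⁅⁅D.e γ, (D.t n α : g)⁆, ⁅(D.t n α : g), m⁆⁆ +
        ⁅(D.t n α : g), ⁅⁅D.e γ, (D.t n α : g)⁆, m⁆⁆) + (⁅⁅D.e γ, D.e α⁆, ⁅D.f' n α, m⁆⁆ +
        ⁅D.e α, ⁅⁅D.e γ, D.f' n α⁆, m⁆⁆) := by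
    intro α
    rw [lie_add, lie_lie_lie_eq _ _ (D.e γ), lie_lie_lie_eq _ _ (D.e γ)]
    abel
  rw [Finset.sum_congr rfl fun α _ => hsum α, Finset.sum_add_distrib, hT, Finset.sum_add_distrib,
    hA, hB]
  rw [← hAB]
  abel

end RootData


/-! ### Positive systems and the Casimir eigenvalue at multiples of a long root. -/

namespace RootData

variable {g : Type u} [LieRing g] [LieAlgebra ℂ g] {h : LieSubalgebra ℂ g} (D : RootData h)

/-- A real functional defining a positive system of level `n` in which `β` is dominant. -/
structure IsPosFunctional (n : ℕ) (β : Module.Dual ℂ h) (l : Module.Dual ℂ h →ₗ[ℝ] ℝ) : Prop where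
  ne_zero : ∀ γ ∈ D.Φ n, l γ ≠ 0
  pos : ∀ γ ∈ D.Φ n, 0 < D.pairing γ β → 0 < l γ

include D

theorem exists_isPosFunctional {β : Module.Dual ℂ h} (hβ : β ∈ rootSet h) (n : ℕ) :
    ∃ l, D.IsPosFunctional n β l := by
  obtain ⟨l₀, hl₀⟩ := Module.exists_dual_forall_apply_ne_zero (K := ℝ)
    (fun γ : D.Φ n => (γ : Module.Dual ℂ h)) (fun γ => (D.mem_rootSet γ.2).1)
  -- `l₀` is a generic functional. Pairings with `β` are integers, so a weight `K` exceeding every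
  -- `|l₀ γ|` lets the sign of a non-zero pairing decide the sign of `l`.
  set K : ℝ := ∑ γ ∈ D.Φ n, |l₀ γ| + 1 with hK
  have hK0 : ∀ γ ∈ D.Φ n, |l₀ γ| < K := fun γ hγ => by
    have : |l₀ γ| ≤ ∑ γ ∈ D.Φ n, |l₀ γ| :=
      Finset.single_le_sum (f := fun γ => |l₀ γ|) (fun _ _ => abs_nonneg _) hγ
    linarith
  let p : Module.Dual ℂ h →ₗ[ℝ] ℝ :=
    { toFun := fun γ => D.pairing γ β
      map_add' := fun x y => D.pairing_add x y β
      map_smul' := fun a x => by simp [pairing] }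
  have hval : ∀ γ, (l₀ + K • p) γ = l₀ γ + K * D.pairing γ β := fun γ => rfl
  have hpos : ∀ γ ∈ D.Φ n, 0 < D.pairing γ β → 0 < (l₀ + K • p) γ := by
    intro γ hγ h0
    have h1 := hK0 γ hγ
    obtain ⟨k, hk⟩ := D.pairing_int hβ (D.mem_rootSet hγ)
    rw [hval, hk]
    rw [hk] at h0
    have h2 : (1 : ℝ) ≤ k := by
      have : 0 < k := by exact_mod_cast h0
      exact_mod_cast this
    have h3 := abs_lt.1 h1
    have h4 : 0 ≤ |l₀ γ| := abs_nonneg _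
    nlinarith
  refine ⟨l₀ + K • p, fun γ hγ => ?_, hpos⟩
  rcases lt_trichotomy (D.pairing γ β) 0 with h0 | h0 | h0
  · have := hpos (-γ) (D.neg_mem hγ) (by rw [pairing_neg]; linarith)
    rw [map_neg] at this
    linarith
  · rw [hval, h0, mul_zero, add_zero]
    exact hl₀ ⟨γ, hγ⟩
  · exact (hpos γ hγ h0).ne'

/-- The positive roots of level `n`. -/
noncomputable def posRoots (n : ℕ) (l : Module.Dual ℂ h →ₗ[ℝ] ℝ) : Finset (Module.Dual ℂ h) :=
  (D.Φ n).filter fun γ => 0 < l γ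

theorem mem_posRoots {n : ℕ} {l : Module.Dual ℂ h →ₗ[ℝ] ℝ} {γ : Module.Dual ℂ h} :
    γ ∈ D.posRoots n l ↔ γ ∈ D.Φ n ∧ 0 < l γ := Finset.mem_filter

/-- The sum of the inner products of a functional with the positive roots. -/
noncomputable def rhoSum (n : ℕ) (l : Module.Dual ℂ h →ₗ[ℝ] ℝ) (η : Module.Dual ℂ h) : ℝ :=
  ∑ α ∈ D.posRoots n l, D.ip n η α

theorem rhoSum_add (n : ℕ) (l : Module.Dual ℂ h →ₗ[ℝ] ℝ) (η ξ : Module.Dual ℂ h) :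
    D.rhoSum n l (η + ξ) = D.rhoSum n l η + D.rhoSum n l ξ := by
  simp only [rhoSum, ip_add, Finset.sum_add_distrib]

theorem rhoSum_neg (n : ℕ) (l : Module.Dual ℂ h →ₗ[ℝ] ℝ) (η : Module.Dual ℂ h) :
    D.rhoSum n l (-η) = -D.rhoSum n l η := by
  simp only [rhoSum, ip_neg, Finset.sum_neg_distrib]

theorem rhoSum_zero (n : ℕ) (l : Module.Dual ℂ h →ₗ[ℝ] ℝ) : D.rhoSum n l 0 = 0 := by
  simp [rhoSum, ip, pairing]

/-- Up to a positive factor this is the sum of the pairings of positive roots with `δ`. Positive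
roots that stay positive under the reflection in `δ` cancel in total. Those that become negative
have positive pairing with `δ`, and `δ` is one of them. -/
theorem rhoSum_pos {n : ℕ} {l : Module.Dual ℂ h →ₗ[ℝ] ℝ} {δ : Module.Dual ℂ h} (hδ : δ ∈ D.posRoots n l) :
    0 < D.rhoSum n l δ := by
  classical
  obtain ⟨hδn, hδl⟩ := D.mem_posRoots.1 hδ
  have hδ' := D.mem_rootSet hδn
  have h1 : D.rhoSum n l δ = (∑ α ∈ D.posRoots n l, D.pairing α δ) / D.len n δ := by
    rw [rhoSum, Finset.sum_div]
    refine Finset.sum_congr rfl fun α hα => ?_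
    rw [D.ip_comm hδn (D.mem_posRoots.1 hα).1, ip]
  rw [h1]
  refine div_pos ?_ (D.len_pos hδn)
  have hlr : ∀ α ∈ D.Φ n, l (D.refl δ α) = l α - D.pairing α δ * l δ := fun α hα => by
    rw [D.refl_eq hδ' (D.mem_rootSet hα), map_sub]
    congr 1
    have : ((D.pairing α δ : ℂ) • δ) = D.pairing α δ • δ := by
      ext x; simp
    rw [this, map_smul, smul_eq_mul]
  rw [← Finset.sum_filter_add_sum_filter_not (D.posRoots n l) (fun α => 0 < l (D.refl δ α))]
  have hA : ∑ α ∈ (D.posRoots n l).filter (fun α => 0 < l (D.refl δ α)), D.pairing α δ = 0 := by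
    have : ∑ α ∈ (D.posRoots n l).filter (fun α => 0 < l (D.refl δ α)), D.pairing α δ =
        ∑ α ∈ (D.posRoots n l).filter (fun α => 0 < l (D.refl δ α)), -D.pairing α δ := by
      refine Finset.sum_bij' (fun α _ => D.refl δ α) (fun α _ => D.refl δ α) ?_ ?_
        (fun α _ => D.refl_refl hδ' α) (fun α _ => D.refl_refl hδ' α) ?_
      all_goals
        intro α hα
        obtain ⟨h2, h3⟩ := Finset.mem_filter.1 hα
        obtain ⟨h4, h5⟩ := D.mem_posRoots.1 h2
      · exact Finset.mem_filter.2 ⟨D.mem_posRoots.2 ⟨D.refl_mem hδn h4, h3⟩, by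
          rwa [D.refl_refl hδ']⟩
      · exact Finset.mem_filter.2 ⟨D.mem_posRoots.2 ⟨D.refl_mem hδn h4, h3⟩, by
          rwa [D.refl_refl hδ']⟩
      · rw [D.pairing_refl hδ' (D.mem_rootSet h4), D.pairing_self hδ']
        ring
    rw [Finset.sum_neg_distrib] at this
    linarith
  rw [hA, zero_add]
  refine Finset.sum_pos (fun α hα => ?_) ⟨δ, Finset.mem_filter.2 ⟨hδ, ?_⟩⟩
  · obtain ⟨h2, h3⟩ := Finset.mem_filter.1 hα
    obtain ⟨h4, h5⟩ := D.mem_posRoots.1 h2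
    rw [hlr α h4, not_lt] at h3
    by_contra hc
    have : D.pairing α δ * l δ ≤ 0 := mul_nonpos_of_nonpos_of_nonneg (not_lt.1 hc) hδl.le
    linarith
  · rw [hlr δ hδn, D.pairing_self hδ']
    linarith

/-- If the pairing of `γ` with `β` is positive, it equals 1, and `β - γ` is a positive root. If it
is zero, some positive `δ` makes `γ + δ` a root of the previous kind. If it is negative, `-γ` is
positive while `rhoSum` at `β` is positive. -/
theorem rhoSum_lt {n : ℕ} {β : Module.Dual ℂ h} {l : Module.Dual ℂ h →ₗ[ℝ] ℝ}
    (hl : D.IsPosFunctional n β l) (hlong : D.IsLong β) (hconn : D.IsConnected β)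
    {γ : Module.Dual ℂ h} (hγ : γ = 0 ∨ γ ∈ D.Φ n) (hne : γ ≠ β) :
    D.rhoSum n l γ < D.rhoSum n l β := by
  have hβ := hconn.mem n
  have hβ' := hlong.1
  have hpos : ∀ δ ∈ D.Φ n, 0 < D.pairing δ β → 0 < D.rhoSum n l δ := fun δ hδ h0 =>
    D.rhoSum_pos (D.mem_posRoots.2 ⟨hδ, hl.pos δ hδ h0⟩)
  have hββ : 0 < D.rhoSum n l β := hpos β hβ (by rw [D.pairing_self hβ']; norm_num)
  have key : ∀ γ ∈ D.Φ n, γ ≠ β → 0 < D.pairing γ β → D.rhoSum n l γ < D.rhoSum n l β := by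
    intro γ hγ hne h0
    have hγ' := D.mem_rootSet hγ
    have h1 := hlong.2 γ hγ' hne (by
      rintro rfl
      rw [pairing_neg, D.pairing_self hβ'] at h0
      linarith)
    obtain ⟨k, hk⟩ := D.pairing_int hβ' hγ'
    have hk1 : D.pairing γ β = 1 := by
      rw [hk] at h0 h1 ⊢
      have h2 : 0 < k := by exact_mod_cast h0
      have h3 : |k| ≤ 1 := by exact_mod_cast h1
      rw [abs_of_pos h2] at h3
      have : k = 1 := by omega
      exact_mod_cast this
    have h2 : -(D.refl β γ) ∈ D.Φ n := D.neg_mem (D.refl_mem hβ hγ)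
    have h3 := hpos _ h2 (by
      rw [pairing_neg, D.pairing_refl hβ' hγ', D.pairing_self hβ', hk1]
      norm_num)
    have h4 : D.refl β γ = γ + -β := by
      rw [D.refl_eq hβ' hγ', hk1, Complex.ofReal_one, one_smul, sub_eq_add_neg]
    rw [rhoSum_neg, h4, rhoSum_add, rhoSum_neg] at h3
    linarith
  rcases hγ with rfl | hγ
  · rwa [rhoSum_zero]
  have hγ' := D.mem_rootSet hγ
  rcases lt_trichotomy (D.pairing γ β) 0 with h0 | h0 | h0
  · have := hpos (-γ) (D.neg_mem hγ) (by rw [pairing_neg]; linarith)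
    rw [rhoSum_neg] at this
    linarith
  · obtain ⟨δ, hδ, h1, h2⟩ : ∃ δ ∈ D.Φ n, 0 < D.pairing δ β ∧ D.pairing γ δ < 0 := by
      have hsign : ∃ δ ∈ D.Φ n, 0 < D.pairing δ β ∧ D.pairing γ δ ≠ 0 := by
        obtain ⟨δ, hδ, h1, h2⟩ := hconn.exists_path n γ hγ
        rcases lt_or_gt_of_ne h1 with h3 | h3
        · refine ⟨-δ, D.neg_mem hδ, by rw [pairing_neg]; linarith, ?_⟩
          rw [pairing, D.c_neg (D.mem_rootSet hδ), map_neg, Complex.neg_re, neg_ne_zero]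
          exact h2
        · exact ⟨δ, hδ, h3, h2⟩
      obtain ⟨δ, hδ, h1, h2⟩ := hsign
      have hδ' := D.mem_rootSet hδ
      rcases lt_or_gt_of_ne h2 with h3 | h3
      · exact ⟨δ, hδ, h1, h3⟩
      · refine ⟨D.refl γ δ, D.refl_mem hγ hδ, ?_, ?_⟩
        · rwa [D.pairing_refl hγ' hδ', h0, mul_zero, sub_zero]
        · have hr := D.refl_mem hγ hδ
          rw [D.pairing_eq_ip γ hr, D.ip_comm hγ hr]
          refine mul_neg_of_neg_of_pos ?_ (D.len_pos hr)
          rw [D.ip_refl hγ' hδ', D.pairing_eq_ip δ hγ, D.ip_self hγ, D.ip_comm hδ hγ]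
          have h4 : 0 < D.ip n γ δ := by
            rw [D.pairing_eq_ip γ hδ] at h3
            exact (mul_pos_iff_of_pos_right (D.len_pos hδ)).1 h3
          have h5 := (D.len_pos hγ).ne'
          field_simp
          linarith
    have hδ' := D.mem_rootSet hδ
    obtain ⟨k, hk, hs⟩ := D.exists_int hδ' hγ'
    have hk0 : k < 0 := by
      have : D.pairing γ δ = k := by simp [pairing, hk]
      rw [this] at h2
      exact_mod_cast h2
    have h3 : γ + δ ∈ D.Φ n := by
      have h3 := hs (-1) (by omega)
      rw [neg_one_zsmul, sub_neg_eq_add] at h3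
      refine D.add_mem hγ hδ (h3.resolve_left fun h4 => ?_)
      have h5 : D.pairing (γ + δ) β = 0 := by rw [h4]; simp [pairing]
      rw [pairing_add, h0] at h5
      linarith
    have h4 : 0 < D.pairing (γ + δ) β := by rw [pairing_add, h0, zero_add]; exact h1
    have h5 := hpos δ hδ h1
    have h6 : D.rhoSum n l (γ + δ) ≤ D.rhoSum n l β := by
      by_cases h7 : γ + δ = β
      · rw [h7]
      · exact (key _ h3 h7 h4).le
    rw [rhoSum_add] at h6
    linarith
  · exact key γ hγ hne h0

/-- A sum of `k` elements each of which is zero or a root of level `n`. -/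
def IsSum (n k : ℕ) (ν : Module.Dual ℂ h) : Prop :=
  ∃ L : List (Module.Dual ℂ h), L.length = k ∧ (∀ γ ∈ L, γ = 0 ∨ γ ∈ D.Φ n) ∧ L.sum = ν

theorem IsSum.zero (n : ℕ) : D.IsSum n 0 0 := ⟨[], rfl, by simp, rfl⟩

theorem IsSum.add {n k : ℕ} {γ ν : Module.Dual ℂ h} (hγ : γ = 0 ∨ γ ∈ D.Φ n)
    (hν : D.IsSum n k ν) : D.IsSum n (k + 1) (γ + ν) := by
  obtain ⟨L, rfl, hL, rfl⟩ := hν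
  exact ⟨γ :: L, rfl, by simpa using ⟨hγ, hL⟩, rfl⟩

/-- The trace form of level `n` on functionals. -/
noncomputable def form (n : ℕ) (η ξ : Module.Dual ℂ h) : ℝ := ∑ α ∈ D.Φ n, D.ip n η α * D.ip n ξ α

theorem form_add_left (n : ℕ) (η η' ξ : Module.Dual ℂ h) :
    D.form n (η + η') ξ = D.form n η ξ + D.form n η' ξ := by
  simp only [form, ip_add, add_mul, Finset.sum_add_distrib]

theorem form_comm (n : ℕ) (η ξ : Module.Dual ℂ h) : D.form n η ξ = D.form n ξ η :=
  Finset.sum_congr rfl fun _ _ => mul_comm _ _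

theorem form_zero_left (n : ℕ) (ξ : Module.Dual ℂ h) : D.form n 0 ξ = 0 := by
  simp [form, ip, pairing]

theorem form_self_nonneg (n : ℕ) (η : Module.Dual ℂ h) : 0 ≤ D.form n η η :=
  Finset.sum_nonneg fun _ _ => mul_self_nonneg _

theorem form_self_le {n : ℕ} {β : Module.Dual ℂ h} (hlong : D.IsLong β) (hconn : D.IsConnected β)
    {γ : Module.Dual ℂ h} (hγ : γ = 0 ∨ γ ∈ D.Φ n) : D.form n γ γ ≤ D.form n β β := by
  rcases hγ with rfl | hγ
  · rw [form_zero_left]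
    exact D.form_self_nonneg n β
  · rw [form, form, D.sum_ip hγ hγ, D.sum_ip (hconn.mem n) (hconn.mem n), D.ip_self hγ,
      D.ip_self (hconn.mem n)]
    exact div_le_div_of_nonneg_left zero_le_two (D.len_pos (hconn.mem n)) (D.len_le hlong hconn hγ)

theorem form_le {n : ℕ} {η ξ : Module.Dual ℂ h} {q : ℝ} (hη : D.form n η η ≤ q)
    (hξ : D.form n ξ ξ ≤ q) : D.form n η ξ ≤ q := by
  have h1 : 2 * D.form n η ξ ≤ D.form n η η + D.form n ξ ξ := by
    simp only [form, ← Finset.sum_add_distrib, Finset.mul_sum]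
    refine Finset.sum_le_sum fun α _ => ?_
    nlinarith [sq_nonneg (D.ip n η α - D.ip n ξ α)]
  linarith

/-- A long root has the greatest norm in its level, so each of the `k²` inner products of summands
is at most the square norm of `β`. -/
theorem form_sum_le {n : ℕ} {β : Module.Dual ℂ h} (hlong : D.IsLong β) (hconn : D.IsConnected β)
    {k : ℕ} {ν : Module.Dual ℂ h} (hν : D.IsSum n k ν) :
    D.form n ν ν ≤ k ^ 2 * D.form n β β := by
  obtain ⟨L, rfl, hL, rfl⟩ := hν
  have h1 : ∀ L : List (Module.Dual ℂ h), (∀ γ ∈ L, γ = 0 ∨ γ ∈ D.Φ n) → ∀ ξ,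
      (ξ = 0 ∨ ξ ∈ D.Φ n) → D.form n L.sum ξ ≤ L.length * D.form n β β := by
    intro L hL ξ hξ
    induction L with
    | nil => simp [form_zero_left]
    | cons a L ih =>
      have h2 := ih fun γ hγ => hL γ (List.mem_cons_of_mem _ hγ)
      have h3 := D.form_le (D.form_self_le hlong hconn (hL a List.mem_cons_self))
        (D.form_self_le hlong hconn hξ)
      rw [List.sum_cons, form_add_left, List.length_cons]
      push_cast
      linarith
  induction L with
  | nil => simp [form_zero_left]
  | cons a L ih =>
    have hL' : ∀ γ ∈ L, γ = 0 ∨ γ ∈ D.Φ n := fun γ hγ => hL γ (List.mem_cons_of_mem _ hγ)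
    have h2 := ih hL'
    have h3 := D.form_self_le hlong hconn (hL a List.mem_cons_self)
    have h4 := h1 L hL' a (hL a List.mem_cons_self)
    have h5 : D.form n (a + L.sum) (a + L.sum) =
        D.form n a a + 2 * D.form n L.sum a + D.form n L.sum L.sum := by
      rw [form_add_left, D.form_comm n a, D.form_comm n L.sum (a + _), form_add_left, form_add_left,
        D.form_comm n a L.sum]
      ring
    rw [List.sum_cons, h5, List.length_cons]
    push_cast
    linarith

theorem rhoSum_sum {n : ℕ} {β : Module.Dual ℂ h} {l : Module.Dual ℂ h →ₗ[ℝ] ℝ}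
    (hl : D.IsPosFunctional n β l) (hlong : D.IsLong β) (hconn : D.IsConnected β)
    {k : ℕ} {ν : Module.Dual ℂ h} (hν : D.IsSum n k ν) :
    D.rhoSum n l ν ≤ k * D.rhoSum n l β ∧ (D.rhoSum n l ν = k * D.rhoSum n l β → ν = k • β) := by
  obtain ⟨L, rfl, hL, rfl⟩ := hν
  induction L with
  | nil => simp [rhoSum_zero]
  | cons a L ih =>
    obtain ⟨h1, h2⟩ := ih fun γ hγ => hL γ (List.mem_cons_of_mem _ hγ)
    rw [List.sum_cons, rhoSum_add, List.length_cons]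
    push_cast
    by_cases ha : a = β
    · subst ha
      refine ⟨by linarith, fun h3 => ?_⟩
      rw [h2 (by linarith), succ_nsmul, add_comm]
    · have h3 := D.rhoSum_lt hl hlong hconn (hL a List.mem_cons_self) ha
      exact ⟨by linarith, fun h4 => by linarith⟩

/-- Among the sums of `k` roots the Casimir eigenvalue of highest weight `k β` is attained only
at `k β`. -/
theorem eq_nsmul_of_casimir_eq {n : ℕ} {β : Module.Dual ℂ h} {l : Module.Dual ℂ h →ₗ[ℝ] ℝ}
    (hl : D.IsPosFunctional n β l) (hlong : D.IsLong β) (hconn : D.IsConnected β)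
    {k : ℕ} {ν : Module.Dual ℂ h} (hν : D.IsSum n k ν)
    (heq : D.form n ν ν + D.rhoSum n l ν = k ^ 2 * D.form n β β + k * D.rhoSum n l β) :
    ν = k • β := by
  have h1 := D.form_sum_le hlong hconn hν
  obtain ⟨h2, h3⟩ := D.rhoSum_sum hl hlong hconn hν
  exact h3 (by linarith)

end RootData


/-! ### Blocks and the Casimir projection onto a simple constituent. -/

namespace RootData

variable {g : Type u} [LieRing g] [LieAlgebra ℂ g] {h : LieSubalgebra ℂ g} (D : RootData h)
variable {M : Type w} [AddCommGroup M] [Module ℂ M] [LieRingModule g M] [LieModule ℂ g M]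

/-- A subspace stable under `h` contains the weight components of its elements. -/
theorem component_mem {Y : Submodule ℂ M} (hY : ∀ x ∈ h, ∀ m ∈ Y, ⁅x, m⁆ ∈ Y)
    (s : Finset (Module.Dual ℂ h)) (x : Module.Dual ℂ h → M) (hx : ∀ μ, x μ ∈ wtSpace h M μ)
    (hs : ∑ μ ∈ s, x μ ∈ Y) : ∀ μ ∈ s, x μ ∈ Y := by
  classical
  induction s using Finset.induction_on generalizing x with
  | empty => simp
  | insert a s ha ih =>
    have key : ∀ μ ∈ s, x μ ∈ Y := by
      intro μ hμ
      -- The operator `y - a y` removes the component of weight `a` and rescales the one of weight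
      -- `μ` by a non-zero factor.
      obtain ⟨y, hy⟩ := DFunLike.ne_iff.1 (show μ ≠ a by rintro rfl; exact ha hμ)
      have h1 : ∑ ν ∈ s, (ν y - a y) • x ν ∈ Y := by
        have h2 : ⁅(y : g), ∑ ν ∈ insert a s, x ν⁆ - a y • ∑ ν ∈ insert a s, x ν =
            ∑ ν ∈ s, (ν y - a y) • x ν := by
          rw [lie_sum, Finset.smul_sum, ← Finset.sum_sub_distrib, Finset.sum_insert ha,
            hx a y, sub_self, zero_add]
          exact Finset.sum_congr rfl fun ν _ => by rw [hx ν y, sub_smul]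
        rw [← h2]
        exact Submodule.sub_mem _ (hY _ y.2 _ hs) (Submodule.smul_mem _ _ hs)
      have h3 := ih (fun ν => (ν y - a y) • x ν) (fun ν => Submodule.smul_mem _ _ (hx ν)) h1 μ hμ
      exact (Submodule.smul_mem_iff _ (sub_ne_zero.2 hy)).1 h3
    intro μ hμ
    rcases Finset.mem_insert.1 hμ with rfl | h1
    · rw [Finset.sum_insert ha] at hs
      exact (Submodule.add_mem_iff_left _ (Submodule.sum_mem _ key)).1 hs
    · exact key μ h1

theorem mem_span_weight_vectors {Y : Submodule ℂ M} (hY : ∀ x ∈ h, ∀ m ∈ Y, ⁅x, m⁆ ∈ Y)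
    {x : M} (hx : x ∈ Y) (hgr : x ∈ ⨆ μ, wtSpace h M μ) :
    ∃ f : Module.Dual ℂ h →₀ M, (∀ μ, f μ ∈ wtSpace h M μ ∧ f μ ∈ Y) ∧
      (f.sum fun _ v => v) = x := by
  obtain ⟨f, hf, rfl⟩ := (Submodule.mem_iSup_iff_exists_finsupp _ _).1 hgr
  refine ⟨f, fun μ => ⟨hf μ, ?_⟩, rfl⟩
  by_cases h0 : f μ = 0
  · rw [h0]; exact zero_mem _
  · exact component_mem hY f.support f hf hx μ (Finsupp.mem_support_iff.2 h0)

theorem exists_weight_vector {Y Y' : Submodule ℂ M} (hY' : ∀ x ∈ h, ∀ m ∈ Y', ⁅x, m⁆ ∈ Y')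
    {x : M} (hx : x ∈ Y') (hx' : x ∉ Y) (hgr : x ∈ ⨆ μ, wtSpace h M μ) :
    ∃ μ, ∃ v ∈ Y', v ∈ wtSpace h M μ ∧ v ∉ Y := by
  by_contra! hc
  obtain ⟨f, hf, rfl⟩ := mem_span_weight_vectors hY' hx hgr
  exact hx' (Submodule.sum_mem _ fun μ _ => hc μ _ (hf μ).2 (hf μ).1)

theorem finite_weights (hab : ∀ x ∈ h, ∀ y ∈ h, ⁅x, y⁆ = 0) (N : Submodule ℂ M)
    [FiniteDimensional ℂ N] : {μ | ∃ v ∈ N, v ∈ wtSpace h M μ ∧ v ≠ 0}.Finite := by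
  set A := {μ | ∃ v ∈ N, v ∈ wtSpace h M μ ∧ v ≠ 0}
  choose e he he' he0 using fun α : A => α.2
  have hli : LinearIndependent ℂ e :=
    ((iSupIndep_wtSpace hab).comp Subtype.val_injective).linearIndependent _ he' he0
  have hli' : LinearIndependent ℂ (fun α : A => (⟨e α, he α⟩ : N)) :=
    LinearIndependent.of_comp N.subtype hli
  exact Set.finite_coe_iff.1 hli'.finite

include D

theorem IsSum.ofReal_ip {n k : ℕ} {ν α : Module.Dual ℂ h} (hν : D.IsSum n k ν)
    (hα : α ∈ D.Φ n) : (D.ip n ν α : ℂ) = ν (D.t n α) := by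
  obtain ⟨L, rfl, hL, rfl⟩ := hν
  induction L with
  | nil => simp [ip, pairing]
  | cons a L ih =>
    rw [List.sum_cons, ip_add, LinearMap.add_apply, Complex.ofReal_add,
      ih fun γ hγ => hL γ (List.mem_cons_of_mem _ hγ)]
    congr 1
    rcases hL a List.mem_cons_self with rfl | ha
    · simp [ip, pairing]
    · exact D.ofReal_ip n (D.mem_rootSet ha) (D.mem_rootSet hα)

theorem f'_mem_level {n : ℕ} {α : Module.Dual ℂ h} (hα : α ∈ D.Φ n) : D.f' n α ∈ D.level n := by
  obtain ⟨a, ha⟩ := D.exists_smul (D.neg_mem_rootSet (D.mem_rootSet hα)) _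
    (D.f'_mem n (D.mem_rootSet hα))
  rw [ha]
  exact Submodule.smul_mem _ _ (D.e_mem_level (D.neg_mem hα))

/-- The action of the Casimir operator on a highest weight vector modulo a stable subspace. -/
theorem casimir_sub_smul_mem {n k : ℕ} {β : Module.Dual ℂ h} {l : Module.Dual ℂ h →ₗ[ℝ] ℝ}
    (hl : D.IsPosFunctional n β l) {Y : Submodule ℂ M} (hY : ∀ x ∈ D.level n, ∀ m ∈ Y, ⁅x, m⁆ ∈ Y)
    {ν : Module.Dual ℂ h} (hν : D.IsSum n k ν) {v : M} (hv : v ∈ wtSpace h M ν)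
    (he : ∀ α ∈ D.posRoots n l, ⁅D.e α, v⁆ ∈ Y) :
    D.casimir M n v - ((D.form n ν ν + D.rhoSum n l ν : ℝ) : ℂ) • v ∈ Y := by
  classical
  have h1 : ((D.form n ν ν + D.rhoSum n l ν : ℝ) : ℂ) • v =
      ∑ α ∈ D.Φ n, (((D.ip n ν α * D.ip n ν α : ℝ) : ℂ) • v +
        if 0 < l α then ((D.ip n ν α : ℝ) : ℂ) • v else 0) := by
    rw [Finset.sum_add_distrib, ← Finset.sum_filter, ← Finset.sum_smul, ← Finset.sum_smul,
      ← add_smul, ← Complex.ofReal_sum, ← Complex.ofReal_sum, ← Complex.ofReal_add]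
    rfl
  rw [h1, casimir_apply, ← Finset.sum_sub_distrib]
  refine Submodule.sum_mem _ fun α hα => ?_
  have hα' := D.mem_rootSet hα
  have ht : ⁅(D.t n α : g), v⁆ = (D.ip n ν α : ℂ) • v := by rw [hv, IsSum.ofReal_ip D hν hα]
  rw [ht, lie_smul, ht, smul_smul, ← Complex.ofReal_mul, add_sub_add_left_eq_sub]
  -- For positive `α` the commutator of `e α` and `f' α` contributes `ν (t α)`, and these terms add
  -- up to `rhoSum`. For negative `α`, `f' α` is a multiple of a positive root vector and
  -- contributes nothing modulo `Y`.
  split_ifs with h2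
  · rw [leibniz_lie, D.lie_e_f' n hα', ht, add_sub_cancel_left]
    exact hY _ (D.f'_mem_level hα) _ (he α (D.mem_posRoots.2 ⟨hα, h2⟩))
  · rw [sub_zero]
    refine hY _ (D.e_mem_level hα) _ ?_
    obtain ⟨a, ha⟩ := D.exists_smul (D.neg_mem_rootSet hα') _ (D.f'_mem n hα')
    rw [ha, smul_lie]
    refine Submodule.smul_mem _ _ (he _ (D.mem_posRoots.2 ⟨D.neg_mem hα, ?_⟩))
    rw [map_neg]
    have := hl.ne_zero α hα
    have := lt_of_le_of_ne (not_lt.1 h2) this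
    linarith

/-- Among the finitely many weights having a vector in `Y'` outside `Y`, take one where `l` is
maximal: positive root vectors must then move the chosen vector into `Y`. -/
theorem exists_highest_weight_vector {n : ℕ} {l : Module.Dual ℂ h →ₗ[ℝ] ℝ} {Y Y' : Submodule ℂ M}
    [FiniteDimensional ℂ Y'] (hY' : ∀ x ∈ D.level n, ∀ m ∈ Y', ⁅x, m⁆ ∈ Y') (hle : ¬ Y' ≤ Y)
    (hgr : Y' ≤ ⨆ μ, wtSpace h M μ) :
    ∃ ν, ∃ v ∈ Y', v ∈ wtSpace h M ν ∧ v ∉ Y ∧ ∀ α ∈ D.posRoots n l, ⁅D.e α, v⁆ ∈ Y := by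
  have hh : ∀ x ∈ h, x ∈ D.level n := fun x hx => Submodule.mem_sup_left hx
  obtain ⟨x, hx, hx'⟩ := SetLike.not_le_iff_exists.1 hle
  have hfin : {μ | ∃ v ∈ Y', v ∈ wtSpace h M μ ∧ v ∉ Y}.Finite := by
    refine (finite_weights D.abelian Y').subset ?_
    rintro μ ⟨v, hv, hvμ, hvY⟩
    exact ⟨v, hv, hvμ, fun h0 => hvY (h0 ▸ zero_mem _)⟩
  obtain ⟨μ, hμ⟩ := exists_weight_vector (fun x hx => hY' x (hh x hx)) hx hx' (hgr hx)
  obtain ⟨ν, ⟨v, hv, hvν, hvY⟩, hmax⟩ := Set.exists_max_image _ l hfin ⟨μ, hμ⟩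
  refine ⟨ν, v, hv, hvν, hvY, fun α hα => ?_⟩
  obtain ⟨hα1, hα2⟩ := D.mem_posRoots.1 hα
  by_contra hc
  have := hmax (ν + α) ⟨_, hY' _ (D.e_mem_level hα1) _ hv,
    lie_mem_wtSpace (D.e_mem (D.mem_rootSet hα1)) hvν, hc⟩
  rw [map_add] at this
  linarith

/-- A finite-dimensional subspace stable under level `n`, whose weights are sums of `k` roots and
whose weight space of weight `k β` is spanned by `b`. -/
structure IsBlock (n k : ℕ) (β : Module.Dual ℂ h) (E : Submodule ℂ M) (b : M) : Prop where
  finiteDimensional : FiniteDimensional ℂ E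
  stable : ∀ x ∈ D.level n, ∀ m ∈ E, ⁅x, m⁆ ∈ E
  graded : E ≤ ⨆ μ, wtSpace h M μ
  isSum : ∀ ν, ∀ v ∈ E, v ∈ wtSpace h M ν → v ≠ 0 → D.IsSum n k ν
  mem : b ∈ E
  mem_wtSpace : b ∈ wtSpace h M (k • β)
  ne_zero : b ≠ 0
  unique : ∀ v ∈ E, v ∈ wtSpace h M (k • β) → ∃ a : ℂ, v = a • b

/-- The simple constituent of a block containing `b`, and a polynomial in the Casimir operator
projecting onto it. -/
structure IsSimplePart (n : ℕ) (E : Submodule ℂ M) (b : M) (G : Submodule ℂ M)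
    (p : Polynomial ℂ) : Prop where
  le : G ≤ E
  mem : b ∈ G
  stable : ∀ x ∈ D.level n, ∀ m ∈ G, ⁅x, m⁆ ∈ G
  simple : ∀ Y ≤ G, (∀ x ∈ D.level n, ∀ m ∈ Y, ⁅x, m⁆ ∈ Y) → Y ≠ ⊥ → Y = G
  maps : ∀ x ∈ E, Polynomial.aeval (D.casimir M n) p x ∈ G
  proj : ∀ x ∈ G, Polynomial.aeval (D.casimir M n) p x = x

theorem lie_casimir (hz : ∀ x : h, (∀ α ∈ rootSet h, α x = 0) → x = 0) {n : ℕ} {x : g}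
    (hx : x ∈ D.level n) (m : M) : ⁅x, D.casimir M n m⁆ = D.casimir M n ⁅x, m⁆ := by
  have hle : D.level n ≤ LinearMap.ker
      ((LieModule.toEnd ℂ g M : g →ₗ[ℂ] Module.End ℂ M).flip (D.casimir M n m) -
        D.casimir M n ∘ₗ (LieModule.toEnd ℂ g M : g →ₗ[ℂ] Module.End ℂ M).flip m) := by
    refine sup_le (fun y hy => ?_) (Submodule.span_le.2 ?_)
    · exact sub_eq_zero.2 (D.lie_casimir_of_mem n ⟨y, hy⟩ m)
    · rintro _ ⟨α, hα, rfl⟩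
      exact sub_eq_zero.2 (D.lie_casimir_e hz hα m)
  exact sub_eq_zero.1 (hle hx)

theorem lie_aeval_casimir (hz : ∀ x : h, (∀ α ∈ rootSet h, α x = 0) → x = 0) {n : ℕ} {x : g}
    (hx : x ∈ D.level n) (p : Polynomial ℂ) (m : M) :
    ⁅x, Polynomial.aeval (D.casimir M n) p m⁆ = Polynomial.aeval (D.casimir M n) p ⁅x, m⁆ := by
  induction p using Polynomial.induction_on generalizing m with
  | C a => simp
  | add p q hp hq => rw [map_add, LinearMap.add_apply, LinearMap.add_apply, lie_add, hp, hq]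
  | monomial k a ih =>
    rw [pow_succ, ← mul_assoc, map_mul, Polynomial.aeval_X, Module.End.mul_apply,
      Module.End.mul_apply, ih, D.lie_casimir hz hx]

theorem aeval_casimir_mem {n : ℕ} {N : Submodule ℂ M} (hN : ∀ x ∈ D.level n, ∀ m ∈ N, ⁅x, m⁆ ∈ N)
    (p : Polynomial ℂ) {m : M} (hm : m ∈ N) : Polynomial.aeval (D.casimir M n) p m ∈ N := by
  induction p using Polynomial.induction_on generalizing m with
  | C a => simpa using Submodule.smul_mem _ a hm
  | add p q hp hq =>
    rw [map_add]
    exact Submodule.add_mem _ (hp hm) (hq hm)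
  | monomial k a ih =>
    rw [pow_succ, ← mul_assoc, map_mul, Polynomial.aeval_X, Module.End.mul_apply]
    exact ih (D.casimir_mem hN hm)

omit D in
theorem exists_aeval_eq_zero (φ : Module.End ℂ M) {E : Submodule ℂ M} [FiniteDimensional ℂ E]
    (hE : ∀ x ∈ E, φ x ∈ E) : ∃ p : Polynomial ℂ, p ≠ 0 ∧ ∀ x ∈ E, Polynomial.aeval φ p x = 0 := by
  have key : ∀ (p : Polynomial ℂ) (x : E),
      (Polynomial.aeval (φ.restrict hE) p x : M) = Polynomial.aeval φ p x := by
    intro p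
    induction p using Polynomial.induction_on with
    | C a => simp
    | add p q hp hq => intro x; simp [hp, hq]
    | monomial k a ih =>
      intro x
      rw [pow_succ, ← mul_assoc, map_mul _ _ Polynomial.X, map_mul _ _ Polynomial.X,
        Polynomial.aeval_X, Polynomial.aeval_X, Module.End.mul_apply, Module.End.mul_apply, ih]
      rfl
  refine ⟨minpoly ℂ (φ.restrict hE), minpoly.ne_zero (Algebra.IsIntegral.isIntegral _),
    fun x hx => ?_⟩
  rw [← key _ ⟨x, hx⟩, minpoly.aeval]
  rfl

omit D in
/-- The projection onto a generalized eigenspace is a polynomial in the endomorphism. -/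
theorem exists_polynomial_projection (φ : Module.End ℂ M) {E : Submodule ℂ M}
    [FiniteDimensional ℂ E] (hE : ∀ x ∈ E, φ x ∈ E) (a : ℂ) :
    ∃ p : Polynomial ℂ, (∀ x ∈ E, Polynomial.aeval φ p x ∈ φ.maxGenEigenspace a) ∧
      ∀ x ∈ E, x ∈ φ.maxGenEigenspace a → Polynomial.aeval φ p x = x := by
  obtain ⟨p, hp0, hp⟩ := exists_aeval_eq_zero φ hE
  obtain ⟨q, hq, hdvd⟩ := Polynomial.exists_eq_pow_rootMultiplicity_mul_and_not_dvd p hp0 a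
  set m := p.rootMultiplicity a
  have hcop : ∀ N : ℕ, IsCoprime ((Polynomial.X - Polynomial.C a) ^ N) q := fun N =>
    (((Polynomial.irreducible_X_sub_C a).coprime_iff_not_dvd).2 hdvd).pow_left
  have hval : ∀ N : ℕ, Polynomial.aeval φ ((Polynomial.X - Polynomial.C a) ^ N) =
      (φ - algebraMap ℂ (Module.End ℂ M) a) ^ N := fun N => by simp
  obtain ⟨u, w, huw⟩ := hcop m
  -- With `u (X - a)^m + w q = 1`, the factor `w q` is the identity where `(X - a)^m` vanishes, and
  -- its values are killed by `(X - a)^m`.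
  refine ⟨w * q, fun x hx => ?_, fun x hx hxa => ?_⟩
  · refine Module.End.mem_maxGenEigenspace _ _ _ |>.2 ⟨m, ?_⟩
    have h1 : (Polynomial.X - Polynomial.C a) ^ m * (w * q) = w * p := by rw [hq]; ring
    rw [← Algebra.algebraMap_eq_smul_one, ← hval, ← Module.End.mul_apply, ← map_mul, h1, map_mul,
      Module.End.mul_apply, hp x hx, map_zero]
  · obtain ⟨N, hN⟩ := Module.End.mem_maxGenEigenspace _ _ _ |>.1 hxa
    rw [← Algebra.algebraMap_eq_smul_one, ← hval] at hN
    obtain ⟨u', w', huw'⟩ := hcop N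
    have h2 : Polynomial.aeval φ ((Polynomial.X - Polynomial.C a) ^ m) x = 0 := by
      have h3 : (Polynomial.X - Polynomial.C a) ^ m =
          u' * (Polynomial.X - Polynomial.C a) ^ m * (Polynomial.X - Polynomial.C a) ^ N +
            w' * p := by
        rw [hq]
        linear_combination -(Polynomial.X - Polynomial.C a) ^ m * huw'
      rw [h3, map_add, map_mul, map_mul _ w', LinearMap.add_apply, Module.End.mul_apply,
        Module.End.mul_apply, hN, hp x hx, map_zero, map_zero, add_zero]
    have h4 : w * q = 1 - u * (Polynomial.X - Polynomial.C a) ^ m := by rw [← huw]; ring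
    rw [h4, map_sub, map_mul, LinearMap.sub_apply, Module.End.mul_apply, h2, map_zero, map_one,
      sub_zero, Module.End.one_apply]

theorem form_nsmul (n k : ℕ) (η : Module.Dual ℂ h) :
    D.form n (k • η) (k • η) = k ^ 2 * D.form n η η := by
  have h1 : ∀ ξ, D.form n (k • η) ξ = k * D.form n η ξ := by
    intro ξ
    induction k with
    | zero => simp [form_zero_left]
    | succ k ih => rw [succ_nsmul, form_add_left, ih]; push_cast; ring
  rw [h1, form_comm, h1]
  ring

theorem rhoSum_nsmul (n : ℕ) (l : Module.Dual ℂ h →ₗ[ℝ] ℝ) (k : ℕ) (η : Module.Dual ℂ h) :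
    D.rhoSum n l (k • η) = k * D.rhoSum n l η := by
  induction k with
  | zero => simp [rhoSum_zero]
  | succ k ih => rw [succ_nsmul, rhoSum_add, ih]; push_cast; ring

variable {D} in
-- A highest weight vector of `Y'` modulo `Y` is an eigenvector of the Casimir operator modulo `Y`.
-- Lying in the generalized eigenspace, it has the eigenvalue attached to `k β`, so its weight is `k
-- β` and it is a multiple of `b`.
theorem IsBlock.mem_and_not_mem {n k : ℕ} {β : Module.Dual ℂ h} {l : Module.Dual ℂ h →ₗ[ℝ] ℝ}
    (hl : D.IsPosFunctional n β l) (hlong : D.IsLong β) (hconn : D.IsConnected β)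
    {E : Submodule ℂ M} {b : M} (hE : D.IsBlock n k β E b) {Y Y' : Submodule ℂ M}
    (hY : ∀ x ∈ D.level n, ∀ m ∈ Y, ⁅x, m⁆ ∈ Y) (hY' : ∀ x ∈ D.level n, ∀ m ∈ Y', ⁅x, m⁆ ∈ Y')
    (hYE : Y' ≤ E) (hgen : Y' ≤ (D.casimir M n).maxGenEigenspace
      ((k ^ 2 * D.form n β β + k * D.rhoSum n l β : ℝ) : ℂ)) (hle : ¬ Y' ≤ Y) :
    b ∈ Y' ∧ b ∉ Y := by
  have := hE.finiteDimensional
  have := Submodule.finiteDimensional_of_le hYE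
  obtain ⟨ν, v, hv, hvν, hvY, hhw⟩ :=
    D.exists_highest_weight_vector (l := l) hY' hle (hYE.trans hE.graded)
  have hv0 : v ≠ 0 := fun h0 => hvY (h0 ▸ zero_mem _)
  have hν := hE.isSum ν v (hYE hv) hvν hv0
  have h1 := D.casimir_sub_smul_mem hl hY hν hvν hhw
  set c : ℂ := ((k ^ 2 * D.form n β β + k * D.rhoSum n l β : ℝ) : ℂ) with hc
  set q : ℂ := ((D.form n ν ν + D.rhoSum n l ν : ℝ) : ℂ) with hq
  -- Modulo `Y`, the operator `casimir - c` acts on `v` by `q - c`. As some power kills `v` and `v ∉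
  -- Y`, it follows that `q = c`.
  have h2 : ∀ m : ℕ, ((D.casimir M n - c • 1) ^ m) v - (q - c) ^ m • v ∈ Y := by
    intro m
    induction m with
    | zero => simp
    | succ m ih =>
      have h3 : ((D.casimir M n - c • 1) ^ (m + 1)) v - (q - c) ^ (m + 1) • v =
          D.casimir M n (((D.casimir M n - c • 1) ^ m) v - (q - c) ^ m • v) -
          c • (((D.casimir M n - c • 1) ^ m) v - (q - c) ^ m • v) +
          (q - c) ^ m • (D.casimir M n v - q • v) := by
        rw [pow_succ', Module.End.mul_apply, LinearMap.sub_apply, map_sub, map_smul,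
          LinearMap.smul_apply, Module.End.one_apply]
        module
      rw [h3]
      exact Submodule.add_mem _ (Submodule.sub_mem _ (D.casimir_mem hY ih)
        (Submodule.smul_mem _ _ ih)) (Submodule.smul_mem _ _ h1)
  obtain ⟨N, hN⟩ := (Module.End.mem_maxGenEigenspace _ _ _).1 (hgen hv)
  have h4 := h2 N
  rw [hN, zero_sub, neg_mem_iff] at h4
  have h5 : q = c := by
    by_contra h6
    exact hvY ((Submodule.smul_mem_iff _ (pow_ne_zero N (sub_ne_zero.2 h6))).1 h4)
  obtain rfl := D.eq_nsmul_of_casimir_eq hl hlong hconn hν (Complex.ofReal_injective h5)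
  obtain ⟨a, rfl⟩ := hE.unique v (hYE hv) hvν
  have ha : a ≠ 0 := by
    rintro rfl
    exact hv0 (zero_smul _ _)
  exact ⟨(Submodule.smul_mem_iff _ ha).1 hv, fun h6 => hvY (Submodule.smul_mem _ _ h6)⟩

variable {D} in
theorem IsBlock.exists_isSimplePart (hz : ∀ x : h, (∀ α ∈ rootSet h, α x = 0) → x = 0)
    {n k : ℕ} {β : Module.Dual ℂ h} (hlong : D.IsLong β) (hconn : D.IsConnected β)
    {E : Submodule ℂ M} {b : M} (hE : D.IsBlock n k β E b) :
    ∃ G p, D.IsSimplePart n E b G p := by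
  have := hE.finiteDimensional
  obtain ⟨l, hl⟩ := D.exists_isPosFunctional (D.mem_rootSet (hconn.mem n)) n
  set c : ℂ := ((k ^ 2 * D.form n β β + k * D.rhoSum n l β : ℝ) : ℂ) with hc
  have hCE : ∀ x ∈ E, D.casimir M n x ∈ E := fun x hx => D.casimir_mem hE.stable hx
  obtain ⟨p, hp, hp'⟩ := exists_polynomial_projection (D.casimir M n) hCE c
  have hbot : ∀ x ∈ D.level n, ∀ m ∈ (⊥ : Submodule ℂ M), ⁅x, m⁆ ∈ (⊥ : Submodule ℂ M) := by
    rintro x - m hm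
    rw [(Submodule.mem_bot ℂ).1 hm, lie_zero]
    exact zero_mem _
  have hG : ∀ x ∈ D.level n, ∀ m ∈ E ⊓ (D.casimir M n).maxGenEigenspace c,
      ⁅x, m⁆ ∈ E ⊓ (D.casimir M n).maxGenEigenspace c := by
    rintro x hx m ⟨hm, hm'⟩
    refine ⟨hE.stable x hx m hm, ?_⟩
    have h1 := hp _ (hE.stable x hx m hm)
    rwa [← D.lie_aeval_casimir hz hx, hp' m hm hm'] at h1
  have hbG : b ∈ E ⊓ (D.casimir M n).maxGenEigenspace c := by
    refine ⟨hE.mem, (Module.End.mem_maxGenEigenspace _ _ _).2 ⟨1, ?_⟩⟩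
    have h1 := D.casimir_sub_smul_mem hl hbot (hE.isSum _ b hE.mem hE.mem_wtSpace hE.ne_zero)
      hE.mem_wtSpace (fun α hα => by
        rw [Submodule.mem_bot]
        by_contra h0
        have hα' := D.mem_posRoots.1 hα
        have h2 := hE.isSum _ _ (hE.stable _ (D.e_mem_level hα'.1) b hE.mem)
          (lie_mem_wtSpace (D.e_mem (D.mem_rootSet hα'.1)) hE.mem_wtSpace) h0
        have h3 := (D.rhoSum_sum hl hlong hconn h2).1
        rw [rhoSum_add, rhoSum_nsmul] at h3
        have := D.rhoSum_pos hα
        linarith)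
    rw [form_nsmul, rhoSum_nsmul, Submodule.mem_bot] at h1
    rw [pow_one, LinearMap.sub_apply, LinearMap.smul_apply, Module.End.one_apply, ← h1]
  -- Simplicity follows from `mem_and_not_mem` used twice: a non-zero stable `Y` contains `b`,
  -- whereas a proper one would not.
  refine ⟨E ⊓ (D.casimir M n).maxGenEigenspace c, p, inf_le_left, hbG, hG, fun Y hY hYs hY0 => ?_,
    fun x hx => ⟨D.aeval_casimir_mem hE.stable p hx, hp x hx⟩, fun x hx => hp' x hx.1 hx.2⟩
  have h1 := (hE.mem_and_not_mem hl hlong hconn hbot hYs (hY.trans inf_le_left)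
    (hY.trans inf_le_right) (fun h0 => hY0 (le_bot_iff.1 h0))).1
  by_contra hne
  exact (hE.mem_and_not_mem hl hlong hconn hYs hG inf_le_left inf_le_right
    (fun h0 => hne (le_antisymm hY h0))).2 h1

end RootData


/-! ### The symmetric algebra as a module under derivations. -/

section LieSymAlg

variable (g : Type u) [LieRing g] [LieAlgebra ℂ g]

/-- The symmetric algebra of `g`, realized as polynomials in a basis. -/
abbrev LieSymAlg : Type u := MvPolynomial (Module.Basis.ofVectorSpaceIndex ℂ g) ℂ

namespace LieSymAlg

/-- The inclusion of `g` into its symmetric algebra. -/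
noncomputable def ι : g →ₗ[ℂ] LieSymAlg g :=
  (Module.Basis.ofVectorSpace ℂ g).constr ℂ fun i =>
    (MvPolynomial.X i : MvPolynomial (Module.Basis.ofVectorSpaceIndex ℂ g) ℂ)

theorem ι_basis (i : Module.Basis.ofVectorSpaceIndex ℂ g) :
    ι g (Module.Basis.ofVectorSpace ℂ g i) =
      (MvPolynomial.X i : MvPolynomial (Module.Basis.ofVectorSpaceIndex ℂ g) ℂ) :=
  Module.Basis.constr_basis _ _ _ _

theorem ι_injective : Function.Injective (ι g) := by
  refine LinearMap.ker_eq_bot.1 (LinearMap.ker_eq_bot'.2 fun x hx => ?_)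
  rw [ι, Module.Basis.constr_apply, Finsupp.sum] at hx
  have hli : LinearIndependent ℂ (fun i =>
      (MvPolynomial.X i : MvPolynomial (Module.Basis.ofVectorSpaceIndex ℂ g) ℂ)) :=
    MvPolynomial.linearIndependent_X _ _
  refine (Module.Basis.ofVectorSpace ℂ g).repr.map_eq_zero_iff.1 (Finsupp.ext fun i => ?_)
  by_cases hi : i ∈ ((Module.Basis.ofVectorSpace ℂ g).repr x).support
  · exact linearIndependent_iff'.1 hli _ _ hx i hi
  · exact Finsupp.notMem_support_iff.1 hi

variable {g}

/-- The derivation of the symmetric algebra extending `ad x`. -/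
noncomputable def der (x : g) : Derivation ℂ (LieSymAlg g) (LieSymAlg g) :=
  MvPolynomial.mkDerivation ℂ fun i => ι g ⁅x, Module.Basis.ofVectorSpace ℂ g i⁆

theorem der_ι (x y : g) : der x (ι g y) = ι g ⁅x, y⁆ := by
  have h1 : (der x).toLinearMap ∘ₗ ι g = ι g ∘ₗ (LieAlgebra.ad ℂ g x : g →ₗ[ℂ] g) := by
    refine (Module.Basis.ofVectorSpace ℂ g).ext fun i => ?_
    rw [LinearMap.comp_apply, ι_basis]
    exact MvPolynomial.mkDerivation_X _ _ _
  exact LinearMap.congr_fun h1 y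

theorem der_ext {d d' : Derivation ℂ (LieSymAlg g) (LieSymAlg g)} (hd : ∀ x, d (ι g x) = d' (ι g x)) :
    d = d' := by
  refine MvPolynomial.derivation_ext fun i => ?_
  have := hd (Module.Basis.ofVectorSpace ℂ g i)
  rwa [ι_basis] at this

noncomputable instance : LieRingModule g (LieSymAlg g) where
  bracket x m := der x m
  add_lie x y m := by
    have : der (x + y) = der x + der y := der_ext fun z => by
      rw [Derivation.add_apply, der_ι, der_ι, der_ι, add_lie, map_add]
    exact congrArg (fun d : Derivation ℂ (LieSymAlg g) (LieSymAlg g) => d m) this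
  lie_add x m n := map_add _ _ _
  leibniz_lie x y m := by
    have : ⁅der x, der y⁆ = der ⁅x, y⁆ := der_ext fun z => by
      rw [Derivation.commutator_apply, der_ι, der_ι, der_ι, der_ι, der_ι, lie_lie, map_sub]
    have h1 := congrArg (fun d : Derivation ℂ (LieSymAlg g) (LieSymAlg g) => d m) this
    simp only [Derivation.commutator_apply] at h1
    rw [← h1]
    exact (sub_add_cancel _ _).symm

noncomputable instance : LieModule ℂ g (LieSymAlg g) where
  smul_lie a x m := by
    have : der (a • x) = a • der x := der_ext fun z => by
      rw [Derivation.smul_apply, der_ι, der_ι, smul_lie, map_smul]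
    exact congrArg (fun d : Derivation ℂ (LieSymAlg g) (LieSymAlg g) => d m) this
  lie_smul a x m := (der x).map_smul a m

theorem lie_ι (x y : g) : ⁅x, ι g y⁆ = ι g ⁅x, y⁆ := der_ι x y

theorem lie_mul (x : g) (a b : LieSymAlg g) : ⁅x, a * b⁆ = a * ⁅x, b⁆ + b * ⁅x, a⁆ :=
  (der x).leibniz a b

theorem lie_algebraMap (x : g) (a : ℂ) : ⁅x, algebraMap ℂ (LieSymAlg g) a⁆ = 0 :=
  (der x).map_algebraMap a

theorem lie_pow (x : g) (a : LieSymAlg g) (k : ℕ) :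
    ⁅x, a ^ k⁆ = k • (a ^ (k - 1) * ⁅x, a⁆) := (der x).leibniz_pow a k

variable {h : LieSubalgebra ℂ g}

theorem mul_mem_wtSpace {μ ν : Module.Dual ℂ h} {a b : LieSymAlg g} (ha : a ∈ wtSpace h (LieSymAlg g) μ)
    (hb : b ∈ wtSpace h (LieSymAlg g) ν) : a * b ∈ wtSpace h (LieSymAlg g) (μ + ν) := by
  intro x
  rw [lie_mul, ha x, hb x, LinearMap.add_apply, add_smul, mul_smul_comm, mul_smul_comm,
    mul_comm b a, add_comm]

theorem ι_mem_wtSpace {μ : Module.Dual ℂ h} {x : g} (hx : x ∈ wtSpace h g μ) :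
    ι g x ∈ wtSpace h (LieSymAlg g) μ := by
  intro y
  rw [lie_ι, hx y, map_smul]

theorem one_mem_wtSpace : (1 : LieSymAlg g) ∈ wtSpace h (LieSymAlg g) 0 := by
  intro y
  rw [← map_one (algebraMap ℂ (LieSymAlg g)), lie_algebraMap, LinearMap.zero_apply, zero_smul]

theorem pow_mem_wtSpace {μ : Module.Dual ℂ h} {a : LieSymAlg g} (ha : a ∈ wtSpace h (LieSymAlg g) μ)
    (k : ℕ) : a ^ k ∈ wtSpace h (LieSymAlg g) (k • μ) := by
  induction k with
  | zero => rw [pow_zero, zero_smul]; exact one_mem_wtSpace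
  | succ k ih => rw [pow_succ, succ_nsmul]; exact mul_mem_wtSpace ih ha

/-- Powers of a stable subspace of `g` are stable. -/
theorem lie_mem_map_pow {N : Submodule ℂ g} {x : g} (hN : ∀ y ∈ N, ⁅x, y⁆ ∈ N) (k : ℕ)
    {m : LieSymAlg g} (hm : m ∈ N.map (ι g) ^ k) : ⁅x, m⁆ ∈ N.map (ι g) ^ k := by
  induction k generalizing m with
  | zero =>
    rw [pow_zero] at hm
    obtain ⟨a, rfl⟩ := Submodule.mem_one.1 hm
    rw [lie_algebraMap]
    exact zero_mem _
  | succ k ih =>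
    rw [pow_succ] at hm ⊢
    induction hm using Submodule.mul_induction_on' with
    | mem_mul_mem a ha b hb =>
      rw [lie_mul]
      refine Submodule.add_mem _ (Submodule.mul_mem_mul ha ?_) ?_
      · obtain ⟨y, hy, rfl⟩ := hb
        exact ⟨_, hN y hy, (lie_ι x y).symm⟩
      · rw [mul_comm b]
        exact Submodule.mul_mem_mul (ih ha) hb
    | add a _ b _ ha hb => rw [lie_add]; exact Submodule.add_mem _ ha hb

end LieSymAlg

end LieSymAlg

/-! ### Symmetric powers of a core are blocks. -/

namespace RootData

open scoped Pointwise

variable {g : Type u} [LieRing g] [LieAlgebra ℂ g] {h : LieSubalgebra ℂ g} (D : RootData h)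

theorem pairing_le_one {β γ : Module.Dual ℂ h} (hβ : β ∈ rootSet h) (hlong : D.IsLong β)
    (hγ : γ = 0 ∨ γ ∈ rootSet h) (hne : γ ≠ β) : D.pairing γ β ≤ 1 := by
  rcases hγ with rfl | hγ
  · simp [pairing]
  · by_cases h1 : γ = -β
    · rw [h1, pairing_neg, D.pairing_self hβ]
      norm_num
    · exact (abs_le.1 (hlong.2 γ hγ hne h1)).2

open LieSymAlg in
-- Among the generators only `e β` pairs to 2 with the coroot of `β`; all others pair to at most 1.
-- A product of `k` of them reaches `2 k` only as `e β ^ k`, which gives multiplicity one at `k β`.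
theorem exists_weight_of_mem_pow {n : ℕ} {β : Module.Dual ℂ h} (hβ : β ∈ D.Φ n)
    (hlong : D.IsLong β) (T : Set h) (k : ℕ) {t : LieSymAlg g}
    (ht : t ∈ (ι g '' (D.e '' D.Φ n ∪
      ((fun α => (D.c α : g)) '' D.Φ n ∪ (fun x : h => (x : g)) '' T))) ^ k) :
    ∃ ν, t ∈ wtSpace h (LieSymAlg g) ν ∧ D.IsSum n k ν ∧ D.pairing ν β ≤ 2 * k ∧
      (D.pairing ν β = 2 * k → t = ι g (D.e β) ^ k) := by
  induction k generalizing t with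
  | zero =>
    rw [pow_zero, Set.mem_one] at ht
    subst ht
    exact ⟨0, one_mem_wtSpace, IsSum.zero D n, by simp [pairing], fun _ => (pow_zero _).symm⟩
  | succ k ih =>
    rw [pow_succ] at ht
    obtain ⟨a, ha, b, hb, rfl⟩ := Set.mem_mul.1 ht
    obtain ⟨ν, hν, hs, hle, heq⟩ := ih ha
    have key : ∃ γ, b ∈ wtSpace h (LieSymAlg g) γ ∧ (γ = 0 ∨ γ ∈ D.Φ n) ∧
        (γ = β → b = ι g (D.e β)) := by
      have h0 : ∀ x : h, ∃ γ, ι g (x : g) ∈ wtSpace h (LieSymAlg g) γ ∧ (γ = 0 ∨ γ ∈ D.Φ n) ∧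
          (γ = β → ι g (x : g) = ι g (D.e β)) := fun x =>
        ⟨0, ι_mem_wtSpace (D.mem_wtSpace_zero x), Or.inl rfl, fun h0 =>
          absurd h0.symm (D.mem_rootSet hβ).1⟩
      obtain ⟨_, (⟨γ, hγ, rfl⟩ | ⟨γ, hγ, rfl⟩ | ⟨x, hx, rfl⟩), rfl⟩ := hb
      · refine ⟨γ, ι_mem_wtSpace (D.e_mem (D.mem_rootSet hγ)), Or.inr hγ, ?_⟩
        rintro rfl
        rfl
      · exact h0 _
      · exact h0 _
    obtain ⟨γ, hγ, hγ', hγβ⟩ := key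
    refine ⟨γ + ν, by rw [add_comm]; exact mul_mem_wtSpace hν hγ, IsSum.add D hγ' hs, ?_⟩
    rw [pairing_add]
    push_cast
    by_cases h1 : γ = β
    · rw [h1, D.pairing_self (D.mem_rootSet hβ)]
      refine ⟨by linarith, fun h2 => ?_⟩
      rw [heq (by linarith), hγβ h1, pow_succ]
    · have h2 := D.pairing_le_one (D.mem_rootSet hβ) hlong (hγ'.imp_right D.mem_rootSet) h1
      exact ⟨by linarith, fun h3 => by linarith⟩

open LieSymAlg in
/-- The `k`-th symmetric power of the core of level `n` is a block. -/
theorem isBlock_pow {n : ℕ} {β : Module.Dual ℂ h} (hβ : β ∈ D.Φ n) (hlong : D.IsLong β)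
    {T : Set h} (hT : T.Finite) (k : ℕ) :
    D.IsBlock n k β ((D.core n T).map (ι g) ^ k) (ι g (D.e β) ^ k) := by
  have hspan : (D.core n T).map (ι g) ^ k = Submodule.span ℂ ((ι g '' (D.e '' D.Φ n ∪
      ((fun α => (D.c α : g)) '' D.Φ n ∪ (fun x : h => (x : g)) '' T))) ^ k) := by
    rw [core, Submodule.map_span, Submodule.span_pow]
  have hwt := fun t ht => D.exists_weight_of_mem_pow hβ hlong T k (t := t) ht
  have hne : ι g (D.e β) ^ k ≠ 0 := pow_ne_zero _ fun h0 =>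
    D.e_ne_zero (D.mem_rootSet hβ) (ι_injective g (h0.trans (map_zero _).symm))
  refine ⟨?_, fun x hx m hm => lie_mem_map_pow (fun y hy => D.lie_mem_core hx hy) k hm, ?_, ?_, ?_,
    ?_, hne, ?_⟩
  · have := D.finiteDimensional_core n hT
    exact Module.Finite.iff_fg.2 (((Module.Finite.iff_fg.1 this).map (ι g)).pow k)
  · rw [hspan, Submodule.span_le]
    intro t ht
    obtain ⟨ν, hν, -⟩ := hwt t ht
    exact Submodule.mem_iSup_of_mem ν hν
  · intro ν v hv hvν hv0
    rw [hspan] at hv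
    obtain ⟨t, ht, htν, ht0⟩ := exists_mem_inter_wtSpace D.abelian
      (fun t ht => (hwt t ht).imp fun _ hh => hh.1) hv hvν hv0
    obtain ⟨ν', hν', hs, -⟩ := hwt t ht
    rwa [wt_unique htν hν' ht0]
  · exact Submodule.pow_mem_pow _ (Submodule.mem_map_of_mem (D.e_mem_core hβ T)) k
  · exact pow_mem_wtSpace (ι_mem_wtSpace (D.e_mem (D.mem_rootSet hβ))) k
  · intro v hv hvν
    rw [hspan] at hv
    have h1 := mem_span_inter_wtSpace D.abelian
      (fun t ht => (hwt t ht).imp fun _ hh => hh.1) hv hvν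
    have h2 : Submodule.span ℂ ((ι g '' (D.e '' D.Φ n ∪
        ((fun α => (D.c α : g)) '' D.Φ n ∪ (fun x : h => (x : g)) '' T))) ^ k ∩
        wtSpace h (LieSymAlg g) (k • β)) ≤ Submodule.span ℂ {ι g (D.e β) ^ k} := by
      refine Submodule.span_le.2 ?_
      rintro t ⟨ht, htν⟩
      by_cases ht0 : t = 0
      · rw [ht0]; exact zero_mem _
      · obtain ⟨ν', hν', -, -, heq⟩ := hwt t ht
        obtain rfl := wt_unique htν hν' ht0
        rw [heq (by
          rw [pairing, LinearMap.smul_apply, (D.triple (D.mem_rootSet hβ)).apply_c]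
          simp [mul_comm])]
        exact Submodule.mem_span_singleton_self _
    obtain ⟨a, ha⟩ := Submodule.mem_span_singleton.1 (h2 h1)
    exact ⟨a, ha.symm⟩

end RootData


/-! ### Separating elements and the tower in infinite dimension. -/

namespace RootData

variable {g : Type u} [LieRing g] [LieAlgebra ℂ g] {h : LieSubalgebra ℂ g} (D : RootData h)
include D

theorem abs_pairing_le {α γ : Module.Dual ℂ h} (hα : α ∈ rootSet h) (hγ : γ ∈ rootSet h) :
    |D.pairing γ α| ≤ 3 := by
  classical
  by_cases h1 : γ = α
  · rw [h1, D.pairing_self hα]; norm_num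
  by_cases h2 : γ = -α
  · rw [h2, pairing_neg, D.pairing_self hα]; norm_num
  by_cases h0 : D.pairing γ α = 0
  · rw [h0]; norm_num
  obtain ⟨n, hn⟩ := D.exists_level {α, γ} (by simp [hα, hγ])
  have hα' : α ∈ D.Φ n := hn (by simp)
  have hγ' : γ ∈ D.Φ n := hn (by simp)
  have h3 := D.pairing_mul_le hα hγ h1 h2
  have h4 := D.len_mul_pairing hα' hγ'
  have h5 := D.len_pos hα'
  have h6 := D.len_pos hγ'
  have h7 : 0 ≤ D.pairing γ α * D.pairing α γ := by
    have : D.pairing γ α * D.pairing α γ = D.len n γ / D.len n α * D.pairing γ α ^ 2 := by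
      field_simp
      linarith [congrArg (· * D.pairing γ α) h4]
    rw [this]
    positivity
  obtain ⟨k, hk⟩ := D.pairing_int hγ hα
  have h8 : D.pairing α γ ≠ 0 := fun h9 => h0 ((D.pairing_eq_zero_comm hα hγ).1 h9)
  have h9 : (1 : ℝ) ≤ |D.pairing α γ| := by
    rw [hk] at h8 ⊢
    have : k ≠ 0 := by exact_mod_cast h8
    exact_mod_cast Int.one_le_abs this
  rw [← abs_of_nonneg h7, abs_mul] at h3
  nlinarith [abs_nonneg (D.pairing γ α)]

/-- Roots in the span of `Φ n` are determined by their Cartan integers with `Φ n`, which lie between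
-3 and 3. -/
theorem finite_rootSet {n : ℕ}
    (hn : rootSet h ⊆ Submodule.span ℂ (D.Φ n : Set (Module.Dual ℂ h))) :
    (rootSet h).Finite := by
  set F : rootSet h → (D.Φ n → Set.Icc (-3 : ℤ) 3) := fun δ α =>
    ⟨⌊D.pairing δ α⌋, by
      obtain ⟨k, hk⟩ := D.pairing_int (D.mem_rootSet α.2) δ.2
      have h1 := abs_le.1 (D.abs_pairing_le (D.mem_rootSet α.2) δ.2)
      rw [hk] at h1 ⊢
      rw [Int.floor_intCast]
      exact ⟨by exact_mod_cast h1.1, by exact_mod_cast h1.2⟩⟩ with hF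
  have hinj : Function.Injective F := by
    intro δ ε hδε
    apply Subtype.ext
    rw [← sub_eq_zero]
    refine D.eq_zero_of_mem_span (n := n) (Submodule.sub_mem _ (hn δ.2) (hn ε.2)) fun α hα => ?_
    have h1 : ⌊D.pairing δ α⌋ = ⌊D.pairing ε α⌋ :=
      congrArg Subtype.val (congrFun hδε ⟨α, hα⟩)
    have hα' := D.mem_rootSet hα
    obtain ⟨k, hk⟩ := D.pairing_int hα' δ.2
    obtain ⟨l, hl⟩ := D.pairing_int hα' ε.2
    rw [hk, hl, Int.floor_intCast, Int.floor_intCast] at h1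
    rw [LinearMap.sub_apply, ← D.ofReal_pairing hα' δ.2, ← D.ofReal_pairing hα' ε.2, hk, hl, h1,
      sub_self]
  exact Set.finite_coe_iff.1 (Finite.of_injective F hinj)

theorem finiteDimensional_of_finite_rootSet (hsimple : LieAlgebra.IsSimple ℂ g)
    (hfin : (rootSet h).Finite) : FiniteDimensional ℂ g := by
  have hh : FiniteDimensional ℂ h := by
    have := hfin.to_subtype
    refine FiniteDimensional.of_injective
      (LinearMap.pi fun α : rootSet h => (α : Module.Dual ℂ h)) ?_
    refine LinearMap.ker_eq_bot.1 (LinearMap.ker_eq_bot'.2 fun x hx => ?_)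
    exact D.eq_zero_of_forall_root hsimple fun α hα => congrFun hx ⟨α, hα⟩
  have hh' : FiniteDimensional ℂ h.toSubmodule := hh
  obtain ⟨n, hn⟩ := D.exists_level hfin.toFinset fun α hα => hfin.mem_toFinset.1 hα
  have htop : D.level n = ⊤ := by
    rw [eq_top_iff, ← D.span_top]
    refine sup_le_sup_left (iSup₂_le fun α hα x hx => ?_) _
    obtain ⟨a, rfl⟩ := D.exists_smul hα x hx
    exact Submodule.smul_mem _ _ (Submodule.subset_span ⟨α, hn (hfin.mem_toFinset.2 hα), rfl⟩)
  have := FiniteDimensional.span_of_finite ℂ ((D.Φ n).finite_toSet.image D.e)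
  have : FiniteDimensional ℂ (D.level n) := by rw [level]; infer_instance
  rw [htop] at this
  exact Module.Finite.equiv Submodule.topEquiv

/-- Otherwise every root vanishes on the common kernel of `Φ n`, hence lies in its span. Then there
are finitely many roots, and a simple algebra with finitely many roots is finite-dimensional. -/
theorem exists_separating (hfd : ¬ FiniteDimensional ℂ g) (hsimple : LieAlgebra.IsSimple ℂ g)
    (n : ℕ) : ∃ z : h, (∀ α ∈ D.Φ n, α z = 0) ∧ ∃ δ ∈ rootSet h, δ z ≠ 0 := by
  by_contra! hc
  refine hfd (D.finiteDimensional_of_finite_rootSet hsimple (D.finite_rootSet (n := n)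
    fun δ hδ => ?_))
  have h1 := mem_span_of_iInf_ker_le_ker (L := fun α : D.Φ n => (α : Module.Dual ℂ h)) (K := δ)
    (fun z hz => hc z (fun α hα => by
      exact (Submodule.mem_iInf _).1 hz ⟨α, hα⟩) δ hδ)
  rwa [Subtype.range_coe_subtype] at h1

/-- A path of length two to a root that is non-zero on `z`, after a reflection if needed, yields
such a root not orthogonal to `β`. It is not `±β` because `β z = 0`, so its pairing is `±1`, and a
sign change makes it 1. -/
theorem exists_separating_root {β : Module.Dual ℂ h} (hlong : D.IsLong β)
    (hl : ∀ γ ∈ rootSet h, D.Linked β γ) {z : h} (hz : β z = 0)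
    (hδ : ∃ δ ∈ rootSet h, δ z ≠ 0) :
    ∃ δ ∈ rootSet h, D.pairing δ β = 1 ∧ δ z ≠ 0 ∧ β - δ ∈ rootSet h := by
  have hβ := hlong.1
  obtain ⟨δ₀, hδ₀, hz₀⟩ := hδ
  have h1 : ∃ δ ∈ rootSet h, D.pairing δ β ≠ 0 ∧ δ z ≠ 0 := by
    obtain ⟨ε, hε, h2, h3⟩ := D.exists_path_of_linked hβ (hl δ₀ hδ₀)
    by_cases h4 : D.pairing δ₀ β = 0
    · by_cases h5 : ε z = 0
      · refine ⟨D.refl ε δ₀, D.refl_mem_rootSet hε hδ₀, ?_, ?_⟩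
        · rw [D.pairing_refl hε hδ₀, h4, zero_sub]
          exact neg_ne_zero.2 (mul_ne_zero h3 h2)
        · rwa [refl_apply, h5, mul_zero, sub_zero]
      · exact ⟨ε, hε, h2, h5⟩
    · exact ⟨δ₀, hδ₀, h4, hz₀⟩
  obtain ⟨δ, hδ, h2, h3⟩ := h1
  have h4 := hlong.2 δ hδ (by rintro rfl; exact h3 hz) (by rintro rfl; exact h3 (by simp [hz]))
  obtain ⟨k, hk⟩ := D.pairing_int hβ hδ
  have key : ∀ δ ∈ rootSet h, D.pairing δ β = 1 → β - δ ∈ rootSet h := by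
    intro δ hδ h5
    have h6 := D.neg_mem_rootSet (D.refl_mem_rootSet hβ hδ)
    rwa [refl, ← D.ofReal_pairing hβ hδ, h5, Complex.ofReal_one, one_smul, neg_sub] at h6
  have h5 : k = 1 ∨ k = -1 := by
    rw [hk] at h2 h4
    have h6 : k ≠ 0 := by exact_mod_cast h2
    have h7 : |k| ≤ 1 := by exact_mod_cast h4
    rw [abs_le] at h7
    omega
  rcases h5 with rfl | rfl
  · exact ⟨δ, hδ, by simpa using hk, h3, key δ hδ (by simpa using hk)⟩
  · have h6 : D.pairing (-δ) β = 1 := by rw [pairing_neg, hk]; simp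
    exact ⟨-δ, D.neg_mem_rootSet hδ, h6, by simpa using h3, key _ (D.neg_mem_rootSet hδ) h6⟩

/-- A filtration of the roots around a long root `β`, with elements `z k` of `h` centralized by
level `k` but not by the root vector of `δ k` in level `k + 1`. -/
structure IsTower (β : Module.Dual ℂ h) (z : ℕ → h) (δ : ℕ → Module.Dual ℂ h) : Prop where
  long : D.IsLong β
  conn : D.IsConnected β
  apply_eq_zero : ∀ k, ∀ α ∈ D.Φ k, α (z k) = 0
  mem : ∀ k, δ k ∈ D.Φ (k + 1)
  sub_mem : ∀ k, β - δ k ∈ D.Φ (k + 1)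
  pairing_eq : ∀ k, D.pairing (δ k) β = 1
  apply_ne_zero : ∀ k, δ k (z k) ≠ 0

/-- The same root data with a subsequence of the levels. -/
def reindex (σ : ℕ → ℕ) (hσ : StrictMono σ) : RootData h :=
  { D with
    Φ := fun k => D.Φ (σ k)
    mono := fun _ _ hkl => D.mono (hσ.monotone hkl)
    mem_rootSet := fun hα => D.mem_rootSet hα
    exhaust := fun hα => by
      obtain ⟨n, hn⟩ := D.exhaust hα
      exact ⟨n, D.mono (hσ.le_apply) hn⟩
    neg_mem := fun hα => D.neg_mem hα
    closed := fun hα hγ h0 => D.closed hα hγ h0 }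

theorem exists_isTower (hfd : ¬ FiniteDimensional ℂ g) (hsimple : LieAlgebra.IsSimple ℂ g) :
    ∃ (D' : RootData h) (β : _) (z : _) (δ : _), D'.IsTower β z δ := by
  classical
  obtain ⟨β, hlong⟩ := D.exists_isLong (D.exists_mem_rootSet hsimple)
  obtain ⟨D', hc, hconn⟩ := D.exists_isConnected hlong.1 fun γ hγ =>
    D.linked_of_isSimple hsimple hlong.1 hγ
  have hlong' : D'.IsLong β := by
    refine ⟨hlong.1, fun γ hγ h1 h2 => ?_⟩
    rw [pairing, hc]
    exact hlong.2 γ hγ h1 h2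
  have key : ∀ n, ∃ (z : h) (δ : Module.Dual ℂ h) (m : ℕ), (∀ α ∈ D'.Φ n, α z = 0) ∧
      δ ∈ D'.Φ m ∧ β - δ ∈ D'.Φ m ∧ D'.pairing δ β = 1 ∧ δ z ≠ 0 := by
    intro n
    obtain ⟨z, hz, hδ⟩ := D'.exists_separating hfd hsimple n
    obtain ⟨δ, h1, h2, h3, h4⟩ := D'.exists_separating_root hlong'
      (fun γ hγ => D'.linked_of_isSimple hsimple hlong.1 hγ) (hz β (hconn.mem n)) hδ
    obtain ⟨m, hm⟩ := D'.exists_level {δ, β - δ} (by simp [h1, h4])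
    exact ⟨z, δ, m, hz, hm (by simp), hm (by simp), h2, h3⟩
  choose z δ m h1 h2 h3 h4 h5 using key
  -- Each new level is taken late enough to contain `δ` and `β - δ` found for the previous one, and
  -- strictly later than it.
  set σ : ℕ → ℕ := fun k => Nat.rec 0 (fun _ s => max (m s) (s + 1)) k with hσ
  have hσs : ∀ k, σ (k + 1) = max (m (σ k)) (σ k + 1) := fun k => rfl
  have hmono : StrictMono σ := strictMono_nat_of_lt_succ fun k => by
    rw [hσs]
    exact lt_of_lt_of_le (Nat.lt_succ_self _) (le_max_right _ _)
  have hle : ∀ k, m (σ k) ≤ σ (k + 1) := fun k => by rw [hσs]; exact le_max_left _ _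
  exact ⟨D'.reindex σ hmono, β, fun k => z (σ k), fun k => δ (σ k), {
    long := hlong'
    conn := ⟨fun k => hconn.mem (σ k), fun k => hconn.exists_path (σ k)⟩
    apply_eq_zero := fun k => h1 (σ k)
    mem := fun k => D'.mono (hle k) (h2 (σ k))
    sub_mem := fun k => D'.mono (hle k) (h3 (σ k))
    pairing_eq := fun k => h4 (σ k)
    apply_ne_zero := fun k => h5 (σ k) }⟩

end RootData


/-! ### Direct limits of simple modules realized by sequences. -/

section Sequences

variable {g : Type u} [LieRing g] [LieAlgebra ℂ g]
variable {V : Type w} [AddCommGroup V] [Module ℂ V] [LieRingModule g V] [LieModule ℂ g V]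

instance seqLieRingModule : LieRingModule g (ℕ → V) where
  bracket x a j := ⁅x, a j⁆
  add_lie x y a := funext fun j => add_lie x y (a j)
  lie_add x a b := funext fun j => lie_add x (a j) (b j)
  leibniz_lie x y a := funext fun j => leibniz_lie x y (a j)

theorem seq_lie_apply (x : g) (a : ℕ → V) (j : ℕ) : ⁅x, a⁆ j = ⁅x, a j⁆ := rfl

instance seqLieModule : LieModule ℂ g (ℕ → V) where
  smul_lie t x a := funext fun j => smul_lie t x (a j)
  lie_smul t x a := funext fun j => lie_smul t x (a j)

/-- The sequence that starts with `m` at `K` and continues by the maps `F j`. -/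
def seqFrom (F : ℕ → V →ₗ[ℂ] V) (K : ℕ) : ℕ → V →ₗ[ℂ] V
  | 0 => if K = 0 then LinearMap.id else 0
  | j + 1 => if K = j + 1 then LinearMap.id else F j ∘ₗ seqFrom F K j

theorem seqFrom_of_lt (F : ℕ → V →ₗ[ℂ] V) {K j : ℕ} (hj : j < K) : seqFrom F K j = 0 := by
  induction j with
  | zero => rw [seqFrom, if_neg (by omega)]
  | succ j ih => rw [seqFrom, if_neg (by omega), ih (by omega), LinearMap.comp_zero]

theorem seqFrom_self (F : ℕ → V →ₗ[ℂ] V) (K : ℕ) : seqFrom F K K = LinearMap.id := by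
  cases K <;> rw [seqFrom, if_pos rfl]

theorem seqFrom_succ (F : ℕ → V →ₗ[ℂ] V) {K j : ℕ} (hj : K ≤ j) (m : V) :
    seqFrom F K (j + 1) m = F j (seqFrom F K j m) := by
  rw [seqFrom, if_neg (by omega)]
  rfl

variable (g V) in
/-- The sequences that are eventually zero. -/
def eventuallyZero : LieSubmodule ℂ g (ℕ → V) where
  carrier := {a | ∃ K, ∀ j, K ≤ j → a j = 0}
  zero_mem' := ⟨0, fun _ _ => rfl⟩
  add_mem' := by
    rintro a b ⟨K, hK⟩ ⟨L, hL⟩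
    refine ⟨max K L, fun j hj => ?_⟩
    rw [Pi.add_apply, hK j (le_trans (le_max_left _ _) hj), hL j (le_trans (le_max_right _ _) hj),
      add_zero]
  smul_mem' := by
    rintro t a ⟨K, hK⟩
    exact ⟨K, fun j hj => by rw [Pi.smul_apply, hK j hj, smul_zero]⟩
  lie_mem := by
    rintro x a ⟨K, hK⟩
    exact ⟨K, fun j hj => by rw [seq_lie_apply, hK j hj, lie_zero]⟩

end Sequences

namespace RootData

variable {g : Type u} [LieRing g] [LieAlgebra ℂ g] {h : LieSubalgebra ℂ g} (D : RootData h)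
variable {V : Type w} [AddCommGroup V] [Module ℂ V] [LieRingModule g V] [LieModule ℂ g V]

/-- A direct system of finite-dimensional simple modules over the levels. -/
structure IsSimpleSystem (β : Module.Dual ℂ h) (G : ℕ → Submodule ℂ V) (F : ℕ → V →ₗ[ℂ] V)
    (b : ℕ → V) : Prop where
  finiteDimensional : ∀ k, FiniteDimensional ℂ (G k)
  stable : ∀ k, ∀ x ∈ D.level k, ∀ m ∈ G k, ⁅x, m⁆ ∈ G k
  graded : ∀ k, G k ≤ ⨆ μ, wtSpace h V μ
  simple : ∀ k, ∀ Y ≤ G k, (∀ x ∈ D.level k, ∀ m ∈ Y, ⁅x, m⁆ ∈ Y) → Y ≠ ⊥ → Y = G k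
  maps : ∀ k, ∀ m ∈ G k, F k m ∈ G (k + 1)
  lie_map : ∀ k, ∀ x ∈ D.level k, ∀ m, F k ⁅x, m⁆ = ⁅x, F k m⁆
  injective : ∀ k, ∀ m ∈ G k, F k m = 0 → m = 0
  mem : ∀ k, b k ∈ G k
  mem_wtSpace : ∀ k, b k ∈ wtSpace h V (k • β)
  ne_zero : ∀ k, b k ≠ 0

/-- `M` is a union of the modules `G k` through the maps `Q k`. -/
structure IsUnion (G : ℕ → Submodule ℂ V) (M : Type v) [AddCommGroup M] [Module ℂ M]
    [LieRingModule g M] (Q : ∀ k, G k →ₗ[ℂ] M) : Prop where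
  lie : ∀ k, ∀ x ∈ D.level k, ∀ m m' : G k, (m' : V) = ⁅x, (m : V)⁆ → Q k m' = ⁅x, Q k m⁆
  injective : ∀ k m, Q k m = 0 → m = 0
  surjective : ∀ y : M, ∃ K, ∀ k, K ≤ k → ∃ m, Q k m = y

variable {D} {β : Module.Dual ℂ h} {G : ℕ → Submodule ℂ V} {F : ℕ → V →ₗ[ℂ] V} {b : ℕ → V}

namespace IsSimpleSystem

/-- The sequences that are eventually coherent. -/
def coherent (hG : D.IsSimpleSystem β G F b) : LieSubmodule ℂ g (ℕ → V) where
  carrier := {a | ∃ K, ∀ j, K ≤ j → a j ∈ G j ∧ a (j + 1) = F j (a j)}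
  zero_mem' := ⟨0, fun j _ => ⟨zero_mem _, (map_zero (F j)).symm⟩⟩
  add_mem' := by
    rintro a b ⟨K, hK⟩ ⟨L, hL⟩
    refine ⟨max K L, fun j hj => ?_⟩
    obtain ⟨h1, h2⟩ := hK j (le_trans (le_max_left _ _) hj)
    obtain ⟨h3, h4⟩ := hL j (le_trans (le_max_right _ _) hj)
    exact ⟨Submodule.add_mem _ h1 h3, by rw [Pi.add_apply, Pi.add_apply, h2, h4, map_add]⟩
  smul_mem' := by
    rintro t a ⟨K, hK⟩
    exact ⟨K, fun j hj => ⟨Submodule.smul_mem _ _ (hK j hj).1, by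
      rw [Pi.smul_apply, Pi.smul_apply, (hK j hj).2, map_smul]⟩⟩
  lie_mem := by
    rintro x a ⟨K, hK⟩
    -- An element of level `n` preserves `G j` and commutes with `F j` only for `j ≥ n`, which is
    -- why coherence is required only eventually.
    obtain ⟨n, hn⟩ := D.exists_mem_level x
    refine ⟨max K n, fun j hj => ?_⟩
    obtain ⟨h1, h2⟩ := hK j (le_trans (le_max_left _ _) hj)
    have hx := D.level_mono (le_trans (le_max_right _ _) hj) hn
    exact ⟨hG.stable j x hx _ h1, by
      rw [seq_lie_apply, seq_lie_apply, h2, hG.lie_map j x hx]⟩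

variable (hG : D.IsSimpleSystem β G F b)
include hG

theorem seqFrom_mem {K j : ℕ} (hj : K ≤ j) {m : V} (hm : m ∈ G K) : seqFrom F K j m ∈ G j := by
  induction j, hj using Nat.le_induction with
  | base => rwa [seqFrom_self]
  | succ j hj ih =>
    rw [seqFrom_succ F hj]
    exact hG.maps j _ ih

theorem seqFrom_lie {K : ℕ} {x : g} (hx : x ∈ D.level K) (j : ℕ) (m : V) :
    seqFrom F K j ⁅x, m⁆ = ⁅x, seqFrom F K j m⁆ := by
  rcases lt_or_ge j K with hj | hj
  · rw [seqFrom_of_lt F hj, LinearMap.zero_apply, LinearMap.zero_apply, lie_zero]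
  · induction j, hj using Nat.le_induction with
    | base => rw [seqFrom_self]; rfl
    | succ j hj ih =>
      rw [seqFrom_succ F hj, seqFrom_succ F hj, ih, hG.lie_map j x (D.level_mono hj hx)]

theorem seqFrom_injective {K j : ℕ} (hj : K ≤ j) {m : V} (hm : m ∈ G K)
    (h0 : seqFrom F K j m = 0) : m = 0 := by
  induction j, hj using Nat.le_induction with
  | base => rwa [seqFrom_self] at h0
  | succ j hj ih =>
    rw [seqFrom_succ F hj] at h0
    exact ih (hG.injective j _ (hG.seqFrom_mem hj hm) h0)

/-- The limit is the module of eventually coherent sequences modulo eventually zero ones. The whole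
algebra acts on it although each `G k` carries only an action of level `k`; injectivity of the `F k`
makes each `G k` embed. -/
theorem exists_isUnion : ∃ (M : Type w) (_ : AddCommGroup M) (_ : Module ℂ M)
    (_ : LieRingModule g M) (_ : LieModule ℂ g M) (Q : ∀ k, G k →ₗ[ℂ] M), D.IsUnion G M Q := by
  set N : LieSubmodule ℂ g hG.coherent := (eventuallyZero g V).comap hG.coherent.incl
  set q := LieSubmodule.Quotient.mk' N
  have hq : ∀ a : hG.coherent, q a = 0 ↔ ∃ K, ∀ j, K ≤ j → (a : ℕ → V) j = 0 := fun a =>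
    LieSubmodule.Quotient.mk_eq_zero N
  let s : ∀ k, G k →ₗ[ℂ] hG.coherent := fun k =>
    { toFun := fun m => ⟨fun j => seqFrom F k j m, k, fun j hj =>
        ⟨hG.seqFrom_mem hj m.2, seqFrom_succ F hj m⟩⟩
      map_add' := fun m m' => Subtype.ext (funext fun j => map_add (seqFrom F k j) _ _)
      map_smul' := fun t m => Subtype.ext (funext fun j => map_smul (seqFrom F k j) _ _) }
  have hs : ∀ k m j, (s k m : ℕ → V) j = seqFrom F k j m := fun _ _ _ => rfl
  refine ⟨hG.coherent ⧸ N, inferInstance, inferInstance, inferInstance, inferInstance,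
    fun k => (q : hG.coherent →ₗ[ℂ] hG.coherent ⧸ N) ∘ₗ s k, ?_, ?_, ?_⟩
  · intro k x hx m m' hm
    have h1 : s k m' = ⁅x, s k m⁆ := Subtype.ext (funext fun j => by
      rw [hs, hm, hG.seqFrom_lie hx]
      rfl)
    exact (congrArg q h1).trans (LieModuleHom.map_lie q x (s k m))
  · intro k m hm
    obtain ⟨K, hK⟩ := (hq _).1 hm
    exact Subtype.ext (hG.seqFrom_injective (le_max_left k K) m.2 (hK _ (le_max_right _ _)))
  · intro y
    obtain ⟨⟨a, K, hK⟩, rfl⟩ := LieSubmodule.Quotient.surjective_mk' N y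
    refine ⟨K, fun k hk => ⟨⟨a k, (hK k hk).1⟩, ?_⟩⟩
    refine sub_eq_zero.1 ((map_sub q _ _).symm.trans ((hq _).2 ⟨k, fun j hj => ?_⟩))
    refine sub_eq_zero.2 ?_
    rw [hs]
    induction j, hj using Nat.le_induction with
    | base => rw [seqFrom_self]; rfl
    | succ j hj ih => rw [seqFrom_succ F hj, ih]; exact (hK j (hk.trans hj)).2.symm

variable {M : Type v} [AddCommGroup M] [Module ℂ M] [LieRingModule g M] [LieModule ℂ g M]
  {Q : ∀ k, G k →ₗ[ℂ] M} (hQ : D.IsUnion G M Q)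
include hQ

/-- A non-zero submodule meets all sufficiently late `G k`, and by simplicity it contains them. Any
other vector also comes from such a `G k`. -/
theorem isIrreducible : LieModule.IsIrreducible ℂ g M := by
  have hne : (⊥ : LieSubmodule ℂ g M) ≠ ⊤ := fun h0 => by
    have h1 : Q 0 ⟨b 0, hG.mem 0⟩ ∈ (⊤ : LieSubmodule ℂ g M) := trivial
    rw [← h0, LieSubmodule.mem_bot] at h1
    exact hG.ne_zero 0 (congrArg Subtype.val (hQ.injective _ _ h1))
  have : Nontrivial (LieSubmodule ℂ g M) := ⟨⊥, ⊤, hne⟩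
  refine ⟨fun Y => or_iff_not_imp_left.2 fun hY => ?_⟩
  obtain ⟨y, hy, hy0⟩ := Submodule.exists_mem_ne_zero_of_ne_bot
    (fun h0 => hY ((LieSubmodule.toSubmodule_eq_bot _).1 h0))
  rw [eq_top_iff]
  intro c _
  obtain ⟨K, hK⟩ := hQ.surjective y
  obtain ⟨L, hL⟩ := hQ.surjective c
  obtain ⟨m, rfl⟩ := hK (max K L) (le_max_left _ _)
  obtain ⟨n, rfl⟩ := hL (max K L) (le_max_right _ _)
  generalize max K L = k at m n hy hy0 ⊢
  set Z : Submodule ℂ V := ((Y : Submodule ℂ M).comap (Q k)).map (G k).subtype with hZ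
  have hmem : ∀ m : G k, (m : V) ∈ Z ↔ Q k m ∈ Y := by
    intro m
    constructor
    · rintro ⟨m', hm', h1⟩
      rwa [← Subtype.ext h1]
    · exact fun h1 => ⟨m, h1, rfl⟩
  have hZG : Z ≤ G k := by
    rintro _ ⟨m, -, rfl⟩
    exact m.2
  have hZ' := hG.simple k Z hZG (fun x hx v hv => by
    have h1 := (hmem ⟨v, hZG hv⟩).1 hv
    refine (hmem ⟨⁅x, v⁆, hG.stable k x hx v (hZG hv)⟩).2 ?_
    rw [hQ.lie k x hx ⟨v, hZG hv⟩ _ rfl]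
    exact LieSubmodule.lie_mem _ h1) (fun h0 => by
      have h1 := (hmem m).2 hy
      rw [h0, Submodule.mem_bot] at h1
      exact hy0 (by rw [Subtype.ext h1 (a2 := (0 : G k)), map_zero]))
  exact (hmem n).1 (hZ'.ge n.2)

theorem map_mem_wtSpace {k : ℕ} {μ : Module.Dual ℂ h} (m : G k) (hm : (m : V) ∈ wtSpace h V μ) :
    Q k m ∈ wtSpace h M μ := by
  intro x
  rw [← hQ.lie k x (Submodule.mem_sup_left x.2) m (μ x • m) (hm x).symm, map_smul]

theorem isWeightModule : IsWeightModule h M := by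
  refine ⟨iSupIndep_wtSpace D.abelian, eq_top_iff.2 fun y _ => ?_⟩
  obtain ⟨K, hK⟩ := hQ.surjective y
  obtain ⟨m, rfl⟩ := hK K le_rfl
  obtain ⟨f, hf, hfm⟩ := mem_span_weight_vectors (Y := G K)
    (fun x hx => hG.stable K x (Submodule.mem_sup_left hx)) m.2 (hG.graded K m.2)
  have h1 : m = ∑ μ ∈ f.support, (⟨f μ, (hf μ).2⟩ : G K) := by
    apply Subtype.ext
    rw [AddSubmonoidClass.coe_finsetSum]
    exact hfm.symm
  rw [h1, map_sum]
  exact Submodule.sum_mem _ fun μ _ =>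
    Submodule.mem_iSup_of_mem μ (hG.map_mem_wtSpace hQ _ (hf μ).1)

theorem isIntegrableModule : IsIntegrableModule g M := by
  intro x y
  obtain ⟨n, hn⟩ := D.exists_mem_level x
  obtain ⟨K, hK⟩ := hQ.surjective y
  obtain ⟨m, rfl⟩ := hK (max K n) (le_max_left _ _)
  have hx := D.level_mono (le_max_right K n) hn
  have := hG.finiteDimensional (max K n)
  refine D.finiteDimensional_span_pow (LieModule.toEnd ℂ g M x)
    (N := LinearMap.range (Q (max K n))) ?_ ⟨m, rfl⟩
  rintro _ ⟨m', rfl⟩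
  exact ⟨⟨_, hG.stable _ x hx _ m'.2⟩, hQ.lie _ x hx m' _ rfl⟩

theorem nsmul_mem_wtSupp (k : ℕ) : k • β ∈ wtSupp h M :=
  mem_wtSupp_of_ne_zero (hG.map_mem_wtSpace hQ ⟨b k, hG.mem k⟩ (hG.mem_wtSpace k)) fun h0 =>
    hG.ne_zero k (congrArg Subtype.val (hQ.injective k _ h0))

theorem not_mem_rootsF : β ∉ rootsF h M := by
  rintro ⟨-, hF⟩
  obtain ⟨B, hB⟩ := (hF 0 (by simpa using hG.nsmul_mem_wtSupp hQ 0)).1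
  obtain ⟨k, hk⟩ := exists_nat_gt B
  refine absurd (hB (show (k : ℝ) ∈ wtString h M 0 β from ?_)) (not_le.2 hk)
  have := hG.nsmul_mem_wtSupp hQ k
  rw [wtString, Set.mem_ofPred_eq, zero_add, Complex.ofReal_natCast]
  convert this using 1
  exact Nat.cast_smul_eq_nsmul ℂ k β

end IsSimpleSystem

end RootData


/-! ### Construction of a cuspidal integrable module. -/

namespace RootData

variable {g : Type u} [LieRing g] [LieAlgebra ℂ g] {h : LieSubalgebra ℂ g} {D : RootData h}

/-- Otherwise `β + γ` would be a root with pairing 3 with the long root `β`. -/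
theorem lie_e_eq_zero_of_pairing_eq_one {β γ : Module.Dual ℂ h} (hlong : D.IsLong β)
    (hγ : γ ∈ rootSet h) (h1 : D.pairing γ β = 1) : ⁅D.e γ, D.e β⁆ = 0 := by
  by_contra h0
  have hne : β + γ ≠ 0 := by
    intro h2
    have h3 := D.pairing_add β γ β
    rw [h2, D.pairing_self hlong.1, h1] at h3
    norm_num [pairing] at h3
  have h4 := D.mem_rootSet_of_mem_of_ne_zero
    (lie_mem_wtSpace (D.e_mem hγ) (D.e_mem hlong.1)) h0 hne
  have h5 := D.pairing_le_one hlong.1 hlong (Or.inr h4) fun h6 => hγ.1 (by simpa using h6)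
  rw [pairing_add, D.pairing_self hlong.1, h1] at h5
  norm_num at h5

namespace IsTower

open LieSymAlg

variable {β : Module.Dual ℂ h} {z : ℕ → h} {δ : ℕ → Module.Dual ℂ h} (hT : D.IsTower β z δ)
include hT

theorem lie_eq_zero {k : ℕ} {x : g} (hx : x ∈ D.level k) : ⁅x, (z k : g)⁆ = 0 := by
  have := D.lie_mem_of_mem_level (N := Submodule.span ℂ {(z k : g)}) (N' := ⊥)
    (fun x hx m hm => ?_) (fun α hα m hm => ?_) hx (Submodule.mem_span_singleton_self _)
  · exact (Submodule.mem_bot ℂ).1 this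
  · obtain ⟨a, rfl⟩ := Submodule.mem_span_singleton.1 hm
    rw [lie_smul, D.abelian _ hx _ (z k).2, smul_zero]
    exact zero_mem _
  · obtain ⟨a, rfl⟩ := Submodule.mem_span_singleton.1 hm
    rw [lie_smul, D.lie_e_h (D.mem_rootSet hα), hT.apply_eq_zero k α hα, neg_zero, zero_smul,
      smul_zero]
    exact zero_mem _

theorem isBlock (k : ℕ) : D.IsBlock k k β ((D.core k (z '' Set.Iio k)).map (ι g) ^ k)
    (ι g (D.e β) ^ k) :=
  D.isBlock_pow (hT.conn.mem k) hT.long ((Set.finite_Iio k).image z) k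

theorem mul_mem (k : ℕ) {m : LieSymAlg g}
    (hm : m ∈ (D.core k (z '' Set.Iio k)).map (ι g) ^ k) :
    m * ι g (z k) ∈ (D.core (k + 1) (z '' Set.Iio (k + 1))).map (ι g) ^ (k + 1) := by
  rw [pow_succ]
  have hle : (D.Φ k : Set (Module.Dual ℂ h)) ⊆ D.Φ (k + 1) := D.mono (Nat.le_succ k)
  have hcore : (D.core k (z '' Set.Iio k)).map (ι g) ≤
      (D.core (k + 1) (z '' Set.Iio (k + 1))).map (ι g) :=
    Submodule.map_mono (Submodule.span_mono (Set.union_subset_union (Set.image_mono hle)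
      (Set.union_subset_union (Set.image_mono hle)
        (Set.image_mono (Set.image_mono fun i hi => Nat.lt_succ_of_lt hi)))))
  exact Submodule.mul_mem_mul (pow_le_pow_left' hcore k hm)
    ⟨_, D.mem_core ⟨k, Nat.lt_succ_self k, rfl⟩, rfl⟩

/-- Two root vectors map `e β ^ k * z k` to a nonzero multiple of `e β ^ (k + 1)`. -/
theorem exists_lie_lie_eq (k : ℕ) : ∃ a : ℂ, a ≠ 0 ∧
    ⁅D.e (β - δ k), ⁅D.e (δ k), ι g (D.e β) ^ k * ι g (z k)⁆⁆ = a • ι g (D.e β) ^ (k + 1) := by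
  have hβ := hT.long.1
  have hδ := D.mem_rootSet (hT.mem k)
  have hε := D.mem_rootSet (hT.sub_mem k)
  have h1 : ∀ γ ∈ rootSet h, D.pairing γ β = 1 → ⁅D.e γ, ι g (D.e β) ^ k⁆ = 0 := by
    intro γ hγ hp
    rw [lie_pow, lie_ι, lie_e_eq_zero_of_pairing_eq_one hT.long hγ hp, map_zero, mul_zero,
      smul_zero]
  have hs : β - δ k + δ k = β := sub_add_cancel _ _
  obtain ⟨N, hN⟩ := D.exists_smul hβ ⁅D.e (β - δ k), D.e (δ k)⁆ (by
    have := lie_mem_wtSpace (D.e_mem hε) (D.e_mem hδ)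
    rwa [add_comm, hs] at this)
  have hN0 : N ≠ 0 := by
    rintro rfl
    exact D.lie_e_ne_zero hε hδ (by rwa [hs]) (by rw [hN, zero_smul])
  refine ⟨-(δ k (z k)) * N, mul_ne_zero (neg_ne_zero.2 (hT.apply_ne_zero k)) hN0, ?_⟩
  have hp : D.pairing (β - δ k) β = 1 := by
    rw [pairing_sub, D.pairing_self hβ, hT.pairing_eq k]
    norm_num
  rw [lie_mul, h1 _ hδ (hT.pairing_eq k), mul_zero, add_zero, lie_ι, D.lie_e_h hδ, map_smul,
    mul_smul_comm, lie_smul, lie_mul, h1 _ hε hp, mul_zero, add_zero, lie_ι, hN, map_smul,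
    mul_smul_comm, smul_smul, ← pow_succ]

theorem exists_isSimpleSystem (hz : ∀ x : h, (∀ α ∈ rootSet h, α x = 0) → x = 0) :
    ∃ (G : ℕ → Submodule ℂ (LieSymAlg g)) (F : ℕ → LieSymAlg g →ₗ[ℂ] LieSymAlg g),
      D.IsSimpleSystem β G F fun k => ι g (D.e β) ^ k := by
  have key := fun k => (hT.isBlock k).exists_isSimplePart hz hT.long hT.conn
  choose G p hG using key
  set F : ℕ → LieSymAlg g →ₗ[ℂ] LieSymAlg g := fun k =>
    -- Multiplication by `z k` commutes with level `k`, which centralizes `z k`; it raises the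
    -- symmetric degree by one, and the Casimir polynomial projects to `G (k + 1)`.
    Polynomial.aeval (D.casimir (LieSymAlg g) (k + 1)) (p (k + 1)) ∘ₗ
      LinearMap.mulRight ℂ (ι g (z k)) with hF
  have hFa : ∀ k m, F k m =
    Polynomial.aeval (D.casimir (LieSymAlg g) (k + 1)) (p (k + 1)) (m * ι g (z k)) :=
    fun k m => rfl
  have hlie : ∀ k, ∀ x ∈ D.level k, ∀ m, F k ⁅x, m⁆ = ⁅x, F k m⁆ := by
    intro k x hx m
    rw [hFa, hFa, D.lie_aeval_casimir hz (D.level_mono (Nat.le_succ k) hx), lie_mul, lie_ι,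
      hT.lie_eq_zero hx, map_zero, mul_zero, zero_add, mul_comm]
  refine ⟨G, F, {
    finiteDimensional := fun k => ?_
    stable := fun k => (hG k).stable
    graded := fun k => (hG k).le.trans (hT.isBlock k).graded
    simple := fun k => (hG k).simple
    maps := fun k m hm => (hG (k + 1)).maps _ (hT.mul_mem k ((hG k).le hm))
    lie_map := hlie
    injective := fun k m hm h0 => ?_
    mem := fun k => (hG k).mem
    mem_wtSpace := fun k => (hT.isBlock k).mem_wtSpace
    ne_zero := fun k => (hT.isBlock k).ne_zero }⟩
  · have := (hT.isBlock k).finiteDimensional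
    exact Submodule.finiteDimensional_of_le (hG k).le
  · by_contra hm0
    have h1 := (hG k).simple (G k ⊓ LinearMap.ker (F k)) inf_le_left
      (fun x hx y hy => ⟨(hG k).stable x hx y hy.1, by
        refine LinearMap.mem_ker.2 ?_
        rw [hlie k x hx, LinearMap.mem_ker.1 hy.2, lie_zero]⟩)
      (Submodule.ne_bot_iff _ |>.2 ⟨m, ⟨hm, h0⟩, hm0⟩)
    -- A non-zero kernel would be all of `G k`. Applying the two root vectors of level `k + 1`,
    -- which commute with the projection, would then kill a non-zero multiple of `e β ^ (k + 1)`, a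
    -- vector fixed by the projection.
    have h2 : F k (ι g (D.e β) ^ k) = 0 := (h1.ge (hG k).mem).2
    obtain ⟨a, ha, h3⟩ := hT.exists_lie_lie_eq k
    have h4 := congrArg (fun y => ⁅D.e (β - δ k), ⁅D.e (δ k), y⁆⁆) h2
    simp only [hFa] at h4
    rw [D.lie_aeval_casimir hz (D.e_mem_level (hT.mem k)),
      D.lie_aeval_casimir hz (D.e_mem_level (hT.sub_mem k)), h3, map_smul,
      (hG (k + 1)).proj _ (hG (k + 1)).mem, lie_zero, lie_zero] at h4
    exact smul_ne_zero ha (hT.isBlock (k + 1)).ne_zero h4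

end IsTower

theorem exists_isCuspidalModule (D : RootData h) (hfd : ¬ FiniteDimensional ℂ g)
    (hsimple : LieAlgebra.IsSimple ℂ g) :
      ∃ (M : Type u) (_ : AddCommGroup M) (_ : Module ℂ M) (_ : LieRingModule g M)
        (_ : LieModule ℂ g M),
        LieModule.IsIrreducible ℂ g M ∧ IsWeightModule h M ∧ IsIntegrableModule g M ∧
          IsCuspidalModule h M := by
  obtain ⟨D, β, z, δ, hT⟩ := D.exists_isTower hfd hsimple
  obtain ⟨G, F, hG⟩ := hT.exists_isSimpleSystem fun x hx => D.eq_zero_of_forall_root hsimple hx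
  obtain ⟨M, _, _, _, _, Q, hQ⟩ := hG.exists_isUnion
  have hirr := hG.isIrreducible hQ
  have hint := hG.isIntegrableModule hQ
  exact ⟨M, inferInstance, inferInstance, inferInstance, inferInstance, hirr,
    hG.isWeightModule hQ, hint, (D.isCuspidalModule_or_isFiniteModule hsimple hirr hint).resolve_right
      (D.not_isFiniteModule_of_not_mem hT.long.1 (hG.not_mem_rootsF hQ))⟩

end RootData

theorem mainTheorem8 {g : Type u} [LieRing g] [LieAlgebra ℂ g] (h : LieSubalgebra ℂ g)
    (hg : IsRootReductiveDirectLimit.{u, v} h) :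
    (∀ (M : Type w) [AddCommGroup M] [Module ℂ M] [LieRingModule g M] [LieModule ℂ g M],
      LieModule.IsIrreducible ℂ g M → IsWeightModule h M → IsIntegrableModule g M →
        shadowF h M ⊔ shadowI h M = ⊤ ∧
        (shadowF h M ≠ ⊤ →
          ∀ μ ∈ wtSupp h M, ¬ FiniteDimensional ℂ (wtSpace h M μ))) ∧
    (¬ FiniteDimensional ℂ g → LieAlgebra.IsSimple ℂ g →
      (∀ (M : Type w) [AddCommGroup M] [Module ℂ M] [LieRingModule g M] [LieModule ℂ g M],
        LieModule.IsIrreducible ℂ g M → IsWeightModule h M → IsIntegrableModule g M →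
          Xor (IsCuspidalModule h M) (IsFiniteModule h M)) ∧
      (∃ (M : Type u) (_ : AddCommGroup M) (_ : Module ℂ M) (_ : LieRingModule g M)
        (_ : LieModule ℂ g M),
        LieModule.IsIrreducible ℂ g M ∧ IsWeightModule h M ∧ IsIntegrableModule g M ∧
          IsCuspidalModule h M) ∧
      (∃ (M : Type u) (_ : AddCommGroup M) (_ : Module ℂ M) (_ : LieRingModule g M)
        (_ : LieModule ℂ g M),
        LieModule.IsIrreducible ℂ g M ∧ IsWeightModule h M ∧ IsIntegrableModule g M ∧
          IsFiniteModule h M)) := by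
  obtain ⟨D⟩ := hg.nonempty_rootData
  refine ⟨fun M _ _ _ _ hirr _ hint => ⟨D.shadow_sup hint hirr, fun hF μ hμ => ?_⟩,
    fun hfd hsimple => ⟨fun M _ _ _ _ hirr hw hint =>
      D.xor_isCuspidalModule_isFiniteModule hsimple hirr hw hint, ?_, ?_⟩⟩
  · obtain ⟨α, hα, hαF⟩ := D.exists_not_mem_rootsF hF
    exact D.not_finiteDimensional_wtSpace hint hirr hα hαF hμ
  · exact D.exists_isCuspidalModule hfd hsimple
  · exact ⟨g, inferInstance, inferInstance, inferInstance, inferInstance,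
      RootData.isIrreducible_adjoint hsimple, D.isWeightModule_adjoint,
      D.isIntegrableModule_adjoint, D.isFiniteModule_adjoint hsimple⟩
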